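/- **Theorem 1 (Posterior Concentration).** *Model.* For each $n$ we observe $(Y_i,X_i,Z_i)$, $i=1,\dots,n$, with $Y_i,X_i\in\{0,1\}$ and $Z_i\in\mathbb R^d$, where $d=d_n$. The design $Z=(Z_1,\dots,Z_n)$ has an arbitrary joint law. Given $Z$, the pairs $(X_i,Y_i)$ are independent, $P(X_i=1\mid Z)=p_i(Z_i)\in(0,1)$, and $$P(Y_i=1\mid X_i,Z)=\frac{\exp(X_i\theta_0+Z_i^T\beta_0)}{1+\exp(X_i\theta_0+Z_i^T\beta_0)},$$ where $\theta_0\in\mathbb R$ is fixed and $\beta_0=\beta_{0,n}\in\mathbb R^d$ has $s=s_n$ nonzero entries. (Observations that are i.i.d. in $i$ are a special case.) Write $d\vee n=\max(d,n)$. *Posterior.* Let $\pi$ be a probability density on $\mathbb R$, not depending on $n$, and let $\Pi_\beta,\Pi_\gamma$ be prior probability measures on $\mathbb R^d$, which may depend on $n$. Draw $(\tilde\theta,\beta)$ from the posterior proportional to $\pi(\tilde\theta)\,d\tilde\theta\,\Pi_\beta(d\beta)\prod_{i}\frac{\exp(X_i\tilde\theta+Z_i^T\beta)^{Y_i}}{1+\exp(X_i\tilde\theta+Z_i^T\beta)}$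 and, independently given the data, $\gamma$ from the posterior proportional to $\Pi_\gamma(d\gamma)\prod_{i}\frac{\exp(Z_i^T\gamma)^{X_i}}{1+\exp(Z_i^T\gamma)}$. For $(\theta,\beta)\in\mathbb R\times\mathbb R^d$, $q\in(0,1)$ and $z\in\mathbb R^d$ let $$H(\theta,\beta,q,z)=\Big(1+\frac{v_0(1-q)}{v_1q}\Big)^{-1},\qquad v_k=\mu_k(1-\mu_k),\quad \mu_k=\frac{\exp(k\theta+z^T\beta)}{1+\exp(k\theta+z^T\beta)}.$$ Put $h_0(Z_i)=H(\theta_0,\beta_0,p_i(Z_i),Z_i)$, $\phi_{0i}=\theta_0h_0(Z_i)+Z_i^T\beta_0$, and put $h(Z_i)=H\big(\tilde\theta,\beta,\tfrac{\exp(Z_i^T\gamma)}{1+\exp(Z_i^T\gamma)},Z_i\big)$, $\phi_i=\tilde\theta h(Z_i)+Z_i^T\beta$. Let $$L_n(\theta\mid h,\phi)=\sum_{i=1}^n\Big[Y_i\{\theta(X_i-h(Z_i))+\phi_i\}-\log\{1+\exp(\theta(X_i-h(Z_i))+\phi_i)\}\Big],$$ $$f(\theta\mid Y,X,Z,h,\phi)=\frac{\pi(\theta)\exp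 L_n(\theta\mid h,\phi)}{\int_{\mathbb R}\pi(t)\exp L_n(t\mid h,\phi)\,dt},$$ and let $f(\theta\mid Y,X,Z)$ be the average of $f(\theta\mid Y,X,Z,h,\phi)$ over the draws of $(\tilde\theta,\beta)$ and $\gamma$. Let $\hat\theta_0$ maximize $\theta\mapsto L_n(\theta\mid h_0,\phi_0)$ over $\mathbb R$ (with an arbitrary value if there is no maximizer) and let $\sigma_n=\{-\partial_\theta^2L_n(\theta\mid h_0,\phi_0)|_{\theta=\hat\theta_0}\}^{-1/2}$. *Assumptions.* * A1: $\log d=o(n)$. * A2: $\max_{i,j}|Z_{ij}|\le C$ almost surely, for a constant $C$ not depending on $n$. * A3: $s^2\log(d\vee n)=o(\sqrt n)$. * A4: there are constants $M,C,c_1>0$ such that, for all large $n$, with probability at least $1-(d\vee n)^{-c_1}$ the posterior probability given $(Y,X,Z)$ that $\|(\tilde\theta,\beta)-(\theta_0,\beta_0)\|_1\ge Ms\sqrt{\log(d\vee n)/n}$ or $\|(\tilde\theta,\beta)-(\theta_0,\beta_0)\|_2\ge M\sqrt{s}\sqrt{\log(d\vee n)/n}$ is at most $C(d\vee n)^{-c_1}$.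 * A5: there are constants $M,C,c_2>0$ such that, for all large $n$, with probability at least $1-(d\vee n)^{-c_2}$ the posterior probability given $(X,Z)$ that $\max_{i\le n}\big|Z_i^T\gamma-\log\frac{p_i(Z_i)}{1-p_i(Z_i)}\big|\ge M\sqrt{\log(d\vee n)/n}$ is at most $C(d\vee n)^{-c_2}$. * A6: $\pi$ is continuous at $\theta_0$ and $\pi(\theta_0)>0$. * Nondegenerate information: for some $\kappa>0$, with probability tending to one, $\frac1n\sum_{i=1}^nE\big[(X_i-h_0(Z_i))^2\,\mathrm{Var}(Y_i\mid X_i,Z_i)\mid Z_i\big]\ge\kappa$. *Conclusion.* For all constants $a<b$, the marginal posterior probability $$\int_{\hat\theta_0+a\sigma_n}^{\hat\theta_0+b\sigma_n}f(\theta\mid Y,X,Z)\,d\theta$$ converges in probability, as $n\to\infty$, to $\frac1{\sqrt{2\pi}}\int_a^b e^{-z^2/2}\,dz=\Phi(b)-\Phi(a)$. -/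

import Mathlib

open MeasureTheory Filter Topology
open scoped ENNReal Matrix

namespace LogisticCP

/-- A data set `(Y, X, Z)`: `n` binary responses, `n` binary covariates of interest, and `n`
vectors of `d` nuisance covariates. -/
abbrev Obs (n d : ℕ) : Type := (Fin n → Bool) × (Fin n → Bool) × (Fin n → Fin d → ℝ)

/-- The numerical value (`0` or `1`) of a binary variable. -/
def val (b : Bool) : ℝ := if b then 1 else 0

/-- The probability that a Bernoulli variable with success probability `q` takes the value `b`. -/
def bern (q : ℝ) (b : Bool) : ℝ := if b then q else 1 - q

/-- The probability of the responses `y` in a logistic model with linear predictors `η`, namely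
`∏ i, exp (η i) ^ (y i) / (1 + exp (η i))`. -/
noncomputable def logisticLik {n : ℕ} (y : Fin n → Bool) (η : Fin n → ℝ) : ℝ :=
  ∏ i, bern (Real.sigmoid (η i)) (y i)

/-- The joint law of `(Y, X, Z)`. The design `Z` has law `Q`. Given `Z`, the pairs `(X i, Y i)` are
independent, `X i` is one with probability `p i (Z i)`, and, given `X` and `Z`, `Y i` is one with
probability `exp (X i * θ + Z i ⬝ᵥ β) / (1 + exp (X i * θ + Z i ⬝ᵥ β))`. -/
noncomputable def dataLaw {n d : ℕ} (Q : Measure (Fin n → Fin d → ℝ))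
    (p : Fin n → (Fin d → ℝ) → ℝ) (θ : ℝ) (β : Fin d → ℝ) : Measure (Obs n d) :=
  ∑ y : Fin n → Bool, ∑ x : Fin n → Bool,
    (Q.withDensity fun z => ENNReal.ofReal
      ((∏ i, bern (p i (z i)) (x i)) * logisticLik y fun i => val (x i) * θ + z i ⬝ᵥ β)).map
        fun z => (y, x, z)

/-- `P(Y = 1 | X = k, Z = z)` in the logistic model with parameters `(θ, β)`. -/
noncomputable def respProb {d : ℕ} (θ : ℝ) (β z : Fin d → ℝ) (k : Bool) : ℝ :=
  Real.sigmoid (val k * θ + z ⬝ᵥ β)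

/-- `Var(Y | X = k, Z = z)` in the logistic model with parameters `(θ, β)`. -/
noncomputable def respVar {d : ℕ} (θ : ℝ) (β z : Fin d → ℝ) (k : Bool) : ℝ :=
  respProb θ β z k * (1 - respProb θ β z k)

/-- The variance-weighted projection at `z`, for logistic parameters `(θ, β)` and the value `q` of
the propensity score at `z`. -/
noncomputable def vwProj {d : ℕ} (θ : ℝ) (β z : Fin d → ℝ) (q : ℝ) : ℝ :=
  1 / (1 + respVar θ β z false * (1 - q) / (respVar θ β z true * q))

/-- The oracle variance-weighted projections `h₀(Z)`. -/
noncomputable def oracleH {n d : ℕ} (p : Fin n → (Fin d → ℝ) → ℝ) (θ₀ : ℝ) (β₀ : Fin d → ℝ)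
    (z : Fin n → Fin d → ℝ) (i : Fin n) : ℝ :=
  vwProj θ₀ β₀ (z i) (p i (z i))

/-- The estimated variance-weighted projections `h(Z)` for a sample `((θt, β), γ)`. -/
noncomputable def sampleH {n d : ℕ} (θt : ℝ) (β γ : Fin d → ℝ)
    (z : Fin n → Fin d → ℝ) (i : Fin n) : ℝ :=
  vwProj θt β (z i) (Real.sigmoid (z i ⬝ᵥ γ))

/-- The re-parametrized nuisance quantity `φ i = θ * h i + Z i ⬝ᵥ β`. -/
def phi {n d : ℕ} (θ : ℝ) (β : Fin d → ℝ) (z : Fin n → Fin d → ℝ) (h : Fin n → ℝ)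
    (i : Fin n) : ℝ :=
  θ * h i + z i ⬝ᵥ β

/-- The linear predictors of the working model for `θ` given `h(Z)` and `φ`. -/
def workPred {n d : ℕ} (D : Obs n d) (h φ : Fin n → ℝ) (θ : ℝ) (i : Fin n) : ℝ :=
  (val (D.2.1 i) - h i) * θ + φ i

/-- The conditional log-likelihood `L_n(θ | h(Z), φ)`. -/
noncomputable def logLik {n d : ℕ} (D : Obs n d) (h φ : Fin n → ℝ) (θ : ℝ) : ℝ :=
  ∑ i, (val (D.1 i) * workPred D h φ θ i - Real.log (1 + Real.exp (workPred D h φ θ i)))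

/-- The oracle log-likelihood `θ ↦ L_n(θ | h₀(Z), φ₀)`. -/
noncomputable def oracleLogLik {n d : ℕ} (p : Fin n → (Fin d → ℝ) → ℝ) (θ₀ : ℝ)
    (β₀ : Fin d → ℝ) (D : Obs n d) : ℝ → ℝ :=
  logLik D (oracleH p θ₀ β₀ D.2.2) (phi θ₀ β₀ D.2.2 (oracleH p θ₀ β₀ D.2.2))

/-- `σ_n`, where `σ_n⁻²` is minus the second derivative of the oracle log-likelihood at `t`. -/
noncomputable def oracleSigma {n d : ℕ} (p : Fin n → (Fin d → ℝ) → ℝ) (θ₀ : ℝ)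
    (β₀ : Fin d → ℝ) (D : Obs n d) (t : ℝ) : ℝ :=
  (Real.sqrt (-iteratedDeriv 2 (oracleLogLik p θ₀ β₀ D) t))⁻¹

/-- The probability measure proportional to `lik a` times `prior (da)`. -/
noncomputable def posterior {α : Type*} [MeasurableSpace α] (prior : Measure α) (lik : α → ℝ) :
    Measure α :=
  (∫⁻ a, ENNReal.ofReal (lik a) ∂prior)⁻¹ • prior.withDensity fun a => ENNReal.ofReal (lik a)

/-- The prior law of `θ` with density `π`. -/
noncomputable def thetaPrior (π : ℝ → ℝ) : Measure ℝ :=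
  volume.withDensity fun t => ENNReal.ofReal (π t)

/-- The conditional posterior of `(θt, β)` given `(Y, X, Z)`. -/
noncomputable def thetaBetaPosterior {n d : ℕ} (π : ℝ → ℝ) (Pβ : Measure (Fin d → ℝ))
    (D : Obs n d) : Measure (ℝ × (Fin d → ℝ)) :=
  posterior ((thetaPrior π).prod Pβ)
    fun w => logisticLik D.1 fun i => val (D.2.1 i) * w.1 + D.2.2 i ⬝ᵥ w.2

/-- The conditional posterior of `γ` given `(X, Z)`. -/
noncomputable def gammaPosterior {n d : ℕ} (Pγ : Measure (Fin d → ℝ))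
    (D : Obs n d) : Measure (Fin d → ℝ) :=
  posterior Pγ fun γ => logisticLik D.2.1 fun i => D.2.2 i ⬝ᵥ γ

/-- The density `f(θ | Y, X, Z, h(Z), φ)` of the conditional posterior of `θ`. -/
noncomputable def thetaCondDensity {n d : ℕ} (π : ℝ → ℝ) (D : Obs n d) (h φ : Fin n → ℝ)
    (θ : ℝ) : ℝ≥0∞ :=
  ENNReal.ofReal (π θ * Real.exp (logLik D h φ θ)) /
    ∫⁻ t, ENNReal.ofReal (π t * Real.exp (logLik D h φ t))

/-- The marginal posterior density `f(θ | Y, X, Z)`: the conditional posterior density of `θ`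
averaged over `h(Z)` and `φ`, where `(θt, β)` and `γ` are drawn independently from their
conditional posteriors. -/
noncomputable def thetaDensity {n d : ℕ} (π : ℝ → ℝ) (Pβ Pγ : Measure (Fin d → ℝ))
    (D : Obs n d) (θ : ℝ) : ℝ≥0∞ :=
  ∫⁻ γ, ∫⁻ w, thetaCondDensity π D (sampleH w.1 w.2 γ D.2.2)
    (phi w.1 w.2 D.2.2 (sampleH w.1 w.2 γ D.2.2)) θ
      ∂(thetaBetaPosterior π Pβ D) ∂(gammaPosterior Pγ D)

/-- The marginal posterior probability of a set `A` of values of `θ`. -/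
noncomputable def thetaPosteriorProb {n d : ℕ} (π : ℝ → ℝ) (Pβ Pγ : Measure (Fin d → ℝ))
    (D : Obs n d) (A : Set ℝ) : ℝ :=
  (∫⁻ θ in A, thetaDensity π Pβ Pγ D θ).toReal

/-- The number of nonzero entries. -/
noncomputable def numNonzero {d : ℕ} (β : Fin d → ℝ) : ℕ := {j | β j ≠ 0}.ncard

/-- The `ℓ¹` distance on `ℝ × ℝ^d`. -/
def l1Dist {d : ℕ} (u v : ℝ × (Fin d → ℝ)) : ℝ := |u.1 - v.1| + ∑ j, |u.2 j - v.2 j|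

/-- The `ℓ²` distance on `ℝ × ℝ^d`. -/
noncomputable def l2Dist {d : ℕ} (u v : ℝ × (Fin d → ℝ)) : ℝ :=
  Real.sqrt ((u.1 - v.1) ^ 2 + ∑ j, (u.2 j - v.2 j) ^ 2)

/-- `d ∨ n` as a real number. -/
def dvn (d n : ℕ) : ℝ := ((max d n : ℕ) : ℝ)

/-- The rate `√(log (d ∨ n) / n)`. -/
noncomputable def rate (d n : ℕ) : ℝ := Real.sqrt (Real.log (dvn d n) / n)

/-- The odds `q / (1 - q)`. -/
noncomputable def odds (q : ℝ) : ℝ := q / (1 - q)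

/-- The conditional Fisher information `E[(X i - h₀(Z i))² Var(Y i | X i, Z i) | Z i]` about `θ`
carried by the `i`-th observation in the oracle likelihood, at the true parameters. -/
noncomputable def condInfo {n d : ℕ} (p : Fin n → (Fin d → ℝ) → ℝ) (θ₀ : ℝ) (β₀ : Fin d → ℝ)
    (z : Fin n → Fin d → ℝ) (i : Fin n) : ℝ :=
  ∑ k : Bool, bern (p i (z i)) k * (val k - oracleH p θ₀ β₀ z i) ^ 2 * respVar θ₀ β₀ (z i) k

end LogisticCP

open LogisticCP

/-! Given `(h, φ)`, the likelihood of `θ` is a one-parameter logistic likelihood, hence log-concave,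
and its posterior is asymptotically normal by Laplace approximation. The limit is the same for most
draws of the nuisance quantities provided that, on the scale `1/√n` around the oracle estimator, the
perturbed log-likelihood has the quadratic shape of the oracle one. Since the derivatives of the
logistic function are bounded by absolute constants, it suffices that at `θ₀` the perturbed score is
within `o(√n)`, and the perturbed information within `o(n)`, of its oracle version
(`abs_local_quadratic_le`, `laplace_ratio`, combined in `posterior_ratio_close`).

The information is Lipschitz in the nuisance errors, so their uniform smallness is enough. The score
is the delicate part: a Lipschitz bound would only give order `s √(n log (d ∨ n))`. The gain comes
from Neyman orthogonality. On the logit scale the projection is `sigmoid (logit q + log (v₁ / v₀))`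
(`vwProj_eq_sigmoid`), so the score expands to second order with absolute constants, without
bounding propensities or variances away from zero. Every first-order coefficient is a residual times
a function of `(X, Z)`, or `(X - h₀) Var(Y | X, Z)` times a function of `Z`; both are centred given
`Z`, the second by the choice of `h₀` (`sum_obsWt_mul_orth`). By Hoeffding's inequality and a union
bound over coordinates the coefficient sums are of order `√(n log (d ∨ n))`; paired with the `ℓ¹`
error of `(θt, β)` they contribute `s log (d ∨ n)`, while the remainder contributes `s² log (d ∨
n)`. Both are `o(√n)` by A3.

The propensity error is controlled only in supremum norm, so no union bound is available for it.
Instead, the posterior of `γ` depends on `(X, Z)` alone: for fixed `γ`, `X`, `Z` the residuals of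
`Y` are still independent and centred. Hoeffding's inequality for each `γ`, followed by Fubini and
Markov, shows that the posterior mass of the harmful `γ` is small
(`lintegral_gammaPosterior_largePropEffect_le`). Finally, conditional probabilities lie in `[0, 1]`,
so bad draws cost at most their posterior mass (`lintegral_lintegral_close`). -/

namespace LogisticCP

/-! ### Scalar estimates for the logistic function -/

/-- The variance `σ (1 - σ)` of a Bernoulli variable with logit `x`. -/
noncomputable def sigVar (x : ℝ) : ℝ := Real.sigmoid x * (1 - Real.sigmoid x)

/-- The cumulant function `log (1 + exp x)` of the logistic model. -/
noncomputable def softplus (x : ℝ) : ℝ := Real.log (1 + Real.exp x)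

lemma sigVar_pos (x : ℝ) : 0 < sigVar x :=
  mul_pos (Real.sigmoid_pos x) (sub_pos.2 (Real.sigmoid_lt_one x))

lemma sigVar_le_one (x : ℝ) : sigVar x ≤ 1 := by
  have h1 := Real.sigmoid_pos x
  have h2 := Real.sigmoid_lt_one x
  unfold sigVar; nlinarith

lemma hasDerivAt_softplus (x : ℝ) : HasDerivAt softplus (Real.sigmoid x) x := by
  have h : HasDerivAt (fun x => 1 + Real.exp x) (Real.exp x) x :=
    (Real.hasDerivAt_exp x).const_add 1
  have := h.log (by positivity)
  refine this.congr_deriv ?_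
  rw [Real.sigmoid_def, Real.exp_neg]
  have := Real.exp_pos x
  field_simp
  ring

lemma hasDerivAt_sigVar (x : ℝ) :
    HasDerivAt sigVar (sigVar x * (1 - 2 * Real.sigmoid x)) x := by
  have h := Real.hasDerivAt_sigmoid x
  have h2 := h.mul (h.const_sub 1)
  refine h2.congr_deriv ?_
  unfold sigVar; ring

/-- Mean value inequality, with the derivative controlled only on `|s| ≤ |t|`. This lets each Taylor
bound below follow from the one of lower order, applied to the derivative of the remainder; the
constants are not sharp. -/
lemma abs_sub_zero_le_of_deriv {g g' : ℝ → ℝ} (hg : ∀ s, HasDerivAt g (g' s) s) {B t : ℝ}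
    (h : ∀ s, |s| ≤ |t| → |g' s| ≤ B) : |g t - g 0| ≤ B * |t| := by
  have := (convex_Icc (-|t|) |t|).norm_image_sub_le_of_norm_hasDerivWithin_le (f := g) (f' := g')
    (C := B) (fun x _ => (hg x).hasDerivWithinAt) (fun x hx => h x (abs_le.2 hx))
    (x := 0) (y := t) ⟨by simp, by simp⟩ (abs_le.1 le_rfl)
  simpa using this

lemma abs_sigmoid_add_sub_le (x t : ℝ) : |Real.sigmoid (x + t) - Real.sigmoid x| ≤ |t| := by
  have := abs_sub_zero_le_of_deriv (g := fun s => Real.sigmoid (x + s))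
    (g' := fun s => sigVar (x + s)) (fun s => (Real.hasDerivAt_sigmoid (x + s)).comp_const_add x s)
    (B := 1) (t := t) (fun s _ => by
      rw [abs_of_pos (sigVar_pos _)]; exact sigVar_le_one _)
  simpa using this

lemma abs_sigVar_add_sub_le (x t : ℝ) : |sigVar (x + t) - sigVar x| ≤ |t| := by
  have := abs_sub_zero_le_of_deriv (g := fun s => sigVar (x + s))
    (g' := fun s => sigVar (x + s) * (1 - 2 * Real.sigmoid (x + s)))
    (fun s => (hasDerivAt_sigVar (x + s)).comp_const_add x s)
    (B := 1) (t := t) (fun s _ => by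
      have h0 := sigVar_pos (x + s)
      have h1 := sigVar_le_one (x + s)
      have h2 := Real.sigmoid_pos (x + s)
      have h3 := Real.sigmoid_lt_one (x + s)
      rw [abs_mul, abs_of_pos h0]
      exact mul_le_one₀ h1 (abs_nonneg _) (abs_le.2 ⟨by linarith, by linarith⟩))
  simpa using this

lemma abs_sigmoid_taylor_le (x t : ℝ) :
    |Real.sigmoid (x + t) - Real.sigmoid x - sigVar x * t| ≤ t ^ 2 := by
  have := abs_sub_zero_le_of_deriv (g := fun s => Real.sigmoid (x + s) - sigVar x * s)
    (g' := fun s => sigVar (x + s) - sigVar x * 1)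
    (fun s => ((Real.hasDerivAt_sigmoid (x + s)).comp_const_add x s).sub
      ((hasDerivAt_id s).const_mul _))
    (B := |t|) (t := t) (fun s hs => by
      rw [mul_one]; exact (abs_sigVar_add_sub_le x s).trans hs)
  rw [← sq, sq_abs] at this
  refine le_trans (le_of_eq ?_) this
  congr 1; simp; ring

lemma abs_softplus_taylor_le (x t : ℝ) :
    |softplus (x + t) - softplus x - Real.sigmoid x * t| ≤ t ^ 2 := by
  have := abs_sub_zero_le_of_deriv (g := fun s => softplus (x + s) - Real.sigmoid x * s)
    (g' := fun s => Real.sigmoid (x + s) - Real.sigmoid x * 1)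
    (fun s => ((hasDerivAt_softplus (x + s)).comp_const_add x s).sub
      ((hasDerivAt_id s).const_mul _))
    (B := |t|) (t := t) (fun s hs => by
      rw [mul_one]; exact (abs_sigmoid_add_sub_le x s).trans hs)
  rw [← sq, sq_abs] at this
  refine le_trans (le_of_eq ?_) this
  congr 1; simp; ring

lemma abs_softplus_taylor_two_le (x t : ℝ) :
    |softplus (x + t) - softplus x - Real.sigmoid x * t - sigVar x * t ^ 2 / 2| ≤ |t| ^ 3 := by
  have := abs_sub_zero_le_of_deriv
    (g := fun s => softplus (x + s) - Real.sigmoid x * s - sigVar x / 2 * s ^ 2)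
    (g' := fun s => Real.sigmoid (x + s) - Real.sigmoid x * 1
      - sigVar x / 2 * (((2 : ℕ) : ℝ) * s ^ (2 - 1)))
    (fun s => (((hasDerivAt_softplus (x + s)).comp_const_add x s).sub
      ((hasDerivAt_id s).const_mul _)).sub ((hasDerivAt_pow 2 s).const_mul _))
    (B := |t| ^ 2) (t := t) (fun s hs => by
      have h1 := abs_sigmoid_taylor_le x s
      have h2 : s ^ 2 ≤ |t| ^ 2 := by rw [← sq_abs s]; gcongr
      refine le_trans (le_of_eq ?_) (h1.trans h2)
      congr 1; simp; ring)
  rw [← pow_succ] at this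
  refine le_trans (le_of_eq ?_) this
  congr 1; simp; ring

/-! ### The conditional log-likelihood -/

lemma val_nonneg (b : Bool) : 0 ≤ val b := by cases b <;> simp [val]

lemma val_le_one (b : Bool) : val b ≤ 1 := by cases b <;> simp [val]

lemma abs_val_sub_le {q : ℝ} (h0 : 0 ≤ q) (h1 : q ≤ 1) (b : Bool) : |val b - q| ≤ 1 :=
  abs_le.2 ⟨by linarith [val_nonneg b], by linarith [val_le_one b]⟩

/-- The score of the conditional log-likelihood. -/
noncomputable def score {n d : ℕ} (D : Obs n d) (h φ : Fin n → ℝ) (θ : ℝ) : ℝ :=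
  ∑ i, (val (D.2.1 i) - h i) * (val (D.1 i) - Real.sigmoid (workPred D h φ θ i))

/-- The observed information of the conditional log-likelihood. -/
noncomputable def obsInfo {n d : ℕ} (D : Obs n d) (h φ : Fin n → ℝ) (θ : ℝ) : ℝ :=
  ∑ i, (val (D.2.1 i) - h i) ^ 2 * sigVar (workPred D h φ θ i)

section LogLik

variable {n d : ℕ} (D : Obs n d) (h φ : Fin n → ℝ)

lemma workPred_add (θ t : ℝ) (i : Fin n) :
    workPred D h φ (θ + t) i = workPred D h φ θ i + (val (D.2.1 i) - h i) * t := by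
  unfold workPred; ring

lemma hasDerivAt_workPred (θ : ℝ) (i : Fin n) :
    HasDerivAt (fun t => workPred D h φ t i) (val (D.2.1 i) - h i) θ := by
  have := ((hasDerivAt_id θ).const_mul (val (D.2.1 i) - h i)).add_const (φ i)
  simpa [workPred] using this

lemma hasDerivAt_logLik (θ : ℝ) : HasDerivAt (logLik D h φ) (score D h φ θ) θ := by
  unfold logLik score
  refine HasDerivAt.fun_sum fun i _ => ?_
  have h1 := hasDerivAt_workPred D h φ θ i
  have h2 := (hasDerivAt_softplus (workPred D h φ θ i)).comp θ h1
  have h3 := (h1.const_mul (val (D.1 i))).sub h2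
  refine h3.congr_deriv ?_
  ring

lemma hasDerivAt_score (θ : ℝ) : HasDerivAt (score D h φ) (-obsInfo D h φ θ) θ := by
  unfold score obsInfo
  rw [← Finset.sum_neg_distrib]
  refine HasDerivAt.fun_sum fun i _ => ?_
  have h1 := hasDerivAt_workPred D h φ θ i
  have h2 := (Real.hasDerivAt_sigmoid (workPred D h φ θ i)).comp θ h1
  have h3 := (h2.const_sub (val (D.1 i))).const_mul (val (D.2.1 i) - h i)
  refine h3.congr_deriv ?_
  unfold sigVar; ring

lemma deriv_logLik : deriv (logLik D h φ) = score D h φ :=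
  funext fun θ => (hasDerivAt_logLik D h φ θ).deriv

lemma iteratedDeriv_two_logLik (θ : ℝ) :
    iteratedDeriv 2 (logLik D h φ) θ = -obsInfo D h φ θ := by
  rw [iteratedDeriv_succ, iteratedDeriv_one, deriv_logLik]
  exact (hasDerivAt_score D h φ θ).deriv

lemma obsInfo_nonneg (θ : ℝ) : 0 ≤ obsInfo D h φ θ :=
  Finset.sum_nonneg fun _ _ => mul_nonneg (sq_nonneg _) (sigVar_pos _).le

lemma differentiable_logLik : Differentiable ℝ (logLik D h φ) :=
  fun θ => (hasDerivAt_logLik D h φ θ).differentiableAt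

lemma antitone_score : Antitone (score D h φ) := by
  refine antitone_of_deriv_nonpos (fun θ => (hasDerivAt_score D h φ θ).differentiableAt) fun θ => ?_
  rw [(hasDerivAt_score D h φ θ).deriv]
  linarith [obsInfo_nonneg D h φ θ]

lemma concaveOn_logLik : ConcaveOn ℝ Set.univ (logLik D h φ) := by
  refine Antitone.concaveOn_univ_of_deriv (differentiable_logLik D h φ) ?_
  rw [deriv_logLik]; exact antitone_score D h φ

lemma val_mul_le_softplus (b : Bool) (x : ℝ) : val b * x ≤ softplus x := by
  unfold softplus
  have hx := Real.exp_pos x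
  cases b
  · simp only [val]; simp; apply Real.log_nonneg; linarith
  · simp only [val]; simp
    calc x = Real.log (Real.exp x) := (Real.log_exp x).symm
      _ ≤ _ := Real.log_le_log hx (by linarith)

/-- Each factor of the likelihood is a probability. This makes the unnormalized posterior integrable
for any prior density. -/
lemma logLik_nonpos (θ : ℝ) : logLik D h φ θ ≤ 0 :=
  Finset.sum_nonpos fun _ _ => sub_nonpos.2 (val_mul_le_softplus _ _)

lemma abs_sum_le_of_abs_le {n : ℕ} {f : Fin n → ℝ} {B : ℝ} (hf : ∀ i, |f i| ≤ B) :
    |∑ i, f i| ≤ n * B := by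
  calc |∑ i, f i| ≤ ∑ i, |f i| := Finset.abs_sum_le_sum_abs _ _
    _ ≤ ∑ _i : Fin n, B := Finset.sum_le_sum fun i _ => hf i
    _ = n * B := by simp

variable {h}

lemma abs_mul_le_of_abs_le_one {c x B : ℝ} (hc : |c| ≤ 1) (hx : |x| ≤ B) : |c * x| ≤ B := by
  rw [abs_mul]
  exact (mul_le_of_le_one_left (abs_nonneg x) hc).trans hx

/-- Here and in the two expansions that follow, `|X - h| ≤ 1` is the only property of the nuisance
used, so the bounds are uniform over all draws of `(h, φ)`. -/
lemma abs_obsInfo_add_sub_le (hh : ∀ i, |val (D.2.1 i) - h i| ≤ 1) (θ t : ℝ) :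
    |obsInfo D h φ (θ + t) - obsInfo D h φ θ| ≤ n * |t| := by
  unfold obsInfo
  rw [← Finset.sum_sub_distrib]
  refine abs_sum_le_of_abs_le fun i => ?_
  rw [← mul_sub, workPred_add]
  refine abs_mul_le_of_abs_le_one ?_ ((abs_sigVar_add_sub_le _ _).trans
    (abs_mul_le_of_abs_le_one (hh i) le_rfl))
  rw [abs_pow]; exact pow_le_one₀ (abs_nonneg _) (hh i)

lemma abs_score_taylor_le (hh : ∀ i, |val (D.2.1 i) - h i| ≤ 1) (θ t : ℝ) :
    |score D h φ (θ + t) - score D h φ θ + obsInfo D h φ θ * t| ≤ n * t ^ 2 := by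
  unfold obsInfo score
  rw [← Finset.sum_sub_distrib, Finset.sum_mul, ← Finset.sum_add_distrib]
  refine abs_sum_le_of_abs_le fun i => ?_
  rw [workPred_add]
  set c := val (D.2.1 i) - h i
  have h1 := abs_sigmoid_taylor_le (workPred D h φ θ i) (c * t)
  have h2 : (c * t) ^ 2 ≤ t ^ 2 := by
    rw [mul_pow]
    exact mul_le_of_le_one_left (sq_nonneg _) (by
      rw [← sq_abs]; exact pow_le_one₀ (abs_nonneg _) (hh i))
  have h3 := abs_mul_le_of_abs_le_one (c := -c) (by rw [abs_neg]; exact hh i) (h1.trans h2)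
  refine le_trans (le_of_eq ?_) h3
  congr 1; ring

lemma abs_logLik_taylor_le (hh : ∀ i, |val (D.2.1 i) - h i| ≤ 1) (θ t : ℝ) :
    |logLik D h φ (θ + t) - logLik D h φ θ - score D h φ θ * t + obsInfo D h φ θ * t ^ 2 / 2|
      ≤ n * |t| ^ 3 := by
  unfold obsInfo score logLik
  rw [← Finset.sum_sub_distrib, Finset.sum_mul, ← Finset.sum_sub_distrib, Finset.sum_mul,
    Finset.sum_div, ← Finset.sum_add_distrib]
  refine abs_sum_le_of_abs_le fun i => ?_
  rw [workPred_add]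
  set c := val (D.2.1 i) - h i
  have h1 := abs_softplus_taylor_two_le (workPred D h φ θ i) (c * t)
  have h2 : |c * t| ^ 3 ≤ |t| ^ 3 := by
    have := abs_mul_le_of_abs_le_one (hh i) (le_refl |t|)
    gcongr
  refine le_trans (le_of_eq ?_) (h1.trans h2)
  rw [← abs_neg]
  unfold softplus
  congr 1; ring

end LogLik

/-! ### Laplace approximation for concave log-densities -/

/-- The standard normal probability of an interval, as it appears in the theorem. -/
noncomputable def gaussProb (a b : ℝ) : ℝ :=
  1 / Real.sqrt (2 * Real.pi) * ∫ u in a..b, Real.exp (-(1 / 2) * u ^ 2)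

/-- For `u ≥ 1` the chord from `0` to `u` gives `g u ≤ u * g 1`. For `u ≤ 1` the chord from `-1` to
`u` passes below `g 0 = 0`, giving `g u ≤ u`. The constant `5 / 4` makes the affine bound dominate
both. -/
lemma concave_le_of_nonneg {g : ℝ → ℝ} (hg : ConcaveOn ℝ Set.univ g) (h0 : g 0 = 0)
    (h1 : g 1 ≤ -1 / 4) (h2 : -1 ≤ g (-1)) {u : ℝ} (hu : 0 ≤ u) : g u ≤ 5 / 4 - u / 4 := by
  rcases le_total 1 u with h | h
  · have hpos : 0 < u := by linarith
    have := hg.2 (Set.mem_univ u) (Set.mem_univ 0) (show 0 ≤ 1 / u by positivity)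
      (show 0 ≤ 1 - 1 / u by rw [sub_nonneg, div_le_one hpos]; exact h) (by ring)
    simp only [smul_eq_mul, mul_zero, add_zero, h0] at this
    rw [one_div, inv_mul_cancel₀ hpos.ne', inv_mul_le_iff₀ hpos] at this
    nlinarith
  · have hpos : 0 < 1 + u := by linarith
    have := hg.2 (Set.mem_univ (-1)) (Set.mem_univ u)
      (show 0 ≤ u / (1 + u) by positivity) (show 0 ≤ 1 / (1 + u) by positivity)
      (by field_simp; ring)
    simp only [smul_eq_mul] at this
    have e1 : u / (1 + u) * -1 + 1 / (1 + u) * u = 0 := by ring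
    have e2 : u / (1 + u) * g (-1) + 1 / (1 + u) * g u = (u * g (-1) + g u) / (1 + u) := by ring
    rw [e1, h0, e2, div_le_iff₀ hpos, zero_mul] at this
    nlinarith

lemma concave_le_sub_abs {g : ℝ → ℝ} (hg : ConcaveOn ℝ Set.univ g) (h0 : g 0 = 0)
    (h1 : g 1 ≤ -1 / 4) (h1' : -1 ≤ g 1) (h2 : -1 ≤ g (-1)) (h2' : g (-1) ≤ -1 / 4) (u : ℝ) :
    g u ≤ 5 / 4 - |u| / 4 := by
  rcases le_total 0 u with h | h
  · rw [abs_of_nonneg h]; exact concave_le_of_nonneg hg h0 h1 h2 h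
  · rw [abs_of_nonpos h]
    have hg' : ConcaveOn ℝ Set.univ fun x => g (-x) := by
      have := hg.comp_linearMap (-LinearMap.id)
      simpa [Function.comp_def] using this
    have := concave_le_of_nonneg (g := fun x => g (-x)) hg' (by simpa using h0) h2'
      (by simpa using h1') (u := -u) (by linarith)
    simpa using this

lemma integrable_exp_neg_abs_div : Integrable fun u : ℝ => Real.exp (5 / 4 - |u| / 4) := by
  have h : Integrable fun u : ℝ => Real.exp (-(1 / 4) * |u|) := by
    rw [← integrableOn_univ, ← Set.Iic_union_Ioi (a := (0 : ℝ))]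
    refine IntegrableOn.union ?_ ?_
    · refine (integrableOn_exp_mul_Iic (show (0 : ℝ) < 1 / 4 by norm_num) 0).congr_fun
        (fun u hu => ?_) measurableSet_Iic
      simp only
      rw [abs_of_nonpos (Set.mem_Iic.1 hu)]; congr 1; ring
    · refine (integrableOn_exp_mul_Ioi (show -(1 / 4 : ℝ) < 0 by norm_num) 0).congr_fun
        (fun u hu => ?_) measurableSet_Ioi
      simp only
      rw [abs_of_pos (Set.mem_Ioi.1 hu)]
  refine (h.const_mul (Real.exp (5 / 4))).congr (Eventually.of_forall fun u => ?_)
  simp only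
  rw [← Real.exp_add]; congr 1; ring

lemma integrable_density {π : ℝ → ℝ} (hm : Measurable π) (h0 : ∀ t, 0 ≤ π t)
    (h1 : ∫⁻ t, ENNReal.ofReal (π t) = 1) : Integrable π := by
  refine ⟨hm.aestronglyMeasurable, ?_⟩
  rw [hasFiniteIntegral_iff_ofReal (Eventually.of_forall h0), h1]
  exact ENNReal.one_lt_top

lemma integral_density {π : ℝ → ℝ} (hm : Measurable π) (h0 : ∀ t, 0 ≤ π t)
    (h1 : ∫⁻ t, ENNReal.ofReal (π t) = 1) : ∫ t, π t = 1 := by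
  rw [integral_eq_lintegral_of_nonneg_ae (Eventually.of_forall h0) hm.aestronglyMeasurable, h1]
  simp

lemma integral_comp_affine (f : ℝ → ℝ) (m : ℝ) {σ : ℝ} (hσ : 0 < σ) :
    ∫ u, f (m + σ * u) = σ⁻¹ * ∫ t, f t := by
  have h := Measure.integral_comp_mul_left (fun t => f (m + t)) σ
  rw [h, integral_add_left_eq_self f m, abs_of_pos (inv_pos.2 hσ), smul_eq_mul]

lemma integrable_comp_affine {f : ℝ → ℝ} (hf : Integrable f) (m : ℝ) {σ : ℝ} (hσ : 0 < σ) :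
    Integrable fun u => f (m + σ * u) :=
  (hf.comp_add_left m).comp_mul_left' hσ.ne'

lemma tendsto_exp_neg_div_div {δ : ℝ} (hδ : 0 < δ) {s : ℕ → ℝ} (hs0 : ∀ k, 0 < s k)
    (hs : Tendsto s atTop (𝓝 0)) :
    Tendsto (fun k => Real.exp (5 / 4 - δ / s k / 4) * (s k)⁻¹) atTop (𝓝 0) := by
  have h1 : Tendsto (fun k => (s k)⁻¹) atTop atTop :=
    tendsto_inv_nhdsGT_zero.comp (tendsto_nhdsWithin_iff.2 ⟨hs, Eventually.of_forall hs0⟩)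
  have h2 := (Real.tendsto_pow_mul_exp_neg_atTop_nhds_zero 1).comp
    (h1.const_mul_atTop (show 0 < δ / 4 by positivity))
  have h3 := h2.const_mul (Real.exp (5 / 4) * (4 / δ))
  rw [mul_zero] at h3
  refine h3.congr fun k => ?_
  have := hs0 k
  simp only [Function.comp, pow_one, sub_eq_add_neg, Real.exp_add]
  rw [show -(δ / s k / 4) = -(δ / 4 * (s k)⁻¹) by ring]
  field_simp

/-- The prior is bounded only near `θ₀`, so the integral is split at `s k * |u| = δ`. Near the
centre dominated convergence applies; far away the exponential is uniformly tiny and `π` is merely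
integrated. -/
lemma tendsto_setIntegral_laplace {π : ℝ → ℝ} (hm : Measurable π) (h0 : ∀ t, 0 ≤ π t)
    (h1 : ∫⁻ t, ENNReal.ofReal (π t) = 1) {θ₀ : ℝ} (hc : ContinuousAt π θ₀)
    {s m : ℕ → ℝ} {g : ℕ → ℝ → ℝ} (hs0 : ∀ k, 0 < s k) (hs : Tendsto s atTop (𝓝 0))
    (hmt : Tendsto m atTop (𝓝 θ₀)) (hg : ∀ k, ConcaveOn ℝ Set.univ (g k))
    (hg0 : ∀ k, g k 0 = 0) (hgm : ∀ k, Measurable (g k))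
    (hlim : ∀ u, Tendsto (fun k => g k u) atTop (𝓝 (-(1 / 2) * u ^ 2)))
    {S : Set ℝ} :
    Tendsto (fun k => ∫ u in S, π (m k + s k * u) * Real.exp (g k u)) atTop
      (𝓝 (π θ₀ * ∫ u in S, Real.exp (-(1 / 2) * u ^ 2))) := by
  have hπi := integrable_density hm h0 h1
  -- The radius `2 * δ` leaves one `δ` for the drift of the centre `m k` and one for `s k * u`.
  obtain ⟨δ, hδ, hδπ⟩ : ∃ δ > 0, ∀ t, |t - θ₀| < 2 * δ → π t ≤ π θ₀ + 1 := by
    obtain ⟨δ, hδ, h⟩ := Metric.continuousAt_iff.1 hc 1 one_pos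
    refine ⟨δ / 2, by positivity, fun t ht => ?_⟩
    have := h (x := t) (by rw [Real.dist_eq]; linarith)
    rw [Real.dist_eq] at this
    linarith [(abs_lt.1 this).2]
  -- By concavity, convergence at the two points `1` and `-1` already yields an integrable envelope
  -- on the whole line.
  have hbound : ∀ᶠ k in atTop, ∀ u, g k u ≤ 5 / 4 - |u| / 4 := by
    have e1 := (hlim 1)
    have e2 := (hlim (-1))
    norm_num at e1 e2
    filter_upwards [e1.eventually_le_const (show -(1 / 2 : ℝ) < -1 / 4 by norm_num),
      e1.eventually_const_le (show (-1 : ℝ) < -(1 / 2) by norm_num),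
      e2.eventually_le_const (show -(1 / 2 : ℝ) < -1 / 4 by norm_num),
      e2.eventually_const_le (show (-1 : ℝ) < -(1 / 2) by norm_num)] with k k1 k2 k3 k4
    exact concave_le_sub_abs (hg k) (hg0 k) k1 k2 k4 k3
  set F : ℕ → ℝ → ℝ := fun k u => π (m k + s k * u) * Real.exp (g k u) with hF
  have hFm : ∀ k, Measurable (F k) := fun k =>
    (hm.comp ((measurable_id.const_mul _).const_add _)).mul (Real.measurable_exp.comp (hgm k))
  have hFi : ∀ᶠ k in atTop, Integrable (F k) := by
    filter_upwards [hbound] with k hk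
    refine ((integrable_comp_affine hπi (m k) (hs0 k)).mul_const (Real.exp (5 / 4))).mono'
      (hFm k).aestronglyMeasurable (Eventually.of_forall fun u => ?_)
    rw [Real.norm_of_nonneg (mul_nonneg (h0 _) (Real.exp_pos _).le)]
    refine mul_le_mul_of_nonneg_left (Real.exp_le_exp.2 ?_) (h0 _)
    linarith [hk u, abs_nonneg u]
  have hAm : ∀ k, MeasurableSet {u : ℝ | s k * |u| < δ} := fun k =>
    measurableSet_lt (by fun_prop) measurable_const
  have hnear : Tendsto (fun k => ∫ u in S, {u | s k * |u| < δ}.indicator (F k) u) atTop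
      (𝓝 (∫ u in S, π θ₀ * Real.exp (-(1 / 2) * u ^ 2))) := by
    refine tendsto_integral_filter_of_dominated_convergence
      (fun u => (π θ₀ + 1) * Real.exp (5 / 4 - |u| / 4))
      (Eventually.of_forall fun k => ((hFm k).indicator (hAm k)).aestronglyMeasurable) ?_
      (integrable_exp_neg_abs_div.const_mul _).integrableOn
      (Eventually.of_forall fun u => ?_)
    · filter_upwards [hbound, hmt (Metric.ball_mem_nhds θ₀ hδ)] with k hk hmk
      refine Eventually.of_forall fun u => ?_
      by_cases hu : s k * |u| < δ
      · rw [Set.indicator_of_mem (by exact hu),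
          Real.norm_of_nonneg (mul_nonneg (h0 _) (Real.exp_pos _).le)]
        refine mul_le_mul (hδπ _ ?_) (Real.exp_le_exp.2 (hk u)) (Real.exp_pos _).le
          (by linarith [h0 θ₀])
        have hmk' : |m k - θ₀| < δ := by simpa [Real.dist_eq] using hmk
        calc |m k + s k * u - θ₀| = |(m k - θ₀) + s k * u| := by congr 1; ring
          _ ≤ |m k - θ₀| + |s k * u| := abs_add_le _ _
          _ < 2 * δ := by rw [abs_mul, abs_of_pos (hs0 k)]; linarith
      · rw [Set.indicator_of_notMem (by exact hu), norm_zero]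
        have := h0 θ₀
        positivity
    · have hsu : Tendsto (fun k => s k * |u|) atTop (𝓝 0) := by simpa using hs.mul_const |u|
      have hmu : Tendsto (fun k => m k + s k * u) atTop (𝓝 θ₀) := by
        simpa using hmt.add (hs.mul_const u)
      have := (hc.tendsto.comp hmu).mul ((Real.continuous_exp.tendsto _).comp (hlim u))
      refine this.congr' ?_
      filter_upwards [hsu.eventually_lt_const hδ] with k hk
      rw [Set.indicator_of_mem (by exact hk)]
      rfl
  -- The substitution back to `t` costs a factor `1 / s k`, which `exp (-δ / (4 s k))` overwhelms.
  have hfar : Tendsto (fun k => ∫ u in S, {u | s k * |u| < δ}ᶜ.indicator (F k) u) atTop (𝓝 0) := by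
    refine squeeze_zero_norm' ?_ (tendsto_exp_neg_div_div hδ hs0 hs)
    filter_upwards [hbound] with k hk
    have hi := (integrable_comp_affine hπi (m k) (hs0 k)).const_mul
      (Real.exp (5 / 4 - δ / s k / 4))
    calc ‖∫ u in S, {u | s k * |u| < δ}ᶜ.indicator (F k) u‖
        ≤ ∫ u in S, Real.exp (5 / 4 - δ / s k / 4) * π (m k + s k * u) := by
          refine norm_integral_le_of_norm_le hi.integrableOn (Eventually.of_forall fun u => ?_)
          by_cases hu : s k * |u| < δ
          · rw [Set.indicator_of_notMem (by simpa using hu), norm_zero]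
            exact mul_nonneg (Real.exp_pos _).le (h0 _)
          · rw [Set.indicator_of_mem (by simpa using hu),
              Real.norm_of_nonneg (mul_nonneg (h0 _) (Real.exp_pos _).le), mul_comm]
            refine mul_le_mul_of_nonneg_right (Real.exp_le_exp.2 ((hk u).trans ?_)) (h0 _)
            have : δ / s k ≤ |u| := by
              rw [div_le_iff₀ (hs0 k), mul_comm]; exact not_lt.1 hu
            linarith
      _ ≤ ∫ u, Real.exp (5 / 4 - δ / s k / 4) * π (m k + s k * u) :=
          setIntegral_le_integral hi
            (Eventually.of_forall fun u => mul_nonneg (Real.exp_pos _).le (h0 _))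
      _ = Real.exp (5 / 4 - δ / s k / 4) * (s k)⁻¹ := by
          rw [integral_const_mul, integral_comp_affine π (m k) (hs0 k), integral_density hm h0 h1,
            mul_one]
  have := hnear.add hfar
  rw [add_zero, integral_const_mul] at this
  refine this.congr' ?_
  filter_upwards [hFi] with k hk
  rw [← integral_add (hk.indicator (hAm k)).integrableOn (hk.indicator (hAm k).compl).integrableOn]
  refine integral_congr_ae (Eventually.of_forall fun u => ?_)
  exact congrFun (Set.indicator_self_add_compl _ (F k)) u

lemma setIntegral_Ioo_affine (f : ℝ → ℝ) (m a b : ℝ) {σ : ℝ} (hσ : 0 < σ) :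
    ∫ t in Set.Ioo (m + a * σ) (m + b * σ), f t = σ * ∫ u in Set.Ioo a b, f (m + σ * u) := by
  rw [← integral_indicator measurableSet_Ioo, ← integral_indicator measurableSet_Ioo]
  have h := integral_comp_affine ((Set.Ioo (m + a * σ) (m + b * σ)).indicator f) m hσ
  have h2 : ∀ u, (Set.Ioo (m + a * σ) (m + b * σ)).indicator f (m + σ * u)
      = (Set.Ioo a b).indicator (fun u => f (m + σ * u)) u := fun u => by
    have : m + σ * u ∈ Set.Ioo (m + a * σ) (m + b * σ) ↔ u ∈ Set.Ioo a b := by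
      simp only [Set.mem_Ioo, add_lt_add_iff_left]
      rw [mul_comm a, mul_comm b, mul_lt_mul_iff_right₀ hσ, mul_lt_mul_iff_right₀ hσ]
    by_cases hu : u ∈ Set.Ioo a b
    · rw [Set.indicator_of_mem hu, Set.indicator_of_mem (this.2 hu)]
    · rw [Set.indicator_of_notMem hu, Set.indicator_of_notMem (mt this.1 hu)]
  simp_rw [h2] at h
  rw [h, ← mul_assoc, mul_inv_cancel₀ hσ.ne', one_mul]

/-- Uniformity over all concave `l` comes from an argument by contradiction: counterexamples for `η
= 1 / (k + 1)` form a sequence to which the sequential limit applies. One `η` governs the scale, the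
centre, the window and the error of the quadratic approximation. -/
lemma laplace_ratio {π : ℝ → ℝ} (hm : Measurable π) (h0 : ∀ t, 0 ≤ π t)
    (h1 : ∫⁻ t, ENNReal.ofReal (π t) = 1) {θ₀ : ℝ} (hc : ContinuousAt π θ₀) (hpos : 0 < π θ₀)
    {a b : ℝ} (hab : a < b) {ε : ℝ} (hε : 0 < ε) :
    ∃ η > 0, ∀ (σ m : ℝ) (l : ℝ → ℝ), 0 < σ → σ < η → |m - θ₀| < η → ConcaveOn ℝ Set.univ l →
      Measurable l →
      (∀ u, |u| ≤ η⁻¹ → |l (m + σ * u) - l m + u ^ 2 / 2| ≤ η) →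
      |(∫ t in Set.Ioo (m + a * σ) (m + b * σ), π t * Real.exp (l t)) /
        (∫ t, π t * Real.exp (l t)) - gaussProb a b| ≤ ε := by
  by_contra! hcon
  have hk : ∀ k : ℕ, (0 : ℝ) < 1 / ((k : ℝ) + 1) := fun k => by positivity
  choose s m l hs0 hs hmt hl hlm hlim hbad using fun k : ℕ => hcon _ (hk k)
  have hz : Tendsto (fun k : ℕ => 1 / ((k : ℝ) + 1)) atTop (𝓝 0) :=
    tendsto_one_div_add_atTop_nhds_zero_nat
  have hst : Tendsto s atTop (𝓝 0) :=
    squeeze_zero (fun k => (hs0 k).le) (fun k => (hs k).le) hz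
  have hmt' : Tendsto m atTop (𝓝 θ₀) := by
    rw [tendsto_iff_dist_tendsto_zero]
    exact squeeze_zero (fun k => dist_nonneg) (fun k => (hmt k).le) hz
  set g : ℕ → ℝ → ℝ := fun k u => l k (m k + s k * u) - l k (m k) with hg
  have hgc : ∀ k, ConcaveOn ℝ Set.univ (g k) := fun k => by
    have := ((hl k).comp_affineMap (AffineMap.lineMap (m k) (m k + s k))).add_const (-l k (m k))
    have e : g k = (l k ∘ ⇑(AffineMap.lineMap (m k) (m k + s k))) + fun _ => -l k (m k) := by
      funext u
      simp [hg, AffineMap.lineMap_apply, sub_eq_add_neg]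
      ring_nf
    rw [e]; simpa using this
  have hg0 : ∀ k, g k 0 = 0 := fun k => by simp [hg]
  have hgm : ∀ k, Measurable (g k) := fun k =>
    ((hlm k).comp ((measurable_id.const_mul _).const_add _)).sub_const _
  have hgl : ∀ u, Tendsto (fun k => g k u) atTop (𝓝 (-(1 / 2) * u ^ 2)) := fun u => by
    rw [tendsto_iff_dist_tendsto_zero]
    refine squeeze_zero' (Eventually.of_forall fun k => dist_nonneg) ?_ hz
    obtain ⟨N, hN⟩ := exists_nat_ge |u|
    filter_upwards [eventually_ge_atTop N] with k hk'
    have : |u| ≤ (1 / ((k : ℝ) + 1))⁻¹ := by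
      have : (N : ℝ) ≤ k := by exact_mod_cast hk'
      simp; linarith
    have := hlim k u this
    rw [Real.dist_eq]
    refine le_trans (le_of_eq ?_) this
    simp only [hg]; congr 1; ring
  have key := fun S => tendsto_setIntegral_laplace (S := S) hm h0 h1 hc hs0 hst hmt' hgc hg0 hgm hgl
  have kA := key (Set.Ioo a b)
  have kU := key Set.univ
  simp only [Measure.restrict_univ] at kU
  have hgi : ∫ u : ℝ, Real.exp (-(1 / 2) * u ^ 2) = Real.sqrt (2 * Real.pi) := by
    rw [integral_gaussian]; congr 1; ring
  have hsq : 0 < Real.sqrt (2 * Real.pi) := Real.sqrt_pos.2 (by positivity)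
  have kR := kA.div kU (by rw [hgi]; positivity)
  have hval : (π θ₀ * ∫ u in Set.Ioo a b, Real.exp (-(1 / 2) * u ^ 2)) /
      (π θ₀ * ∫ u, Real.exp (-(1 / 2) * u ^ 2)) = gaussProb a b := by
    rw [hgi, mul_div_mul_left _ _ hpos.ne', gaussProb, intervalIntegral.integral_of_le hab.le,
      integral_Ioc_eq_integral_Ioo, div_eq_inv_mul, one_div (Real.sqrt _)]
  rw [hval] at kR
  have hev := (tendsto_iff_dist_tendsto_zero.1 kR).eventually_lt_const hε
  obtain ⟨k, hk'⟩ := hev.exists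
  refine absurd (hbad k) (not_lt.2 (le_of_lt ?_))
  rw [Real.dist_eq] at hk'
  convert hk' using 3
  -- Normalizing by the value at the centre is harmless: the factor `exp (l k (m k))` and the
  -- Jacobian `s k` cancel in the ratio.
  have e : ∀ u, π (m k + s k * u) * Real.exp (l k (m k + s k * u))
      = Real.exp (l k (m k)) * (π (m k + s k * u) * Real.exp (g k u)) := fun u => by
    rw [mul_left_comm, ← Real.exp_add]; simp [hg]
  have hsk := hs0 k
  have hnum := setIntegral_Ioo_affine (fun t => π t * Real.exp (l k t)) (m k) a b hsk
  have hden := integral_comp_affine (fun t => π t * Real.exp (l k t)) (m k) hsk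
  simp only [e, integral_const_mul] at hnum hden
  rw [hnum, show (∫ t, π t * Real.exp (l k t)) = s k * (Real.exp (l k (m k)) *
      ∫ u, π (m k + s k * u) * Real.exp (g k u)) by rw [hden]; field_simp]
  rw [mul_div_mul_left _ _ hsk.ne', mul_div_mul_left _ _ (Real.exp_pos _).ne']
  rfl

/-! ### The oracle maximum likelihood estimator -/

lemma isMaxOn_logLik_of_score_eq_zero {n d : ℕ} (D : Obs n d) (h φ : Fin n → ℝ) {θ : ℝ}
    (hθ : score D h φ θ = 0) : IsMaxOn (logLik D h φ) Set.univ θ := by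
  have hc := concaveOn_logLik D h φ
  have hd := hasDerivAt_logLik D h φ θ
  rw [hθ] at hd
  intro t _
  simp only [Set.mem_ofPred_eq]
  rcases lt_trichotomy t θ with h | h | h
  · have := hc.le_slope_of_hasDerivAt (Set.mem_univ t) (Set.mem_univ θ) h hd
    rw [slope_def_field, le_div_iff₀ (by linarith)] at this
    linarith
  · rw [h]
  · have := hc.slope_le_of_hasDerivAt (Set.mem_univ θ) (Set.mem_univ t) h hd
    rw [slope_def_field, div_le_iff₀ (by linarith)] at this
    linarith

lemma score_eq_zero_of_isMaxOn {n d : ℕ} (D : Obs n d) (h φ : Fin n → ℝ) {θ : ℝ}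
    (hθ : IsMaxOn (logLik D h φ) Set.univ θ) : score D h φ θ = 0 :=
  (hθ.isLocalMax univ_mem).hasDerivAt_eq_zero (hasDerivAt_logLik D h φ θ)

/-- At distance `t = 2K / (k √n)` from `θ₀` the information moves the score by at least `2K √n`,
which beats both its initial size `K √n` and the Taylor error. The score thus changes sign, and
monotonicity traps every zero in between. -/
lemma mle_localization {n d : ℕ} (D : Obs n d) {h φ : Fin n → ℝ}
    (hh : ∀ i, |val (D.2.1 i) - h i| ≤ 1) {θ₀ K k : ℝ} (hK : 0 < K) (hk : 0 < k)
    (hn : 4 * K / k ^ 2 < Real.sqrt n) (hS : |score D h φ θ₀| ≤ K * Real.sqrt n)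
    (hI : k * n ≤ obsInfo D h φ θ₀) {m : ℝ}
    (hm : (∃ t, IsMaxOn (logLik D h φ) Set.univ t) → IsMaxOn (logLik D h φ) Set.univ m) :
    score D h φ m = 0 ∧ |m - θ₀| ≤ 2 * K / k / Real.sqrt n := by
  set r := Real.sqrt n with hr
  have hr0 : 0 < r := lt_of_le_of_lt (by positivity) hn
  have hnr : (n : ℝ) = r ^ 2 := (Real.sq_sqrt (Nat.cast_nonneg n)).symm
  set t := 2 * K / k / r with ht
  have ht0 : 0 < t := by positivity
  have h1 := abs_score_taylor_le D φ hh θ₀ t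
  have h2 := abs_score_taylor_le D φ hh θ₀ (-t)
  rw [hnr] at h1 h2 hI
  -- This is exactly where the threshold `4 * K / k ^ 2` on `√n` is needed.
  have hq : r ^ 2 * t ^ 2 < K * r := by
    have : r ^ 2 * t ^ 2 = K * (4 * K / k ^ 2) := by rw [ht]; field_simp; ring
    rw [this]; gcongr
  have hIt : 2 * K * r ≤ obsInfo D h φ θ₀ * t := by
    have : 2 * K * r = k * r ^ 2 * t := by rw [ht]; field_simp
    rw [this]; gcongr
  have hS' := abs_le.1 hS
  have hneg : score D h φ (θ₀ + t) < 0 := by linarith [(abs_le.1 h1).2]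
  have hpos : 0 < score D h φ (θ₀ + -t) := by
    rw [neg_sq] at h2; linarith [(abs_le.1 h2).1]
  have hcont : Continuous (score D h φ) :=
    continuous_iff_continuousAt.2 fun θ => (hasDerivAt_score D h φ θ).continuousAt
  obtain ⟨c, -, hc⟩ := intermediate_value_Icc' (show θ₀ + -t ≤ θ₀ + t by linarith)
    hcont.continuousOn ⟨hneg.le, hpos.le⟩
  -- The zero found by the intermediate value theorem is a maximizer, so the convention for data
  -- without a maximizer is not in force.
  have hs := score_eq_zero_of_isMaxOn D h φ (hm ⟨c, isMaxOn_logLik_of_score_eq_zero D h φ hc⟩)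
  refine ⟨hs, abs_le.2 ⟨?_, ?_⟩⟩
  · by_contra! hlt
    have := antitone_score D h φ (show m ≤ θ₀ + -t by linarith)
    linarith
  · by_contra! hlt
    have := antitone_score D h φ (show θ₀ + t ≤ m by linarith)
    linarith

/-! ### Quadratic approximation of a perturbed log-likelihood at the oracle estimator -/

/-- The perturbed score need not vanish at the oracle estimator `m`, but it is only `O(τ √n + 1)`
there; multiplied by `σ u = O(1/√n)` it contributes `O(τ + 1/√n)`. The curvature differs from `σ⁻²`
by `O(τ n + √n)`, which has a relative effect of the same order. -/
lemma abs_local_quadratic_le {n d : ℕ} (D : Obs n d) {h₀ φ₀ h φ : Fin n → ℝ}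
    (hh₀ : ∀ i, |val (D.2.1 i) - h₀ i| ≤ 1) (hh : ∀ i, |val (D.2.1 i) - h i| ≤ 1)
    {θ₀ L k τ r c U σ m u : ℝ} (hr : 0 < r) (hnr : (n : ℝ) = r ^ 2) (hL : 0 ≤ L) (hk : 0 < k)
    (hc : 0 < c) (hτ : 0 ≤ τ) (hm0 : score D h₀ φ₀ m = 0) (hm : |m - θ₀| ≤ L / r)
    (hS : |score D h φ θ₀ - score D h₀ φ₀ θ₀| ≤ τ * r)
    (hI : |obsInfo D h φ θ₀ - obsInfo D h₀ φ₀ θ₀| ≤ τ * r ^ 2)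
    (hJ : k / 2 * r ^ 2 ≤ obsInfo D h₀ φ₀ m) (hσ0 : 0 < σ) (hσ : σ ≤ c / r)
    (hσJ : σ ^ 2 * obsInfo D h₀ φ₀ m = 1) (hu : |u| ≤ U) :
    |logLik D h φ (m + σ * u) - logLik D h φ m + u ^ 2 / 2| ≤
      (c * U * (1 + L) + U ^ 2 / k) * τ +
        (c * U * L ^ 2 + U ^ 2 * L / k + (L ^ 3 + (L + c * U) ^ 3)) / r := by
  set S₀ := score D h₀ φ₀ θ₀
  set S := score D h φ θ₀
  set I₀ := obsInfo D h₀ φ₀ θ₀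
  set I := obsInfo D h φ θ₀
  set J := obsInfo D h₀ φ₀ m
  obtain ⟨μ, rfl⟩ : ∃ μ, m = θ₀ + μ := ⟨m - θ₀, by ring⟩
  rw [add_sub_cancel_left] at hm
  have hU : 0 ≤ U := (abs_nonneg u).trans hu
  have hμr : r * |μ| ≤ L := by rw [le_div_iff₀ hr] at hm; linarith
  have hσr : r * σ ≤ c := by rw [le_div_iff₀ hr] at hσ; linarith
  have h1 := abs_score_taylor_le D φ₀ hh₀ θ₀ μ
  rw [hm0, hnr] at h1
  -- The oracle score vanishes at `θ₀ + μ`, so its linearization there is as small as the Taylor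
  -- remainder.
  have h1' : |S₀ - μ * I₀| ≤ L ^ 2 := by
    have : r ^ 2 * μ ^ 2 ≤ L ^ 2 := by
      rw [← sq_abs μ, ← mul_pow]; gcongr
    refine le_trans (le_of_eq ?_) (h1.trans this)
    rw [← abs_neg]; congr 1; ring
  have h2 := abs_obsInfo_add_sub_le D φ₀ hh₀ θ₀ μ
  rw [hnr] at h2
  have h2' : |J - I₀| ≤ L * r := by
    refine h2.trans ?_
    calc r ^ 2 * |μ| = r * |μ| * r := by ring
      _ ≤ L * r := by gcongr
  have hSI : |S - μ * I| ≤ τ * r * (1 + L) + L ^ 2 := by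
    have e : S - μ * I = (S - S₀) + (S₀ - μ * I₀) + (-μ) * (I - I₀) := by ring
    have : |(-μ) * (I - I₀)| ≤ L * (τ * r) := by
      rw [abs_mul, abs_neg]
      calc |μ| * |I - I₀| ≤ |μ| * (τ * r ^ 2) := by gcongr
        _ = r * |μ| * (τ * r) := by ring
        _ ≤ _ := by gcongr
    rw [e]
    refine (abs_add_three _ _ _).trans ?_
    linarith
  have hJI : |J - I| ≤ τ * r ^ 2 + L * r := by
    have e : J - I = (J - I₀) - (I - I₀) := by ring
    rw [e]; refine (abs_sub _ _).trans ?_; linarith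
  have hJ0 : 0 < J := lt_of_lt_of_le (by positivity) hJ
  -- Both points are expanded around `θ₀` rather than around `m`, because the comparison of scores
  -- and informations is assumed only at `θ₀`.
  have t1 := abs_logLik_taylor_le D φ hh θ₀ μ
  have t2 := abs_logLik_taylor_le D φ hh θ₀ (μ + σ * u)
  rw [hnr] at t1 t2
  have hμ3 : r ^ 2 * |μ| ^ 3 ≤ L ^ 3 / r := by
    rw [le_div_iff₀ hr]
    calc r ^ 2 * |μ| ^ 3 * r = (r * |μ|) ^ 3 := by ring
      _ ≤ _ := by gcongr
  have hμu : r ^ 2 * |μ + σ * u| ^ 3 ≤ (L + c * U) ^ 3 / r := by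
    rw [le_div_iff₀ hr]
    have : r * |μ + σ * u| ≤ L + c * U := by
      calc r * |μ + σ * u| ≤ r * (|μ| + |σ * u|) := by gcongr; exact abs_add_le _ _
        _ = r * |μ| + r * σ * |u| := by rw [abs_mul, abs_of_pos hσ0]; ring
        _ ≤ _ := by gcongr
    calc r ^ 2 * |μ + σ * u| ^ 3 * r = (r * |μ + σ * u|) ^ 3 := by ring
      _ ≤ _ := by gcongr
  have m1 : |σ * u * (S - μ * I)| ≤ c * U * ((1 + L) * τ + L ^ 2 / r) := by
    rw [abs_mul, abs_mul, abs_of_pos hσ0]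
    calc σ * |u| * |S - μ * I| ≤ σ * U * (τ * r * (1 + L) + L ^ 2) := by gcongr
      _ = r * σ * U * ((1 + L) * τ + L ^ 2 / r) := by field_simp
      _ ≤ _ := by gcongr
  have m2 : |u ^ 2 / 2 * (σ ^ 2 * (J - I))| ≤ U ^ 2 / k * τ + U ^ 2 * L / k / r := by
    have hσ2 : σ ^ 2 * r ^ 2 ≤ 2 / k := by
      rw [le_div_iff₀ hk]
      have := mul_le_mul_of_nonneg_left hJ (sq_nonneg σ)
      rw [hσJ] at this
      linarith
    rw [abs_mul, abs_mul, abs_of_nonneg (by positivity : (0 : ℝ) ≤ u ^ 2 / 2),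
      abs_of_nonneg (sq_nonneg σ)]
    have hu2 : u ^ 2 ≤ U ^ 2 := by rw [← sq_abs u]; gcongr
    calc u ^ 2 / 2 * (σ ^ 2 * |J - I|) ≤ U ^ 2 / 2 * (σ ^ 2 * (τ * r ^ 2 + L * r)) := by gcongr
      _ = U ^ 2 / 2 * (σ ^ 2 * r ^ 2) * (τ + L / r) := by field_simp
      _ ≤ U ^ 2 / 2 * (2 / k) * (τ + L / r) := by gcongr
      _ = _ := by field_simp
  have e : logLik D h φ (θ₀ + μ + σ * u) - logLik D h φ (θ₀ + μ) + u ^ 2 / 2 =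
      (logLik D h φ (θ₀ + (μ + σ * u)) - logLik D h φ θ₀ - S * (μ + σ * u)
          + I * (μ + σ * u) ^ 2 / 2)
        - (logLik D h φ (θ₀ + μ) - logLik D h φ θ₀ - S * μ + I * μ ^ 2 / 2)
        + (σ * u * (S - μ * I) + u ^ 2 / 2 * (σ ^ 2 * (J - I))) := by
    rw [mul_sub (σ ^ 2), hσJ, add_assoc θ₀]; ring
  rw [e]
  refine (abs_add_le _ _).trans ((add_le_add (abs_sub _ _) (abs_add_le _ _)).trans ?_)
  refine (add_le_add (add_le_add (t2.trans hμu) (t1.trans hμ3)) (add_le_add m1 m2)).trans ?_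
  apply le_of_eq; field_simp; ring

/-- This reduces the theorem to score and information comparisons. The tolerance `τ` is fixed before
`n`, and the bound is uniform in the dimension, the data and the nuisance, so it can be integrated
over the posterior draws. -/
lemma posterior_ratio_close {π : ℝ → ℝ} (hm : Measurable π) (h0 : ∀ t, 0 ≤ π t)
    (h1 : ∫⁻ t, ENNReal.ofReal (π t) = 1) {θ₀ : ℝ} (hc : ContinuousAt π θ₀) (hpos : 0 < π θ₀)
    {a b : ℝ} (hab : a < b) {ε K k : ℝ} (hε : 0 < ε) (hK : 0 < K) (hk : 0 < k) :
    ∃ τ > 0, ∀ᶠ n : ℕ in atTop, ∀ (d : ℕ) (D : Obs n d) (h₀ φ₀ : Fin n → ℝ),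
      (∀ i, |val (D.2.1 i) - h₀ i| ≤ 1) → |score D h₀ φ₀ θ₀| ≤ K * Real.sqrt n →
      k * n ≤ obsInfo D h₀ φ₀ θ₀ → ∀ m : ℝ,
      ((∃ t, IsMaxOn (logLik D h₀ φ₀) Set.univ t) → IsMaxOn (logLik D h₀ φ₀) Set.univ m) →
      ∀ σ, σ = (Real.sqrt (-iteratedDeriv 2 (logLik D h₀ φ₀) m))⁻¹ →
      ∀ h φ : Fin n → ℝ, (∀ i, |val (D.2.1 i) - h i| ≤ 1) →
      |score D h φ θ₀ - score D h₀ φ₀ θ₀| ≤ τ * Real.sqrt n →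
      |obsInfo D h φ θ₀ - obsInfo D h₀ φ₀ θ₀| ≤ τ * n →
      |(∫ t in Set.Ioo (m + a * σ) (m + b * σ), π t * Real.exp (logLik D h φ t)) /
        (∫ t, π t * Real.exp (logLik D h φ t)) - gaussProb a b| ≤ ε := by
  obtain ⟨η, hη, H⟩ := laplace_ratio hm h0 h1 hc hpos hab hε
  set L := 2 * K / k with hLdef
  have hL : 0 < L := by positivity
  -- At least half of the information at `θ₀` survives at `m`, so `σ ≤ √(2 / k) / √n`.
  set c := Real.sqrt (2 / k) with hcdef
  have hc0 : 0 < c := Real.sqrt_pos.2 (by positivity)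
  set U := η⁻¹ with hU
  have hU0 : 0 < U := by positivity
  set B₁ := c * U * (1 + L) + U ^ 2 / k with hB₁
  set B₂ := c * U * L ^ 2 + U ^ 2 * L / k + (L ^ 3 + (L + c * U) ^ 3) with hB₂
  have hB₁0 : 0 < B₁ := by positivity
  have hB₂0 : 0 < B₂ := by positivity
  have hsq : Tendsto (fun n : ℕ => Real.sqrt n) atTop atTop :=
    Real.tendsto_sqrt_atTop.comp tendsto_natCast_atTop_atTop
  -- Half of `η` absorbs the perturbation term `B₁ τ`; the other half absorbs `B₂ / √n` for large
  -- `n`.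
  refine ⟨η / 2 / B₁, by positivity, ?_⟩
  filter_upwards [hsq.eventually_gt_atTop (4 * K / k ^ 2), hsq.eventually_gt_atTop (2 * L / k),
    hsq.eventually_gt_atTop (B₂ / (η / 2)), hsq.eventually_gt_atTop (c / η),
    hsq.eventually_gt_atTop (L / η)] with n n1 n2 n3 n4 n5
  intro d D h₀ φ₀ hh₀ hS₀ hI₀ m hmax σ hσ h φ hh hS hI
  obtain ⟨hm0, hmθ⟩ := mle_localization D hh₀ hK hk n1 hS₀ hI₀ hmax
  set r := Real.sqrt n with hr
  have hr0 : 0 < r := lt_of_le_of_lt (by positivity) n1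
  have hnr : (n : ℝ) = r ^ 2 := (Real.sq_sqrt (Nat.cast_nonneg n)).symm
  rw [iteratedDeriv_two_logLik, neg_neg] at hσ
  have hJ : k / 2 * r ^ 2 ≤ obsInfo D h₀ φ₀ m := by
    have h2 := abs_obsInfo_add_sub_le D φ₀ hh₀ θ₀ (m - θ₀)
    rw [hnr, add_sub_cancel] at h2
    rw [hnr] at hI₀
    have h3 : r ^ 2 * |m - θ₀| ≤ L * r := by
      rw [le_div_iff₀ hr0] at hmθ
      calc r ^ 2 * |m - θ₀| = |m - θ₀| * r * r := by ring
        _ ≤ L * r := by gcongr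
    have h4 : L * r ≤ k / 2 * r ^ 2 := by
      rw [div_lt_iff₀ hk] at n2
      nlinarith
    linarith [(abs_le.1 h2).1]
  have hJ0 : 0 < obsInfo D h₀ φ₀ m := lt_of_lt_of_le (by positivity) hJ
  have hσ0 : 0 < σ := by rw [hσ]; exact inv_pos.2 (Real.sqrt_pos.2 hJ0)
  have hσJ : σ ^ 2 * obsInfo D h₀ φ₀ m = 1 := by
    rw [hσ, inv_pow, Real.sq_sqrt hJ0.le, inv_mul_cancel₀ hJ0.ne']
  have hσc : σ ≤ c / r := by
    rw [hcdef]
    refine le_of_sq_le_sq ?_ (by positivity)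
    rw [div_pow, Real.sq_sqrt (by positivity), le_div_iff₀ (by positivity), le_div_iff₀ hk]
    have := mul_le_mul_of_nonneg_left hJ (sq_nonneg σ)
    rw [hσJ] at this
    linarith
  refine H σ m (logLik D h φ) hσ0 (hσc.trans_lt ?_) (hmθ.trans_lt ?_) (concaveOn_logLik D h φ)
    (differentiable_logLik D h φ).continuous.measurable fun u hu => ?_
  · rw [div_lt_iff₀ hr0]; rwa [div_lt_iff₀ hη, mul_comm] at n4
  · rw [div_lt_iff₀ hr0]; rwa [div_lt_iff₀ hη, mul_comm] at n5
  · refine (abs_local_quadratic_le D hh₀ hh hr0 hnr hL.le hk hc0 (by positivity) hm0 hmθ hS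
      (by rwa [hnr] at hI) hJ hσ0 hσc hσJ hu).trans ?_
    rw [← hB₁, ← hB₂]
    have e1 : B₁ * (η / 2 / B₁) = η / 2 := by field_simp
    have e2 : B₂ / r ≤ η / 2 := by
      rw [div_le_iff₀ hr0]; rw [div_lt_iff₀ (by positivity)] at n3; linarith
    linarith

/-! ### The projection as a logistic function -/

lemma sigmoid_eq_exp (x : ℝ) : Real.sigmoid x = Real.exp (x - softplus x) := by
  have := Real.exp_pos x
  rw [softplus, Real.exp_sub, Real.exp_log (by positivity), Real.sigmoid_def, Real.exp_neg]
  field_simp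
  ring

lemma one_sub_sigmoid_eq_exp (x : ℝ) : 1 - Real.sigmoid x = Real.exp (-softplus x) := by
  have := Real.exp_pos x
  rw [softplus, Real.exp_neg, Real.exp_log (by positivity), Real.sigmoid_def, Real.exp_neg]
  field_simp
  ring

lemma sigVar_eq_exp (x : ℝ) : sigVar x = Real.exp (x - 2 * softplus x) := by
  rw [sigVar, one_sub_sigmoid_eq_exp, sigmoid_eq_exp, ← Real.exp_add]
  congr 1; ring

/-- The logarithm of the ratio of the response variances at `X = 1` and at `X = 0`. -/
noncomputable def logVarRatio (θ u : ℝ) : ℝ := θ - 2 * softplus (θ + u) + 2 * softplus u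

lemma odds_pos {q : ℝ} (hq : q ∈ Set.Ioo (0 : ℝ) 1) : 0 < odds q :=
  div_pos hq.1 (sub_pos.2 hq.2)

/-- The projection is a Bayes-type ratio, and such ratios are additive on the logit scale. All later
perturbation bounds are then free of `1 / q` and `1 / v₀`. -/
lemma vwProj_eq_sigmoid {d : ℕ} (θ : ℝ) (β z : Fin d → ℝ) {q : ℝ} (hq : q ∈ Set.Ioo (0 : ℝ) 1) :
    vwProj θ β z q = Real.sigmoid (Real.log (odds q) + logVarRatio θ (z ⬝ᵥ β)) := by
  have h1 : respVar θ β z true = sigVar (θ + z ⬝ᵥ β) := by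
    simp [respVar, respProb, val, sigVar]
  have h0 : respVar θ β z false = sigVar (z ⬝ᵥ β) := by
    simp [respVar, respProb, val, sigVar]
  have hq1 : 0 < 1 - q := sub_pos.2 hq.2
  have hq0 := hq.1
  rw [vwProj, Real.sigmoid_def, one_div, neg_add, Real.exp_add, Real.exp_neg,
    Real.exp_log (odds_pos hq), mul_div_mul_comm, h1, h0, sigVar_eq_exp, sigVar_eq_exp,
    ← Real.exp_sub]
  congr 2
  rw [mul_comm, odds, inv_div]
  congr 2
  rw [logVarRatio]; ring

lemma sigmoid_mem_Ioo (x : ℝ) : Real.sigmoid x ∈ Set.Ioo (0 : ℝ) 1 :=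
  ⟨Real.sigmoid_pos x, Real.sigmoid_lt_one x⟩

lemma log_odds_sigmoid (x : ℝ) : Real.log (odds (Real.sigmoid x)) = x := by
  rw [odds, one_sub_sigmoid_eq_exp, sigmoid_eq_exp, ← Real.exp_sub, Real.log_exp]; ring

/-! ### Expansion of the contribution of one observation -/

lemma abs_softplus_add_sub_le (x t : ℝ) : |softplus (x + t) - softplus x| ≤ |t| := by
  have := abs_sub_zero_le_of_deriv (g := fun s => softplus (x + s))
    (g' := fun s => Real.sigmoid (x + s))
    (fun s => (hasDerivAt_softplus (x + s)).comp_const_add x s)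
    (B := 1) (t := t) (fun s _ => by
      rw [abs_of_pos (Real.sigmoid_pos _)]; exact Real.sigmoid_le_one _)
  simpa using this

section Expansion

variable {θ₀ u₀ Δ ζ ρ : ℝ}

lemma abs_logVarRatio_sub_le (hΔ : |Δ| ≤ ρ) (hζ : |ζ| ≤ ρ) :
    |logVarRatio (θ₀ + Δ) (u₀ + ζ) - logVarRatio θ₀ u₀| ≤ 7 * ρ := by
  have h1 := abs_softplus_add_sub_le (θ₀ + u₀) (Δ + ζ)
  have h2 := abs_softplus_add_sub_le u₀ ζ
  have h3 : |Δ + ζ| ≤ 2 * ρ := (abs_add_le _ _).trans (by linarith)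
  have e : logVarRatio (θ₀ + Δ) (u₀ + ζ) - logVarRatio θ₀ u₀ =
      Δ - 2 * (softplus (θ₀ + u₀ + (Δ + ζ)) - softplus (θ₀ + u₀))
        + 2 * (softplus (u₀ + ζ) - softplus u₀) := by
    rw [logVarRatio, logVarRatio, show θ₀ + Δ + (u₀ + ζ) = θ₀ + u₀ + (Δ + ζ) by ring]; ring
  rw [e, abs_le]
  have := abs_le.1 (h1.trans h3)
  have := abs_le.1 (h2.trans hζ)
  have := abs_le.1 hΔ
  constructor <;> linarith

lemma abs_logVarRatio_taylor_le (hΔ : |Δ| ≤ ρ) (hζ : |ζ| ≤ ρ) :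
    |logVarRatio (θ₀ + Δ) (u₀ + ζ) - logVarRatio θ₀ u₀
      - ((1 - 2 * Real.sigmoid (θ₀ + u₀)) * Δ
        + (2 * Real.sigmoid u₀ - 2 * Real.sigmoid (θ₀ + u₀)) * ζ)| ≤ 10 * ρ ^ 2 := by
  have h1 := abs_softplus_taylor_le (θ₀ + u₀) (Δ + ζ)
  have h2 := abs_softplus_taylor_le u₀ ζ
  have h3 : |Δ + ζ| ≤ 2 * ρ := (abs_add_le _ _).trans (by linarith)
  have h3' : (Δ + ζ) ^ 2 ≤ 4 * ρ ^ 2 := by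
    rw [← sq_abs]; nlinarith [abs_nonneg (Δ + ζ)]
  have h4' : ζ ^ 2 ≤ ρ ^ 2 := by
    rw [← sq_abs]; nlinarith [abs_nonneg ζ]
  have e : logVarRatio (θ₀ + Δ) (u₀ + ζ) - logVarRatio θ₀ u₀
      - ((1 - 2 * Real.sigmoid (θ₀ + u₀)) * Δ
        + (2 * Real.sigmoid u₀ - 2 * Real.sigmoid (θ₀ + u₀)) * ζ) =
      - 2 * (softplus (θ₀ + u₀ + (Δ + ζ)) - softplus (θ₀ + u₀)
          - Real.sigmoid (θ₀ + u₀) * (Δ + ζ))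
        + 2 * (softplus (u₀ + ζ) - softplus u₀ - Real.sigmoid u₀ * ζ) := by
    rw [logVarRatio, logVarRatio, show θ₀ + Δ + (u₀ + ζ) = θ₀ + u₀ + (Δ + ζ) by ring]; ring
  rw [e, abs_le]
  have := abs_le.1 (h1.trans h3')
  have := abs_le.1 (h2.trans h4')
  constructor <;> linarith

variable {l u h₀ h : ℝ}

lemma abs_proj_sub_le (hΔ : |Δ| ≤ ρ) (hζ : |ζ| ≤ ρ) (hu : |u| ≤ ρ)
    (hh₀ : h₀ = Real.sigmoid (l + logVarRatio θ₀ u₀))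
    (hh : h = Real.sigmoid (l + u + logVarRatio (θ₀ + Δ) (u₀ + ζ))) : |h - h₀| ≤ 8 * ρ := by
  have h1 := abs_logVarRatio_sub_le (θ₀ := θ₀) (u₀ := u₀) hΔ hζ
  set w := u + (logVarRatio (θ₀ + Δ) (u₀ + ζ) - logVarRatio θ₀ u₀) with hw
  have e : l + u + logVarRatio (θ₀ + Δ) (u₀ + ζ) = l + logVarRatio θ₀ u₀ + w := by
    rw [hw]; ring
  rw [hh, hh₀, e]
  refine (abs_sigmoid_add_sub_le _ _).trans ((abs_add_le _ _).trans ?_)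
  linarith

lemma abs_shift_le (hΔ : |Δ| ≤ ρ) (hζ : |ζ| ≤ ρ) (h0 : 0 ≤ h) (h1 : h ≤ 1) :
    |Δ * h + ζ| ≤ 2 * ρ := by
  refine (abs_add_le _ _).trans ?_
  have := abs_mul_le_of_abs_le_one (c := h) (abs_le.2 ⟨by linarith, h1⟩) hΔ
  rw [mul_comm] at this
  linarith

variable {X Y : ℝ}

/-- Moving `h` changes the score in proportion to the residual `Y - sigmoid η`; moving the predictor
changes it in proportion to `(X - h₀) sigVar η`. Only these two centred quantities occur at first
order. -/
lemma score_term_expansion (hΔ : |Δ| ≤ ρ) (hζ : |ζ| ≤ ρ) (hu : |u| ≤ ρ)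
    (hh₀ : h₀ = Real.sigmoid (l + logVarRatio θ₀ u₀))
    (hh : h = Real.sigmoid (l + u + logVarRatio (θ₀ + Δ) (u₀ + ζ)))
    (hX0 : 0 ≤ X) (hX1 : X ≤ 1) (hY0 : 0 ≤ Y) (hY1 : Y ≤ 1) (η : ℝ) :
    |(X - h) * (Y - Real.sigmoid (η + (Δ * h + ζ))) - (X - h₀) * (Y - Real.sigmoid η)
      + (sigVar (l + logVarRatio θ₀ u₀) * u * (Y - Real.sigmoid η)
        + Δ * (sigVar (l + logVarRatio θ₀ u₀) * (1 - 2 * Real.sigmoid (θ₀ + u₀))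
            * (Y - Real.sigmoid η) + (X - h₀) * sigVar η * h₀)
        + ζ * (sigVar (l + logVarRatio θ₀ u₀)
            * (2 * Real.sigmoid u₀ - 2 * Real.sigmoid (θ₀ + u₀))
            * (Y - Real.sigmoid η) + (X - h₀) * sigVar η))| ≤ 102 * ρ ^ 2 := by
  have hρ : 0 ≤ ρ := (abs_nonneg _).trans hΔ
  have hd := abs_proj_sub_le hΔ hζ hu hh₀ hh
  have hh0m : h₀ ∈ Set.Ioo (0 : ℝ) 1 := hh₀ ▸ sigmoid_mem_Ioo _
  have hhm : h ∈ Set.Ioo (0 : ℝ) 1 := hh ▸ sigmoid_mem_Ioo _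
  have hδ := abs_shift_le hΔ hζ hhm.1.le hhm.2.le
  have g1 := abs_logVarRatio_taylor_le (θ₀ := θ₀) (u₀ := u₀) hΔ hζ
  have g2 := abs_logVarRatio_sub_le (θ₀ := θ₀) (u₀ := u₀) hΔ hζ
  set κ := sigVar (l + logVarRatio θ₀ u₀) with hκ
  set w := u + (logVarRatio (θ₀ + Δ) (u₀ + ζ) - logVarRatio θ₀ u₀) with hw
  set δ := Δ * h + ζ with hδdef
  set e := Y - Real.sigmoid η with he
  set r₁ := logVarRatio (θ₀ + Δ) (u₀ + ζ) - logVarRatio θ₀ u₀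
      - ((1 - 2 * Real.sigmoid (θ₀ + u₀)) * Δ
        + (2 * Real.sigmoid u₀ - 2 * Real.sigmoid (θ₀ + u₀)) * ζ) with hr₁
  set r₂ := h - h₀ - κ * w with hr₂
  set r₃ := Real.sigmoid (η + δ) - Real.sigmoid η - sigVar η * δ with hr₃
  have hwb : |w| ≤ 8 * ρ := (abs_add_le _ _).trans (by linarith)
  have b2 : |r₂| ≤ 64 * ρ ^ 2 := by
    have e1 : l + u + logVarRatio (θ₀ + Δ) (u₀ + ζ) = l + logVarRatio θ₀ u₀ + w := by
      rw [hw]; ring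
    rw [hr₂, hh, hh₀, e1]
    refine (abs_sigmoid_taylor_le _ _).trans ?_
    rw [← sq_abs]; nlinarith [abs_nonneg w]
  have b3 : |r₃| ≤ 4 * ρ ^ 2 := by
    refine (abs_sigmoid_taylor_le _ _).trans ?_
    rw [← sq_abs]; nlinarith [abs_nonneg δ]
  have hκ1 : |κ| ≤ 1 := by rw [abs_of_pos (sigVar_pos _)]; exact sigVar_le_one _
  have hv1 : |sigVar η| ≤ 1 := by rw [abs_of_pos (sigVar_pos _)]; exact sigVar_le_one _
  have he1 : |e| ≤ 1 := abs_le.2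
    ⟨by linarith [Real.sigmoid_le_one η], by linarith [Real.sigmoid_nonneg η]⟩
  have hXh : |X - h| ≤ 1 := abs_le.2 ⟨by linarith [hhm.2], by linarith [hhm.1]⟩
  have hXh0 : |X - h₀| ≤ 1 := abs_le.2 ⟨by linarith [hh0m.2], by linarith [hh0m.1]⟩
  -- The five second-order pieces add up to `10 + 64 + 8 + 16 + 4 = 102`.
  have t1 : |κ * (e * r₁)| ≤ 10 * ρ ^ 2 :=
    abs_mul_le_of_abs_le_one hκ1 (abs_mul_le_of_abs_le_one he1 g1)
  have t2 : |e * r₂| ≤ 64 * ρ ^ 2 := abs_mul_le_of_abs_le_one he1 b2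
  have t3 : |(X - h₀) * (sigVar η * (Δ * (h - h₀)))| ≤ 8 * ρ ^ 2 := by
    refine abs_mul_le_of_abs_le_one hXh0 (abs_mul_le_of_abs_le_one hv1 ?_)
    rw [abs_mul]
    calc |Δ| * |h - h₀| ≤ ρ * (8 * ρ) := by gcongr
      _ = _ := by ring
  have t4 : |sigVar η * ((h - h₀) * δ)| ≤ 16 * ρ ^ 2 := by
    refine abs_mul_le_of_abs_le_one hv1 ?_
    rw [abs_mul]
    calc |h - h₀| * |δ| ≤ 8 * ρ * (2 * ρ) := by gcongr
      _ = _ := by ring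
  have t5 : |(X - h) * r₃| ≤ 4 * ρ ^ 2 := abs_mul_le_of_abs_le_one hXh b3
  have key : (X - h) * (Y - Real.sigmoid (η + δ)) - (X - h₀) * e
      + (κ * u * e + Δ * (κ * (1 - 2 * Real.sigmoid (θ₀ + u₀)) * e + (X - h₀) * sigVar η * h₀)
        + ζ * (κ * (2 * Real.sigmoid u₀ - 2 * Real.sigmoid (θ₀ + u₀)) * e
          + (X - h₀) * sigVar η)) =
      -(κ * (e * r₁)) - e * r₂ - (X - h₀) * (sigVar η * (Δ * (h - h₀)))
        + sigVar η * ((h - h₀) * δ) - (X - h) * r₃ := by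
    have e1 : Real.sigmoid (η + δ) = Real.sigmoid η + sigVar η * δ + r₃ := by rw [hr₃]; ring
    have e2 : Y = e + Real.sigmoid η := by rw [he]; ring
    have e3 : h - h₀ = κ * w + r₂ := by rw [hr₂]; ring
    have e4 : w = u + ((1 - 2 * Real.sigmoid (θ₀ + u₀)) * Δ
        + (2 * Real.sigmoid u₀ - 2 * Real.sigmoid (θ₀ + u₀)) * ζ) + r₁ := by rw [hw, hr₁]; ring
    -- The increment `h - h₀` is expanded only where it multiplies the residual; its products with
    -- `Δ` and `δ` are already of second order.
    have e5 : e * (h - h₀) = e * (κ * (u + ((1 - 2 * Real.sigmoid (θ₀ + u₀)) * Δ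
        + (2 * Real.sigmoid u₀ - 2 * Real.sigmoid (θ₀ + u₀)) * ζ) + r₁) + r₂) := by
      rw [← e4, ← e3]
    rw [e1]
    conv_lhs => rw [e2]
    rw [hδdef]
    linear_combination -e5
  rw [key, abs_le]
  have := abs_le.1 t1
  have := abs_le.1 t2
  have := abs_le.1 t3
  have := abs_le.1 t4
  have := abs_le.1 t5
  constructor <;> linarith

lemma info_term_le (hΔ : |Δ| ≤ ρ) (hζ : |ζ| ≤ ρ) (hu : |u| ≤ ρ)
    (hh₀ : h₀ = Real.sigmoid (l + logVarRatio θ₀ u₀))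
    (hh : h = Real.sigmoid (l + u + logVarRatio (θ₀ + Δ) (u₀ + ζ)))
    (hX0 : 0 ≤ X) (hX1 : X ≤ 1) (η : ℝ) :
    |(X - h) ^ 2 * sigVar (η + (Δ * h + ζ)) - (X - h₀) ^ 2 * sigVar η| ≤ 18 * ρ := by
  have hd := abs_proj_sub_le hΔ hζ hu hh₀ hh
  have hh0m : h₀ ∈ Set.Ioo (0 : ℝ) 1 := hh₀ ▸ sigmoid_mem_Ioo _
  have hhm : h ∈ Set.Ioo (0 : ℝ) 1 := hh ▸ sigmoid_mem_Ioo _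
  have hδ := abs_shift_le hΔ hζ hhm.1.le hhm.2.le
  have hXh : |X - h| ≤ 1 := abs_le.2 ⟨by linarith [hhm.2], by linarith [hhm.1]⟩
  have hXh2 : |(X - h) ^ 2| ≤ 1 := by rw [abs_pow]; exact pow_le_one₀ (abs_nonneg _) hXh
  have hv1 : |sigVar η| ≤ 1 := by rw [abs_of_pos (sigVar_pos _)]; exact sigVar_le_one _
  have t1 := abs_mul_le_of_abs_le_one hXh2 ((abs_sigVar_add_sub_le η _).trans hδ)
  have t2 : |sigVar η * ((2 * X - h - h₀) * (h - h₀))| ≤ 2 * (8 * ρ) := by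
    refine abs_mul_le_of_abs_le_one hv1 ?_
    rw [abs_mul]
    have : |2 * X - h - h₀| ≤ 2 :=
      abs_le.2 ⟨by linarith [hhm.2, hh0m.2], by linarith [hhm.1, hh0m.1]⟩
    gcongr
  have e : (X - h) ^ 2 * sigVar (η + (Δ * h + ζ)) - (X - h₀) ^ 2 * sigVar η =
      (X - h) ^ 2 * (sigVar (η + (Δ * h + ζ)) - sigVar η)
        - sigVar η * ((2 * X - h - h₀) * (h - h₀)) := by ring
  rw [e]
  refine (abs_sub _ _).trans ?_
  linarith

end Expansion

/-! ### Comparison of the score and the information with their oracle versions -/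

section Comparison

variable {n d : ℕ}

/-- The residual `Y i - E[Y i | X i, Z i]` at `(Y i, X i) = a`. -/
noncomputable def resid (θ₀ : ℝ) (β₀ : Fin d → ℝ) (z : Fin n → Fin d → ℝ) (i : Fin n)
    (a : Bool × Bool) : ℝ :=
  val a.1 - Real.sigmoid (val a.2 * θ₀ + z i ⬝ᵥ β₀)

/-- The derivative of the projection with respect to the logit of the propensity score. -/
noncomputable def projSlope (p : Fin n → (Fin d → ℝ) → ℝ) (θ₀ : ℝ) (β₀ : Fin d → ℝ)
    (z : Fin n → Fin d → ℝ) (i : Fin n) : ℝ :=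
  sigVar (Real.log (odds (p i (z i))) + logVarRatio θ₀ (z i ⬝ᵥ β₀))

/-- The first-order effect on the score of an error in `θ`. -/
noncomputable def thetaEffect (p : Fin n → (Fin d → ℝ) → ℝ) (θ₀ : ℝ) (β₀ : Fin d → ℝ)
    (z : Fin n → Fin d → ℝ) (i : Fin n) (a : Bool × Bool) : ℝ :=
  projSlope p θ₀ β₀ z i * (1 - 2 * Real.sigmoid (θ₀ + z i ⬝ᵥ β₀)) * resid θ₀ β₀ z i a
    + (val a.2 - oracleH p θ₀ β₀ z i) * sigVar (val a.2 * θ₀ + z i ⬝ᵥ β₀) * oracleH p θ₀ β₀ z i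

/-- The first-order effect on the score of an error in the linear predictor. -/
noncomputable def predEffect (p : Fin n → (Fin d → ℝ) → ℝ) (θ₀ : ℝ) (β₀ : Fin d → ℝ)
    (z : Fin n → Fin d → ℝ) (i : Fin n) (a : Bool × Bool) : ℝ :=
  projSlope p θ₀ β₀ z i
      * (2 * Real.sigmoid (z i ⬝ᵥ β₀) - 2 * Real.sigmoid (θ₀ + z i ⬝ᵥ β₀)) * resid θ₀ β₀ z i a
    + (val a.2 - oracleH p θ₀ β₀ z i) * sigVar (val a.2 * θ₀ + z i ⬝ᵥ β₀)

/-- The error of the logit of the propensity score. -/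
noncomputable def logitErr (p : Fin n → (Fin d → ℝ) → ℝ) (z : Fin n → Fin d → ℝ)
    (γ : Fin d → ℝ) (i : Fin n) : ℝ :=
  z i ⬝ᵥ γ - Real.log (odds (p i (z i)))

variable {p : Fin n → (Fin d → ℝ) → ℝ} (hp : ∀ i z, p i z ∈ Set.Ioo (0 : ℝ) 1)
  (θ₀ : ℝ) (β₀ : Fin d → ℝ) (D : Obs n d)

include hp in
lemma oracleH_eq_sigmoid (z : Fin n → Fin d → ℝ) (i : Fin n) :
    oracleH p θ₀ β₀ z i
      = Real.sigmoid (Real.log (odds (p i (z i))) + logVarRatio θ₀ (z i ⬝ᵥ β₀)) :=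
  vwProj_eq_sigmoid _ _ _ (hp i (z i))

lemma sampleH_eq_sigmoid (θt : ℝ) (β γ : Fin d → ℝ) (z : Fin n → Fin d → ℝ) (i : Fin n) :
    sampleH θt β γ z i = Real.sigmoid (z i ⬝ᵥ γ + logVarRatio θt (z i ⬝ᵥ β)) := by
  rw [sampleH, vwProj_eq_sigmoid _ _ _ (sigmoid_mem_Ioo _), log_odds_sigmoid]

include hp in
lemma oracleH_mem_Ioo (z : Fin n → Fin d → ℝ) (i : Fin n) :
    oracleH p θ₀ β₀ z i ∈ Set.Ioo (0 : ℝ) 1 :=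
  oracleH_eq_sigmoid hp θ₀ β₀ z i ▸ sigmoid_mem_Ioo _

lemma sampleH_mem_Ioo (θt : ℝ) (β γ : Fin d → ℝ) (z : Fin n → Fin d → ℝ) (i : Fin n) :
    sampleH θt β γ z i ∈ Set.Ioo (0 : ℝ) 1 :=
  sampleH_eq_sigmoid θt β γ z i ▸ sigmoid_mem_Ioo _

include hp in
lemma abs_val_sub_oracleH_le (i : Fin n) :
    |val (D.2.1 i) - oracleH p θ₀ β₀ D.2.2 i| ≤ 1 :=
  abs_val_sub_le (oracleH_mem_Ioo hp θ₀ β₀ _ i).1.le (oracleH_mem_Ioo hp θ₀ β₀ _ i).2.le _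

lemma abs_val_sub_sampleH_le (θt : ℝ) (β γ : Fin d → ℝ) (i : Fin n) :
    |val (D.2.1 i) - sampleH θt β γ D.2.2 i| ≤ 1 :=
  abs_val_sub_le (sampleH_mem_Ioo _ _ _ _ i).1.le (sampleH_mem_Ioo _ _ _ _ i).2.le _

/-- The reparametrization by `φ` makes the error of `θt` enter multiplied by `h` instead of `X`. For
the sampled `h` the shift then does not involve `X i`, as the orthogonality requires. -/
lemma workPred_phi (θt : ℝ) (β : Fin d → ℝ) (h : Fin n → ℝ) (i : Fin n) :
    workPred D h (phi θt β D.2.2 h) θ₀ i =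
      val (D.2.1 i) * θ₀ + D.2.2 i ⬝ᵥ β₀ + ((θt - θ₀) * h i + D.2.2 i ⬝ᵥ (β - β₀)) := by
  rw [workPred, phi, dotProduct_sub]; ring

lemma workPred_phi_self (h : Fin n → ℝ) (i : Fin n) :
    workPred D h (phi θ₀ β₀ D.2.2 h) θ₀ i = val (D.2.1 i) * θ₀ + D.2.2 i ⬝ᵥ β₀ := by
  rw [workPred, phi]; ring

variable {θt : ℝ} {β γ : Fin d → ℝ} {ρ : ℝ} (hΔ : |θt - θ₀| ≤ ρ)
  (hζ : ∀ i, |D.2.2 i ⬝ᵥ (β - β₀)| ≤ ρ) (hu : ∀ i, |logitErr p D.2.2 γ i| ≤ ρ)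

include hp hΔ hζ hu in
-- The linear effect of `(θt, β)` is split into coordinates, to be paired with an `ℓ¹` error. The
-- effect of `γ` is kept as one sum, since it is controlled for each `γ` separately.
lemma abs_score_sampleH_sub_le :
    |score D (sampleH θt β γ D.2.2) (phi θt β D.2.2 (sampleH θt β γ D.2.2)) θ₀
      - score D (oracleH p θ₀ β₀ D.2.2) (phi θ₀ β₀ D.2.2 (oracleH p θ₀ β₀ D.2.2)) θ₀|
    ≤ |∑ i, projSlope p θ₀ β₀ D.2.2 i * logitErr p D.2.2 γ i
          * resid θ₀ β₀ D.2.2 i (D.1 i, D.2.1 i)|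
      + (|θt - θ₀| * |∑ i, thetaEffect p θ₀ β₀ D.2.2 i (D.1 i, D.2.1 i)|
        + ∑ j, |β j - β₀ j| * |∑ i, D.2.2 i j * predEffect p θ₀ β₀ D.2.2 i (D.1 i, D.2.1 i)|)
      + n * (102 * ρ ^ 2) := by
  have main : ∀ i, |(val (D.2.1 i) - sampleH θt β γ D.2.2 i) *
        (val (D.1 i) - Real.sigmoid (workPred D (sampleH θt β γ D.2.2)
          (phi θt β D.2.2 (sampleH θt β γ D.2.2)) θ₀ i))
      - (val (D.2.1 i) - oracleH p θ₀ β₀ D.2.2 i) *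
        (val (D.1 i) - Real.sigmoid (workPred D (oracleH p θ₀ β₀ D.2.2)
          (phi θ₀ β₀ D.2.2 (oracleH p θ₀ β₀ D.2.2)) θ₀ i))
      + (projSlope p θ₀ β₀ D.2.2 i * logitErr p D.2.2 γ i
          * resid θ₀ β₀ D.2.2 i (D.1 i, D.2.1 i)
        + (θt - θ₀) * thetaEffect p θ₀ β₀ D.2.2 i (D.1 i, D.2.1 i)
        + D.2.2 i ⬝ᵥ (β - β₀) * predEffect p θ₀ β₀ D.2.2 i (D.1 i, D.2.1 i))|
      ≤ 102 * ρ ^ 2 := fun i => by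
    rw [workPred_phi θ₀ β₀, workPred_phi_self]
    refine score_term_expansion hΔ (hζ i) (hu i) (oracleH_eq_sigmoid hp θ₀ β₀ D.2.2 i) ?_
      (val_nonneg _) (val_le_one _) (val_nonneg _) (val_le_one _) _
    rw [sampleH_eq_sigmoid, logitErr, dotProduct_sub]
    congr 1
    rw [add_sub_cancel, add_sub_cancel, add_sub_cancel]
  have hsum := abs_sum_le_of_abs_le main
  simp only [Finset.sum_add_distrib, Finset.sum_sub_distrib, ← Finset.mul_sum] at hsum
  have hdot : ∑ i, D.2.2 i ⬝ᵥ (β - β₀) * predEffect p θ₀ β₀ D.2.2 i (D.1 i, D.2.1 i)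
      = ∑ j, (β j - β₀ j) * ∑ i, D.2.2 i j * predEffect p θ₀ β₀ D.2.2 i (D.1 i, D.2.1 i) := by
    simp only [dotProduct, Finset.sum_mul, Finset.mul_sum, Pi.sub_apply]
    rw [Finset.sum_comm]
    exact Finset.sum_congr rfl fun j _ => Finset.sum_congr rfl fun i _ => by ring
  have hdot' : |∑ i, D.2.2 i ⬝ᵥ (β - β₀) * predEffect p θ₀ β₀ D.2.2 i (D.1 i, D.2.1 i)|
      ≤ ∑ j, |β j - β₀ j| * |∑ i, D.2.2 i j * predEffect p θ₀ β₀ D.2.2 i (D.1 i, D.2.1 i)| := by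
    rw [hdot]
    refine (Finset.abs_sum_le_sum_abs _ _).trans (le_of_eq ?_)
    simp only [abs_mul]
  have hθ : |(θt - θ₀) * ∑ i, thetaEffect p θ₀ β₀ D.2.2 i (D.1 i, D.2.1 i)|
      = |θt - θ₀| * |∑ i, thetaEffect p θ₀ β₀ D.2.2 i (D.1 i, D.2.1 i)| := abs_mul _ _
  rw [← hθ]
  unfold score
  generalize (∑ i, D.2.2 i ⬝ᵥ (β - β₀) * predEffect p θ₀ β₀ D.2.2 i (D.1 i, D.2.1 i)) = A at *
  generalize (∑ i, projSlope p θ₀ β₀ D.2.2 i * logitErr p D.2.2 γ i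
          * resid θ₀ β₀ D.2.2 i (D.1 i, D.2.1 i)) = B at *
  generalize ((θt - θ₀) * ∑ i, thetaEffect p θ₀ β₀ D.2.2 i (D.1 i, D.2.1 i)) = E at *
  have hA := neg_abs_le A
  have hA' := le_abs_self A
  have hB := neg_abs_le B
  have hB' := le_abs_self B
  have hE := neg_abs_le E
  have hE' := le_abs_self E
  have hs := abs_le.1 hsum
  rw [abs_le]
  constructor <;> linarith [hs.1, hs.2]

include hp hΔ hζ hu in
lemma abs_obsInfo_sampleH_sub_le :
    |obsInfo D (sampleH θt β γ D.2.2) (phi θt β D.2.2 (sampleH θt β γ D.2.2)) θ₀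
      - obsInfo D (oracleH p θ₀ β₀ D.2.2) (phi θ₀ β₀ D.2.2 (oracleH p θ₀ β₀ D.2.2)) θ₀|
    ≤ n * (18 * ρ) := by
  unfold obsInfo
  rw [← Finset.sum_sub_distrib]
  refine abs_sum_le_of_abs_le fun i => ?_
  rw [workPred_phi θ₀ β₀, workPred_phi_self]
  refine info_term_le hΔ (hζ i) (hu i) (oracleH_eq_sigmoid hp θ₀ β₀ D.2.2 i) ?_
    (val_nonneg _) (val_le_one _) _
  rw [sampleH_eq_sigmoid, logitErr, dotProduct_sub]
  congr 1
  rw [add_sub_cancel, add_sub_cancel, add_sub_cancel]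

end Comparison

/-! ### Hoeffding's inequality for finite product weights -/

section Hoeffding

variable {α : Type*} [Fintype α]

/-- On `[-c, c]` the convex exponential lies below its chord; the linear term of the chord averages
out for a centred variable. -/
lemma exp_le_cosh_add {c l x : ℝ} (hc : 0 < c) (hx : |x| ≤ c) :
    Real.exp (l * x) ≤ Real.cosh (l * c) + x / c * Real.sinh (l * c) := by
  have hx' := abs_le.1 hx
  have h := convexOn_exp.2 (Set.mem_univ (l * c)) (Set.mem_univ (-(l * c)))
    (show 0 ≤ (1 + x / c) / 2 by
      have : -1 ≤ x / c := by rw [le_div_iff₀ hc]; linarith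
      linarith)
    (show 0 ≤ (1 - x / c) / 2 by
      have : x / c ≤ 1 := by rw [div_le_iff₀ hc]; linarith
      linarith) (by ring)
  simp only [smul_eq_mul] at h
  have e : (1 + x / c) / 2 * (l * c) + (1 - x / c) / 2 * -(l * c) = l * x := by
    field_simp; ring
  rw [e] at h
  refine h.trans (le_of_eq ?_)
  rw [Real.cosh_eq, Real.sinh_eq]; ring

lemma sum_mul_exp_le {w g : α → ℝ} {c : ℝ} (hc : 0 < c) (hw : ∀ a, 0 ≤ w a)
    (hw1 : ∑ a, w a = 1) (hg : ∀ a, |g a| ≤ c) (hg0 : ∑ a, w a * g a = 0) (l : ℝ) :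
    ∑ a, w a * Real.exp (l * g a) ≤ Real.exp (l ^ 2 * c ^ 2 / 2) := by
  calc ∑ a, w a * Real.exp (l * g a)
      ≤ ∑ a, w a * (Real.cosh (l * c) + g a / c * Real.sinh (l * c)) :=
        Finset.sum_le_sum fun a _ => mul_le_mul_of_nonneg_left (exp_le_cosh_add hc (hg a)) (hw a)
    _ = (∑ a, w a) * Real.cosh (l * c) + (∑ a, w a * g a) * (Real.sinh (l * c) / c) := by
        rw [Finset.sum_mul, Finset.sum_mul, ← Finset.sum_add_distrib]
        exact Finset.sum_congr rfl fun a _ => by ring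
    _ = Real.cosh (l * c) := by rw [hw1, hg0]; ring
    _ ≤ Real.exp ((l * c) ^ 2 / 2) := Real.cosh_le_exp_half_sq _
    _ = _ := by rw [mul_pow]

variable {n : ℕ}

lemma sum_prod_pi [DecidableEq α] (F : Fin n → α → ℝ) :
    ∑ f : Fin n → α, ∏ i, F i (f i) = ∏ i, ∑ a, F i a := by
  rw [Finset.prod_univ_sum, Fintype.piFinset_univ]

variable [DecidableEq α] {w g : Fin n → α → ℝ} {c : ℝ}

lemma sum_prod_mul_exp_le (hc : 0 < c) (hw : ∀ i a, 0 ≤ w i a) (hw1 : ∀ i, ∑ a, w i a = 1)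
    (hg : ∀ i a, |g i a| ≤ c) (hg0 : ∀ i, ∑ a, w i a * g i a = 0) (l : ℝ) :
    ∑ f : Fin n → α, (∏ i, w i (f i)) * Real.exp (l * ∑ i, g i (f i))
      ≤ Real.exp (n * (l ^ 2 * c ^ 2 / 2)) := by
  have e : ∀ f : Fin n → α, (∏ i, w i (f i)) * Real.exp (l * ∑ i, g i (f i))
      = ∏ i, w i (f i) * Real.exp (l * g i (f i)) := fun f => by
    rw [Finset.mul_sum, Real.exp_sum, Finset.prod_mul_distrib]
  simp_rw [e]
  rw [sum_prod_pi fun i a => w i a * Real.exp (l * g i a)]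
  calc ∏ i, ∑ a, w i a * Real.exp (l * g i a)
      ≤ ∏ _i : Fin n, Real.exp (l ^ 2 * c ^ 2 / 2) :=
        Finset.prod_le_prod
          (fun i _ => Finset.sum_nonneg fun a _ => mul_nonneg (hw i a) (Real.exp_pos _).le)
          fun i _ => sum_mul_exp_le hc (hw i) (hw1 i) (hg i) (hg0 i) l
    _ = _ := by rw [Finset.prod_const, Finset.card_univ, Fintype.card_fin, ← Real.exp_nat_mul]

lemma hoeffding_sum_pi (hn : 0 < n) (hc : 0 < c) (hw : ∀ i a, 0 ≤ w i a)
    (hw1 : ∀ i, ∑ a, w i a = 1) (hg : ∀ i a, |g i a| ≤ c) (hg0 : ∀ i, ∑ a, w i a * g i a = 0)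
    {t : ℝ} (ht : 0 ≤ t) (P : (Fin n → α) → Prop) [DecidablePred P]
    (hP : ∀ f, P f → t ≤ |∑ i, g i (f i)|) :
    ∑ f : Fin n → α, (∏ i, w i (f i)) * (if P f then 1 else 0)
      ≤ 2 * Real.exp (-(t ^ 2 / (2 * (n * c ^ 2)))) := by
  have hn' : (0 : ℝ) < n := by exact_mod_cast hn
  -- This minimizes the Chernoff exponent `n l² c² / 2 - l t`.
  set l := t / (n * c ^ 2) with hl
  have hl0 : 0 ≤ l := by positivity
  have hexp : Real.exp (n * (l ^ 2 * c ^ 2 / 2)) * Real.exp (-(l * t))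
      = Real.exp (-(t ^ 2 / (2 * (n * c ^ 2)))) := by
    rw [← Real.exp_add]; congr 1; rw [hl]; field_simp; ring
  calc ∑ f : Fin n → α, (∏ i, w i (f i)) * (if P f then 1 else 0)
      ≤ ∑ f : Fin n → α, (∏ i, w i (f i)) * ((Real.exp (l * ∑ i, g i (f i))
          + Real.exp (-l * ∑ i, g i (f i))) * Real.exp (-(l * t))) := by
        refine Finset.sum_le_sum fun f _ => mul_le_mul_of_nonneg_left ?_
          (Finset.prod_nonneg fun i _ => hw i _)
        split_ifs with h
        · have := hP f h
          rw [add_mul, ← Real.exp_add, ← Real.exp_add]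
          rcases le_abs.1 this with h' | h'
          · have : 0 ≤ l * ∑ i, g i (f i) + -(l * t) := by nlinarith
            linarith [Real.one_le_exp this, Real.exp_pos (-l * ∑ i, g i (f i) + -(l * t))]
          · have : 0 ≤ -l * ∑ i, g i (f i) + -(l * t) := by nlinarith
            linarith [Real.one_le_exp this, Real.exp_pos (l * ∑ i, g i (f i) + -(l * t))]
        · positivity
    _ = (∑ f : Fin n → α, (∏ i, w i (f i)) * Real.exp (l * ∑ i, g i (f i))
          + ∑ f : Fin n → α, (∏ i, w i (f i)) * Real.exp (-l * ∑ i, g i (f i)))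
            * Real.exp (-(l * t)) := by
        rw [← Finset.sum_add_distrib, Finset.sum_mul]
        exact Finset.sum_congr rfl fun f _ => by ring
    _ ≤ (Real.exp (n * (l ^ 2 * c ^ 2 / 2)) + Real.exp (n * ((-l) ^ 2 * c ^ 2 / 2)))
            * Real.exp (-(l * t)) := by
        gcongr
        · exact sum_prod_mul_exp_le hc hw hw1 hg hg0 l
        · exact sum_prod_mul_exp_le hc hw hw1 hg hg0 (-l)
    _ = _ := by rw [neg_sq, add_mul, hexp]; ring

end Hoeffding

/-! ### The conditional law of the responses and the covariates given the design -/

section Weights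

variable {n d : ℕ}

/-- The conditional probability that `(Y i, X i) = a` given the design. -/
noncomputable def obsWt (p : Fin n → (Fin d → ℝ) → ℝ) (θ₀ : ℝ) (β₀ : Fin d → ℝ)
    (z : Fin n → Fin d → ℝ) (i : Fin n) (a : Bool × Bool) : ℝ :=
  bern (p i (z i)) a.2 * bern (Real.sigmoid (val a.2 * θ₀ + z i ⬝ᵥ β₀)) a.1

lemma bern_nonneg {q : ℝ} (h0 : 0 ≤ q) (h1 : q ≤ 1) (b : Bool) : 0 ≤ bern q b := by
  cases b <;> simp [bern, h0, h1]

lemma sum_bern (q : ℝ) : ∑ b : Bool, bern q b = 1 := by simp [bern]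

lemma sum_bern_mul_sub (q : ℝ) : ∑ b : Bool, bern q b * (val b - q) = 0 := by
  simp [bern, val]; ring

lemma bern_sigmoid_pos (x : ℝ) (b : Bool) : 0 < bern (Real.sigmoid x) b := by
  cases b
  · simp [bern, Real.sigmoid_lt_one]
  · simp [bern, Real.sigmoid_pos]

variable {p : Fin n → (Fin d → ℝ) → ℝ} (hp : ∀ i z, p i z ∈ Set.Ioo (0 : ℝ) 1)
  (θ₀ : ℝ) (β₀ : Fin d → ℝ) (z : Fin n → Fin d → ℝ)

include hp in
lemma obsWt_nonneg (i : Fin n) (a : Bool × Bool) : 0 ≤ obsWt p θ₀ β₀ z i a :=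
  mul_nonneg (bern_nonneg (hp _ _).1.le (hp _ _).2.le _) (bern_sigmoid_pos _ _).le

lemma sum_obsWt_mul (i : Fin n) (F : Bool × Bool → ℝ) :
    ∑ a, obsWt p θ₀ β₀ z i a * F a = ∑ x, bern (p i (z i)) x *
      ∑ y, bern (Real.sigmoid (val x * θ₀ + z i ⬝ᵥ β₀)) y * F (y, x) := by
  rw [Fintype.sum_prod_type_right]
  refine Finset.sum_congr rfl fun x _ => ?_
  rw [Finset.mul_sum]
  exact Finset.sum_congr rfl fun y _ => by simp only [obsWt]; ring

lemma sum_obsWt (i : Fin n) : ∑ a, obsWt p θ₀ β₀ z i a = 1 := by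
  have := sum_obsWt_mul (p := p) θ₀ β₀ z i fun _ => 1
  simp only [mul_one, sum_bern] at this
  exact this

lemma sum_bern_mul_resid (i : Fin n) (x : Bool) :
    ∑ y, bern (Real.sigmoid (val x * θ₀ + z i ⬝ᵥ β₀)) y * resid θ₀ β₀ z i (y, x) = 0 :=
  sum_bern_mul_sub _

lemma sum_obsWt_mul_mul_resid (i : Fin n) (c : Bool → ℝ) :
    ∑ a, obsWt p θ₀ β₀ z i a * (c a.2 * resid θ₀ β₀ z i a) = 0 := by
  rw [sum_obsWt_mul]
  refine Finset.sum_eq_zero fun x _ => ?_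
  have := sum_bern_mul_resid θ₀ β₀ z i x
  simp only [mul_left_comm _ (c x), ← Finset.mul_sum, this, mul_zero]

include hp in
/-- The variance-weighted orthogonality of `X - h₀` to functions of the design. -/
lemma sum_obsWt_mul_orth (i : Fin n) :
    ∑ a, obsWt p θ₀ β₀ z i a *
      ((val a.2 - oracleH p θ₀ β₀ z i) * sigVar (val a.2 * θ₀ + z i ⬝ᵥ β₀)) = 0 := by
  rw [sum_obsWt_mul]
  simp only [← Finset.sum_mul, sum_bern]
  have hq := hp i (z i)
  have hv1 := sigVar_pos (θ₀ + z i ⬝ᵥ β₀)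
  have hv0 := sigVar_pos (z i ⬝ᵥ β₀)
  have h1 : respVar θ₀ β₀ (z i) true = sigVar (θ₀ + z i ⬝ᵥ β₀) := by
    simp [respVar, respProb, val, sigVar]
  have h0 : respVar θ₀ β₀ (z i) false = sigVar (z i ⬝ᵥ β₀) := by
    simp [respVar, respProb, val, sigVar]
  simp only [oracleH, vwProj, h1, h0, Fintype.sum_bool, bern, val]
  simp only [if_true, Bool.false_eq_true, if_false, one_mul, zero_mul, zero_add]
  have hq0 := hq.1
  have hq1 : 0 < 1 - p i (z i) := sub_pos.2 hq.2
  generalize sigVar (θ₀ + z i ⬝ᵥ β₀) = v1 at *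
  generalize sigVar (z i ⬝ᵥ β₀) = v0 at *
  generalize p i (z i) = q at *
  have : v1 * q + v0 * (1 - q) ≠ 0 := by positivity
  field_simp
  ring

lemma abs_resid_le_one (i : Fin n) (a : Bool × Bool) : |resid θ₀ β₀ z i a| ≤ 1 :=
  abs_val_sub_le (Real.sigmoid_nonneg _) (Real.sigmoid_le_one _) _

lemma abs_projSlope_le_one (i : Fin n) : |projSlope p θ₀ β₀ z i| ≤ 1 := by
  rw [projSlope, abs_of_pos (sigVar_pos _)]; exact sigVar_le_one _

lemma abs_sigVar_le_one (x : ℝ) : |sigVar x| ≤ 1 := by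
  rw [abs_of_pos (sigVar_pos _)]; exact sigVar_le_one _

include hp in
-- The residual part is centred given `(X, Z)`. The other part is the orthogonality relation
-- multiplied by `h₀`, which depends on the design only.
lemma sum_obsWt_mul_thetaEffect (i : Fin n) :
    ∑ a, obsWt p θ₀ β₀ z i a * thetaEffect p θ₀ β₀ z i a = 0 := by
  have h1 := sum_obsWt_mul_mul_resid (p := p) θ₀ β₀ z i fun _ =>
    projSlope p θ₀ β₀ z i * (1 - 2 * Real.sigmoid (θ₀ + z i ⬝ᵥ β₀))
  have h2 := sum_obsWt_mul_orth hp θ₀ β₀ z i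
  simp only [thetaEffect, mul_add, Finset.sum_add_distrib]
  rw [h1, zero_add]
  simp only [← mul_assoc] at h2 ⊢
  rw [← Finset.sum_mul, h2, zero_mul]

include hp in
lemma sum_obsWt_mul_predEffect (i : Fin n) (c : ℝ) :
    ∑ a, obsWt p θ₀ β₀ z i a * (c * predEffect p θ₀ β₀ z i a) = 0 := by
  have h1 := sum_obsWt_mul_mul_resid (p := p) θ₀ β₀ z i fun _ =>
    projSlope p θ₀ β₀ z i * (2 * Real.sigmoid (z i ⬝ᵥ β₀) - 2 * Real.sigmoid (θ₀ + z i ⬝ᵥ β₀))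
  have h2 := sum_obsWt_mul_orth hp θ₀ β₀ z i
  simp only [mul_left_comm _ c, ← Finset.mul_sum]
  simp only [predEffect, mul_add, Finset.sum_add_distrib]
  rw [h1, h2]; ring

include hp in
lemma abs_val_sub_oracleH_le_one (i : Fin n) (b : Bool) : |val b - oracleH p θ₀ β₀ z i| ≤ 1 :=
  abs_val_sub_le (oracleH_mem_Ioo hp θ₀ β₀ _ i).1.le (oracleH_mem_Ioo hp θ₀ β₀ _ i).2.le _

include hp in
lemma abs_thetaEffect_le (i : Fin n) (a : Bool × Bool) : |thetaEffect p θ₀ β₀ z i a| ≤ 3 := by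
  have h1 : |projSlope p θ₀ β₀ z i * ((1 - 2 * Real.sigmoid (θ₀ + z i ⬝ᵥ β₀))
      * resid θ₀ β₀ z i a)| ≤ 1 := by
    refine abs_mul_le_of_abs_le_one (abs_projSlope_le_one θ₀ β₀ z i)
      (abs_mul_le_of_abs_le_one ?_ (abs_resid_le_one θ₀ β₀ z i a))
    have h0 := Real.sigmoid_nonneg (θ₀ + z i ⬝ᵥ β₀)
    have h1 := Real.sigmoid_le_one (θ₀ + z i ⬝ᵥ β₀)
    exact abs_le.2 ⟨by linarith, by linarith⟩
  have h2 : |(val a.2 - oracleH p θ₀ β₀ z i) * (sigVar (val a.2 * θ₀ + z i ⬝ᵥ β₀)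
      * oracleH p θ₀ β₀ z i)| ≤ 1 := by
    refine abs_mul_le_of_abs_le_one (abs_val_sub_oracleH_le_one hp θ₀ β₀ z i _)
      (abs_mul_le_of_abs_le_one (abs_sigVar_le_one _) ?_)
    have := oracleH_mem_Ioo hp θ₀ β₀ z i
    exact abs_le.2 ⟨by linarith [this.1], this.2.le⟩
  rw [thetaEffect, mul_assoc, mul_assoc]
  exact (abs_add_le _ _).trans (by linarith)

include hp in
lemma abs_predEffect_le (i : Fin n) (a : Bool × Bool) : |predEffect p θ₀ β₀ z i a| ≤ 3 := by
  have h1 : |projSlope p θ₀ β₀ z i * (resid θ₀ β₀ z i a *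
      (2 * Real.sigmoid (z i ⬝ᵥ β₀) - 2 * Real.sigmoid (θ₀ + z i ⬝ᵥ β₀)))| ≤ 2 := by
    refine abs_mul_le_of_abs_le_one (abs_projSlope_le_one θ₀ β₀ z i)
      (abs_mul_le_of_abs_le_one (abs_resid_le_one θ₀ β₀ z i a) ?_)
    have h0 := Real.sigmoid_nonneg (θ₀ + z i ⬝ᵥ β₀)
    have h1 := Real.sigmoid_le_one (θ₀ + z i ⬝ᵥ β₀)
    have h0' := Real.sigmoid_nonneg (z i ⬝ᵥ β₀)
    have h1' := Real.sigmoid_le_one (z i ⬝ᵥ β₀)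
    exact abs_le.2 ⟨by linarith, by linarith⟩
  have h2 : |(val a.2 - oracleH p θ₀ β₀ z i) * sigVar (val a.2 * θ₀ + z i ⬝ᵥ β₀)| ≤ 1 :=
    abs_mul_le_of_abs_le_one (abs_val_sub_oracleH_le_one hp θ₀ β₀ z i _) (abs_sigVar_le_one _)
  rw [predEffect, mul_assoc, mul_comm (_ - _) (resid θ₀ β₀ z i a)]
  exact (abs_add_le _ _).trans (by linarith)

/-- The information carried by one observation with `X i = x` at the true parameters. -/
noncomputable def infoTerm (p : Fin n → (Fin d → ℝ) → ℝ) (θ₀ : ℝ) (β₀ : Fin d → ℝ)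
    (z : Fin n → Fin d → ℝ) (i : Fin n) (x : Bool) : ℝ :=
  (val x - oracleH p θ₀ β₀ z i) ^ 2 * sigVar (val x * θ₀ + z i ⬝ᵥ β₀)

lemma condInfo_eq_sum (i : Fin n) :
    condInfo p θ₀ β₀ z i = ∑ x, bern (p i (z i)) x * infoTerm p θ₀ β₀ z i x :=
  Finset.sum_congr rfl fun x _ => by
    simp only [infoTerm, respVar, respProb, sigVar]; ring

include hp in
lemma infoTerm_mem_Icc (i : Fin n) (x : Bool) : infoTerm p θ₀ β₀ z i x ∈ Set.Icc (0 : ℝ) 1 := by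
  have h1 := abs_val_sub_oracleH_le_one hp θ₀ β₀ z i x
  refine ⟨mul_nonneg (sq_nonneg _) (sigVar_pos _).le, mul_le_one₀ ?_ (sigVar_pos _).le
    (sigVar_le_one _)⟩
  rw [← sq_abs]; exact pow_le_one₀ (abs_nonneg _) h1

include hp in
lemma abs_infoTerm_sub_condInfo_le (i : Fin n) (x : Bool) :
    |infoTerm p θ₀ β₀ z i x - condInfo p θ₀ β₀ z i| ≤ 1 := by
  have h := infoTerm_mem_Icc hp θ₀ β₀ z i
  have hb : ∀ b, 0 ≤ bern (p i (z i)) b := bern_nonneg (hp _ _).1.le (hp _ _).2.le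
  have h0 : 0 ≤ condInfo p θ₀ β₀ z i := by
    rw [condInfo_eq_sum]
    exact Finset.sum_nonneg fun b _ => mul_nonneg (hb b) (h b).1
  have h1 : condInfo p θ₀ β₀ z i ≤ 1 := by
    rw [condInfo_eq_sum, ← sum_bern (p i (z i))]
    exact Finset.sum_le_sum fun b _ => mul_le_of_le_one_right (hb b) (h b).2
  exact abs_le.2 ⟨by linarith [(h x).1], by linarith [(h x).2]⟩

lemma sum_obsWt_mul_infoTerm_sub (i : Fin n) :
    ∑ a, obsWt p θ₀ β₀ z i a * (infoTerm p θ₀ β₀ z i a.2 - condInfo p θ₀ β₀ z i) = 0 := by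
  rw [sum_obsWt_mul]
  simp only [← Finset.sum_mul, sum_bern, one_mul]
  simp only [mul_sub, Finset.sum_sub_distrib, ← Finset.sum_mul, sum_bern, one_mul]
  rw [condInfo_eq_sum, sub_self]

lemma obsInfo_oracle_eq (D : Obs n d) :
    obsInfo D (oracleH p θ₀ β₀ D.2.2) (phi θ₀ β₀ D.2.2 (oracleH p θ₀ β₀ D.2.2)) θ₀
      = ∑ i, infoTerm p θ₀ β₀ D.2.2 i (D.2.1 i) := by
  simp only [obsInfo, workPred_phi_self, infoTerm]

lemma score_oracle_eq (D : Obs n d) :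
    score D (oracleH p θ₀ β₀ D.2.2) (phi θ₀ β₀ D.2.2 (oracleH p θ₀ β₀ D.2.2)) θ₀
      = ∑ i, (val (D.2.1 i) - oracleH p θ₀ β₀ D.2.2 i) * resid θ₀ β₀ D.2.2 i (D.1 i, D.2.1 i) := by
  simp only [score, workPred_phi_self, resid]

end Weights

/-! ### Measurability -/

section Measurability

variable {Ω : Type*} [MeasurableSpace Ω] {n d : ℕ}

@[fun_prop]
lemma measurable_val : Measurable val := Measurable.of_discrete

lemma bern_eq (q : ℝ) (b : Bool) : bern q b = val b * q + (1 - val b) * (1 - q) := by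
  cases b <;> simp [bern, val]

@[fun_prop]
lemma Measurable.bern {q : Ω → ℝ} {b : Ω → Bool} (hq : Measurable q) (hb : Measurable b) :
    Measurable fun ω => LogisticCP.bern (q ω) (b ω) := by
  simp only [bern_eq]; fun_prop

@[fun_prop]
lemma measurable_sigmoid : Measurable Real.sigmoid := continuous_sigmoid.measurable

@[fun_prop]
lemma Measurable.dotProduct {f g : Ω → Fin d → ℝ} (hf : Measurable f) (hg : Measurable g) :
    Measurable fun ω => f ω ⬝ᵥ g ω := by
  simp only [_root_.dotProduct]; fun_prop

@[fun_prop]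
lemma Measurable.logisticLik {y : Ω → Fin n → Bool} {η : Ω → Fin n → ℝ} (hy : Measurable y)
    (hη : Measurable η) : Measurable fun ω => LogisticCP.logisticLik (y ω) (η ω) := by
  simp only [LogisticCP.logisticLik]; fun_prop

@[fun_prop]
lemma Measurable.vwProj {θ q : Ω → ℝ} {β z : Ω → Fin d → ℝ} (hθ : Measurable θ)
    (hq : Measurable q) (hβ : Measurable β) (hz : Measurable z) :
    Measurable fun ω => LogisticCP.vwProj (θ ω) (β ω) (z ω) (q ω) := by
  simp only [LogisticCP.vwProj, respVar, respProb]; fun_prop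

@[fun_prop]
lemma Measurable.sampleH {θ : Ω → ℝ} {β γ : Ω → Fin d → ℝ} {z : Ω → Fin n → Fin d → ℝ}
    (hθ : Measurable θ) (hβ : Measurable β) (hγ : Measurable γ) (hz : Measurable z) :
    Measurable fun ω => LogisticCP.sampleH (θ ω) (β ω) (γ ω) (z ω) := by
  refine measurable_pi_lambda _ fun i => ?_
  simp only [LogisticCP.sampleH]; fun_prop

@[fun_prop]
lemma Measurable.phi {θ : Ω → ℝ} {β : Ω → Fin d → ℝ} {z : Ω → Fin n → Fin d → ℝ}
    {h : Ω → Fin n → ℝ} (hθ : Measurable θ) (hβ : Measurable β) (hz : Measurable z)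
    (hh : Measurable h) : Measurable fun ω => LogisticCP.phi (θ ω) (β ω) (z ω) (h ω) := by
  refine measurable_pi_lambda _ fun i => ?_
  simp only [LogisticCP.phi]; fun_prop

lemma Measurable.logLik (D : Obs n d) {h φ : Ω → Fin n → ℝ} {θ : Ω → ℝ} (hh : Measurable h)
    (hφ : Measurable φ) (hθ : Measurable θ) :
    Measurable fun ω => LogisticCP.logLik D (h ω) (φ ω) (θ ω) := by
  simp only [LogisticCP.logLik, workPred]; fun_prop

variable {p : Fin n → (Fin d → ℝ) → ℝ} (hp : ∀ i, Measurable (p i)) (θ₀ : ℝ) (β₀ : Fin d → ℝ)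

include hp in
lemma measurable_oracleH (i : Fin n) : Measurable fun z => oracleH p θ₀ β₀ z i := by
  have := hp i
  simp only [oracleH]; fun_prop

lemma measurable_softplus : Measurable softplus :=
  continuous_iff_continuousAt.2 (fun x => (hasDerivAt_softplus x).continuousAt) |>.measurable

@[fun_prop]
lemma measurable_sigVar : Measurable sigVar := by
  unfold sigVar; fun_prop

lemma measurable_odds : Measurable odds := by
  unfold odds; fun_prop

include hp in
lemma measurable_projSlope (i : Fin n) : Measurable fun z => projSlope p θ₀ β₀ z i := by
  have h1 := hp i
  have h2 := measurable_softplus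
  have h3 := measurable_odds
  simp only [projSlope, logVarRatio]; fun_prop

@[fun_prop]
lemma measurable_resid (i : Fin n) (a : Bool × Bool) :
    Measurable fun z : Fin n → Fin d → ℝ => resid θ₀ β₀ z i a := by
  simp only [resid]; fun_prop

include hp in
lemma measurable_thetaEffect (i : Fin n) (a : Bool × Bool) :
    Measurable fun z => thetaEffect p θ₀ β₀ z i a := by
  have h1 := measurable_projSlope hp θ₀ β₀ i
  have h2 := measurable_oracleH hp θ₀ β₀ i
  simp only [thetaEffect]; fun_prop

include hp in
lemma measurable_predEffect (i : Fin n) (a : Bool × Bool) :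
    Measurable fun z => predEffect p θ₀ β₀ z i a := by
  have h1 := measurable_projSlope hp θ₀ β₀ i
  have h2 := measurable_oracleH hp θ₀ β₀ i
  simp only [predEffect]; fun_prop

include hp in
lemma measurable_infoTerm (i : Fin n) (x : Bool) :
    Measurable fun z => infoTerm p θ₀ β₀ z i x := by
  have h2 := measurable_oracleH hp θ₀ β₀ i
  simp only [infoTerm]; fun_prop

include hp in
lemma measurable_condInfo (i : Fin n) : Measurable fun z => condInfo p θ₀ β₀ z i := by
  have h1 := hp i
  have h2 := measurable_infoTerm hp θ₀ β₀ i
  simp only [condInfo_eq_sum]; fun_prop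

include hp in
lemma measurable_logitErr (i : Fin n) :
    Measurable fun w : (Fin n → Fin d → ℝ) × (Fin d → ℝ) => logitErr p w.1 w.2 i := by
  have h1 := hp i
  have h3 := measurable_odds
  simp only [logitErr]; fun_prop

lemma measurable_sum_obs {g : (Fin n → Fin d → ℝ) → Fin n → Bool × Bool → ℝ}
    (hg : ∀ i a, Measurable fun z => g z i a) :
    Measurable fun D : Obs n d => ∑ i, g D.2.2 i (D.1 i, D.2.1 i) := by
  refine Finset.measurable_sum _ fun i _ => ?_
  have h : Measurable fun w : (Fin n → Fin d → ℝ) × (Bool × Bool) => g w.1 i w.2 :=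
    measurable_from_prod_countable_left fun a => hg i a
  exact h.comp (by fun_prop : Measurable fun D : Obs n d => (D.2.2, (D.1 i, D.2.1 i)))

end Measurability

/-! ### Posterior measures -/

section Posterior

variable {α Ω : Type*} [MeasurableSpace α] [MeasurableSpace Ω]

lemma posterior_apply (prior : Measure α) (lik : α → ℝ) {S : Set α} (hS : MeasurableSet S) :
    posterior prior lik S
      = (∫⁻ a, ENNReal.ofReal (lik a) ∂prior)⁻¹ * ∫⁻ a in S, ENNReal.ofReal (lik a) ∂prior := by
  rw [posterior, Measure.smul_apply, withDensity_apply _ hS, smul_eq_mul]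

lemma isProbabilityMeasure_posterior (prior : Measure α) [IsProbabilityMeasure prior] {lik : α → ℝ}
    (hm : Measurable lik) (h0 : ∀ a, 0 < lik a) (h1 : ∀ a, lik a ≤ 1) :
    IsProbabilityMeasure (posterior prior lik) := by
  refine ⟨?_⟩
  rw [posterior_apply _ _ MeasurableSet.univ, Measure.restrict_univ]
  refine ENNReal.inv_mul_cancel ?_ ?_
  · rw [Ne, lintegral_eq_zero_iff (by fun_prop)]
    intro h
    obtain ⟨a, ha⟩ := h.exists
    simp only [Pi.zero_apply, ENNReal.ofReal_eq_zero] at ha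
    exact absurd ha (not_le.2 (h0 a))
  · refine ne_top_of_le_ne_top ENNReal.one_ne_top ?_
    calc ∫⁻ a, ENNReal.ofReal (lik a) ∂prior ≤ ∫⁻ _, 1 ∂prior :=
          lintegral_mono fun a => by simpa using h1 a
      _ = 1 := by simp

/-- The set may vary with the data; this is what Fubini and Markov need for the posterior mass of
`largePropEffect`. -/
lemma measurable_posterior_apply (prior : Measure α) [SFinite prior] {L : Ω × α → ℝ}
    (hL : Measurable L) {S : Set (Ω × α)} (hS : MeasurableSet S) :
    Measurable fun ω => posterior prior (fun a => L (ω, a)) {a | (ω, a) ∈ S} := by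
  have e : ∀ ω, posterior prior (fun a => L (ω, a)) {a | (ω, a) ∈ S}
      = (∫⁻ a, ENNReal.ofReal (L (ω, a)) ∂prior)⁻¹ *
        ∫⁻ a, S.indicator (fun w => ENNReal.ofReal (L w)) (ω, a) ∂prior := fun ω => by
    have hSω : MeasurableSet {a | (ω, a) ∈ S} := measurable_prodMk_left hS
    rw [posterior_apply _ _ hSω, ← lintegral_indicator hSω]
    rfl
  simp_rw [e]
  have h1 : Measurable fun w => ENNReal.ofReal (L w) := by fun_prop
  exact h1.lintegral_prod_right'.inv.mul (h1.indicator hS).lintegral_prod_right'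

variable {n d : ℕ}

lemma logisticLik_pos (y : Fin n → Bool) (η : Fin n → ℝ) : 0 < logisticLik y η :=
  Finset.prod_pos fun _ _ => bern_sigmoid_pos _ _

lemma bern_le_one {q : ℝ} (h0 : 0 ≤ q) (h1 : q ≤ 1) (b : Bool) : bern q b ≤ 1 := by
  cases b <;> simp [bern, h0, h1]

lemma logisticLik_le_one (y : Fin n → Bool) (η : Fin n → ℝ) : logisticLik y η ≤ 1 :=
  Finset.prod_le_one (fun _ _ => (bern_sigmoid_pos _ _).le) fun _ _ =>
    bern_le_one (Real.sigmoid_nonneg _) (Real.sigmoid_le_one _) _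

lemma isProbabilityMeasure_thetaPrior {π : ℝ → ℝ} (h1 : ∫⁻ t, ENNReal.ofReal (π t) = 1) :
    IsProbabilityMeasure (thetaPrior π) :=
  ⟨by rw [thetaPrior, withDensity_apply _ MeasurableSet.univ, Measure.restrict_univ, h1]⟩

lemma isProbabilityMeasure_thetaBetaPosterior {π : ℝ → ℝ} (h1 : ∫⁻ t, ENNReal.ofReal (π t) = 1)
    (Pβ : Measure (Fin d → ℝ)) [IsProbabilityMeasure Pβ] (D : Obs n d) :
    IsProbabilityMeasure (thetaBetaPosterior π Pβ D) := by
  have := isProbabilityMeasure_thetaPrior h1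
  exact isProbabilityMeasure_posterior _ (by fun_prop) (fun _ => logisticLik_pos _ _)
    fun _ => logisticLik_le_one _ _

lemma isProbabilityMeasure_gammaPosterior (Pγ : Measure (Fin d → ℝ)) [IsProbabilityMeasure Pγ]
    (D : Obs n d) : IsProbabilityMeasure (gammaPosterior Pγ D) :=
  isProbabilityMeasure_posterior _ (by fun_prop) (fun _ => logisticLik_pos _ _)
    fun _ => logisticLik_le_one _ _

lemma measurable_thetaBetaPosterior_apply {π : ℝ → ℝ} (h1 : ∫⁻ t, ENNReal.ofReal (π t) = 1)
    (Pβ : Measure (Fin d → ℝ)) [IsProbabilityMeasure Pβ] {S : Set (ℝ × (Fin d → ℝ))}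
    (hS : MeasurableSet S) :
    Measurable fun D : Obs n d => thetaBetaPosterior π Pβ D S := by
  have := isProbabilityMeasure_thetaPrior h1
  exact measurable_posterior_apply (Ω := Obs n d) ((thetaPrior π).prod Pβ)
    (L := fun v => logisticLik v.1.1 fun i => val (v.1.2.1 i) * v.2.1 + v.1.2.2 i ⬝ᵥ v.2.2)
    (by fun_prop) (S := {v | v.2 ∈ S}) (measurable_snd hS)

lemma measurable_gammaPosterior_apply (Pγ : Measure (Fin d → ℝ)) [IsProbabilityMeasure Pγ]
    {S : Set (Obs n d × (Fin d → ℝ))} (hS : MeasurableSet S) :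
    Measurable fun D : Obs n d => gammaPosterior Pγ D {γ | (D, γ) ∈ S} :=
  measurable_posterior_apply (Ω := Obs n d) Pγ
    (L := fun v => logisticLik v.1.2.1 fun i => v.1.2.2 i ⬝ᵥ v.2) (by fun_prop) hS

end Posterior

/-! ### Integration with respect to the law of the data -/

section DataLaw

variable {n d : ℕ} (Q : Measure (Fin n → Fin d → ℝ)) [IsProbabilityMeasure Q]
  {p : Fin n → (Fin d → ℝ) → ℝ} (hpm : ∀ i, Measurable (p i))
  (hp : ∀ i z, p i z ∈ Set.Ioo (0 : ℝ) 1) (θ₀ : ℝ) (β₀ : Fin d → ℝ)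

omit [IsProbabilityMeasure Q] in
include hpm hp in
-- The responses are summed innermost, so that one can condition on `(X, Z)`. The version with pairs
-- below has the product form over observations that suits conditioning on `Z` alone.
lemma lintegral_dataLaw {F : Obs n d → ℝ≥0∞} (hF : Measurable F) :
    ∫⁻ D, F D ∂(dataLaw Q p θ₀ β₀) = ∫⁻ z, ∑ x : Fin n → Bool,
      ENNReal.ofReal (∏ i, bern (p i (z i)) (x i)) * ∑ y : Fin n → Bool,
        ENNReal.ofReal (∏ i, bern (Real.sigmoid (val (x i) * θ₀ + z i ⬝ᵥ β₀)) (y i))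
          * F (y, x, z) ∂Q := by
  have hm : ∀ y x : Fin n → Bool, Measurable fun z : Fin n → Fin d → ℝ => (y, x, z) :=
    fun y x => by fun_prop
  have hw : ∀ y x : Fin n → Bool, Measurable fun z : Fin n → Fin d → ℝ => ENNReal.ofReal
      ((∏ i, bern (p i (z i)) (x i)) * logisticLik y fun i => val (x i) * θ₀ + z i ⬝ᵥ β₀) :=
    fun y x => by fun_prop
  have e : ∀ y x : Fin n → Bool, ∀ z : Fin n → Fin d → ℝ, ENNReal.ofReal
      ((∏ i, bern (p i (z i)) (x i)) * logisticLik y fun i => val (x i) * θ₀ + z i ⬝ᵥ β₀)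
        * F (y, x, z) = ENNReal.ofReal (∏ i, bern (p i (z i)) (x i)) *
        (ENNReal.ofReal (∏ i, bern (Real.sigmoid (val (x i) * θ₀ + z i ⬝ᵥ β₀)) (y i))
          * F (y, x, z)) := fun y x z => by
    rw [ENNReal.ofReal_mul (Finset.prod_nonneg fun i _ =>
      bern_nonneg (hp _ _).1.le (hp _ _).2.le _), mul_assoc]
    rfl
  rw [dataLaw]
  simp only [lintegral_finsetSum_measure, lintegral_map hF (hm _ _)]
  have hstep : ∀ y x : Fin n → Bool, ∫⁻ z, F (y, x, z) ∂(Q.withDensity fun z => ENNReal.ofReal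
      ((∏ i, bern (p i (z i)) (x i)) * logisticLik y fun i => val (x i) * θ₀ + z i ⬝ᵥ β₀))
      = ∫⁻ z, ENNReal.ofReal (∏ i, bern (p i (z i)) (x i)) *
        (ENNReal.ofReal (∏ i, bern (Real.sigmoid (val (x i) * θ₀ + z i ⬝ᵥ β₀)) (y i))
          * F (y, x, z)) ∂Q := fun y x => by
    rw [lintegral_withDensity_eq_lintegral_mul _ (hw y x)
      (show Measurable fun z => F (y, x, z) from hF.comp (hm y x))]
    exact lintegral_congr fun z => e y x z
  simp only [hstep]
  have hFm : ∀ y x : Fin n → Bool, Measurable fun z => ENNReal.ofReal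
      (∏ i, bern (p i (z i)) (x i)) *
        (ENNReal.ofReal (∏ i, bern (Real.sigmoid (val (x i) * θ₀ + z i ⬝ᵥ β₀)) (y i))
          * F (y, x, z)) := fun y x => by
    have := hF.comp (hm y x)
    simp only [Function.comp_def] at this
    fun_prop
  rw [Finset.sum_comm]
  simp only [Finset.mul_sum]
  rw [lintegral_finsetSum _ fun x _ => Finset.measurable_sum _ fun y _ => hFm y x]
  refine Finset.sum_congr rfl fun x _ => ?_
  rw [lintegral_finsetSum _ fun y _ => hFm y x]

omit [IsProbabilityMeasure Q] in
include hpm hp in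
lemma lintegral_dataLaw_pairs {F : Obs n d → ℝ≥0∞} (hF : Measurable F) :
    ∫⁻ D, F D ∂(dataLaw Q p θ₀ β₀) = ∫⁻ z, ∑ f : Fin n → Bool × Bool,
      ENNReal.ofReal (∏ i, obsWt p θ₀ β₀ z i (f i)) *
        F (fun i => (f i).1, fun i => (f i).2, z) ∂Q := by
  rw [lintegral_dataLaw Q hpm hp θ₀ β₀ hF]
  refine lintegral_congr fun z => ?_
  rw [← (Equiv.arrowProdEquivProdArrow (Fin n) (fun _ => Bool) (fun _ => Bool)).symm.sum_comp,
    Fintype.sum_prod_type_right]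
  refine Finset.sum_congr rfl fun x _ => ?_
  rw [Finset.mul_sum]
  refine Finset.sum_congr rfl fun y _ => ?_
  rw [← mul_assoc, ← ENNReal.ofReal_mul (Finset.prod_nonneg fun i _ =>
      bern_nonneg (hp _ _).1.le (hp _ _).2.le _), ← Finset.prod_mul_distrib]
  rfl

lemma sum_prod_obsWt (z : Fin n → Fin d → ℝ) :
    ∑ f : Fin n → Bool × Bool, ∏ i, obsWt p θ₀ β₀ z i (f i) = 1 := by
  rw [sum_prod_pi fun i a => obsWt p θ₀ β₀ z i a]
  simp only [sum_obsWt, Finset.prod_const_one]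

include hpm hp in
lemma isProbabilityMeasure_dataLaw : IsProbabilityMeasure (dataLaw Q p θ₀ β₀) := by
  refine ⟨?_⟩
  rw [← lintegral_one, lintegral_dataLaw_pairs Q hpm hp θ₀ β₀ measurable_const]
  simp only [mul_one]
  have : ∀ z, ∑ f : Fin n → Bool × Bool, ENNReal.ofReal (∏ i, obsWt p θ₀ β₀ z i (f i)) = 1 :=
    fun z => by
      rw [← ENNReal.ofReal_sum_of_nonneg fun f _ =>
        Finset.prod_nonneg fun i _ => obsWt_nonneg hp θ₀ β₀ z i _, sum_prod_obsWt,
        ENNReal.ofReal_one]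
  simp [this]

omit [IsProbabilityMeasure Q] in
include hpm hp in
lemma dataLaw_design {G : Set (Fin n → Fin d → ℝ)} (hG : MeasurableSet G) :
    dataLaw Q p θ₀ β₀ {D | D.2.2 ∈ G} = Q G := by
  have hG' : MeasurableSet {D : Obs n d | D.2.2 ∈ G} := measurable_snd (measurable_snd hG)
  rw [← lintegral_indicator_one hG',
    lintegral_dataLaw_pairs Q hpm hp θ₀ β₀ (measurable_one.indicator hG'),
    ← lintegral_indicator_one hG]
  refine lintegral_congr fun z => ?_
  have : ∀ f : Fin n → Bool × Bool, ({D : Obs n d | D.2.2 ∈ G}.indicator 1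
      ((fun i => (f i).1), (fun i => (f i).2), z) : ℝ≥0∞) = G.indicator 1 z := fun f => rfl
  simp only [this]
  rw [← Finset.sum_mul, ← ENNReal.ofReal_sum_of_nonneg fun f _ =>
        Finset.prod_nonneg fun i _ => obsWt_nonneg hp θ₀ β₀ z i _, sum_prod_obsWt,
        ENNReal.ofReal_one, one_mul]

include hpm hp in
-- The inequality is applied conditionally on the design, where the pairs are independent; its bound
-- does not depend on the design, whose law can therefore be arbitrary.
lemma dataLaw_hoeffding (hn : 0 < n) {g : (Fin n → Fin d → ℝ) → Fin n → Bool × Bool → ℝ}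
    (hgm : ∀ i a, Measurable fun z => g z i a) {c t : ℝ} (hc : 0 < c) (ht : 0 ≤ t)
    (hgc : ∀ᵐ z ∂Q, ∀ i a, |g z i a| ≤ c)
    (hg0 : ∀ z i, ∑ a, obsWt p θ₀ β₀ z i a * g z i a = 0) :
    dataLaw Q p θ₀ β₀ {D | t ≤ |∑ i, g D.2.2 i (D.1 i, D.2.1 i)|}
      ≤ ENNReal.ofReal (2 * Real.exp (-(t ^ 2 / (2 * (n * c ^ 2))))) := by
  classical
  have hB : MeasurableSet {D : Obs n d | t ≤ |∑ i, g D.2.2 i (D.1 i, D.2.1 i)|} :=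
    measurableSet_le measurable_const (measurable_sum_obs hgm).abs
  rw [← lintegral_indicator_one hB,
    lintegral_dataLaw_pairs Q hpm hp θ₀ β₀ (measurable_one.indicator hB)]
  refine (lintegral_mono_ae (hgc.mono fun z hz => ?_)).trans
    (le_of_eq (by rw [lintegral_const, measure_univ, mul_one]))
  have h := hoeffding_sum_pi hn hc (obsWt_nonneg hp θ₀ β₀ z) (sum_obsWt θ₀ β₀ z) hz (hg0 z) ht
    (fun f => t ≤ |∑ i, g z i (f i)|) fun f hf => hf
  refine le_trans (le_of_eq ?_) (ENNReal.ofReal_le_ofReal h)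
  rw [ENNReal.ofReal_sum_of_nonneg fun f _ => mul_nonneg
    (Finset.prod_nonneg fun i _ => obsWt_nonneg hp θ₀ β₀ z i _) (by split_ifs <;> simp)]
  refine Finset.sum_congr rfl fun f _ => ?_
  rw [ENNReal.ofReal_mul (Finset.prod_nonneg fun i _ => obsWt_nonneg hp θ₀ β₀ z i _)]
  congr 1
  simp only [Set.indicator_apply, Set.mem_ofPred_eq, Pi.one_apply]
  split_ifs <;> simp

/-- The values of `γ` with accurate propensity scores for which the first-order effect of the error
of the propensity score on the score is large. -/
def largePropEffect (p : Fin n → (Fin d → ℝ) → ℝ) (θ₀ : ℝ) (β₀ : Fin d → ℝ) (R t : ℝ) :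
    Set (Obs n d × (Fin d → ℝ)) :=
  {v | (∀ i, |logitErr p v.1.2.2 v.2 i| ≤ R) ∧
    t ≤ |∑ i, projSlope p θ₀ β₀ v.1.2.2 i * logitErr p v.1.2.2 v.2 i
      * resid θ₀ β₀ v.1.2.2 i (v.1.1 i, v.1.2.1 i)|}

include hpm in
lemma measurableSet_largePropEffect (R t : ℝ) :
    MeasurableSet (largePropEffect p θ₀ β₀ R t) := by
  have h1 : ∀ i, Measurable fun v : Obs n d × (Fin d → ℝ) => logitErr p v.1.2.2 v.2 i :=
    fun i => (measurable_logitErr hpm i).comp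
      (by fun_prop : Measurable fun v : Obs n d × (Fin d → ℝ) => (v.1.2.2, v.2))
  have h2 : ∀ i, Measurable fun v : Obs n d × (Fin d → ℝ) => projSlope p θ₀ β₀ v.1.2.2 i :=
    fun i => (measurable_projSlope hpm θ₀ β₀ i).comp (by fun_prop)
  have h3 : ∀ i, Measurable fun v : Obs n d × (Fin d → ℝ) =>
      resid θ₀ β₀ v.1.2.2 i (v.1.1 i, v.1.2.1 i) := fun i => by
    simp only [resid]; fun_prop
  have hA : MeasurableSet {v : Obs n d × (Fin d → ℝ) | ∀ i, |logitErr p v.1.2.2 v.2 i| ≤ R} := by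
    have e : {v : Obs n d × (Fin d → ℝ) | ∀ i, |logitErr p v.1.2.2 v.2 i| ≤ R}
        = ⋂ i, {v | |logitErr p v.1.2.2 v.2 i| ≤ R} := by ext; simp
    rw [e]
    exact MeasurableSet.iInter fun i => measurableSet_le (h1 i).abs measurable_const
  have hB : MeasurableSet {v : Obs n d × (Fin d → ℝ) |
      t ≤ |∑ i, projSlope p θ₀ β₀ v.1.2.2 i * logitErr p v.1.2.2 v.2 i
        * resid θ₀ β₀ v.1.2.2 i (v.1.1 i, v.1.2.1 i)|} :=
    measurableSet_le measurable_const
      (Finset.measurable_sum _ fun i _ => ((h2 i).mul (h1 i)).mul (h3 i)).abs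
  exact hA.inter hB

include hpm hp in
-- Given `(X, Z)`, the posterior of `γ` is a fixed measure independent of `Y`, so the sum over `Y`
-- and the integral over `γ` can be exchanged. For each fixed `γ` the sum of weighted residuals then
-- obeys Hoeffding's inequality.
lemma lintegral_gammaPosterior_largePropEffect_le (hn : 0 < n) (Pγ : Measure (Fin d → ℝ))
    [IsProbabilityMeasure Pγ] {R t : ℝ} (hR : 0 < R) (ht : 0 ≤ t) :
    ∫⁻ D, gammaPosterior Pγ D {γ | (D, γ) ∈ largePropEffect p θ₀ β₀ R t}
      ∂(dataLaw Q p θ₀ β₀) ≤ ENNReal.ofReal (2 * Real.exp (-(t ^ 2 / (2 * (n * R ^ 2))))) := by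
  classical
  set δ := ENNReal.ofReal (2 * Real.exp (-(t ^ 2 / (2 * (n * R ^ 2)))))
  have hS := measurableSet_largePropEffect hpm θ₀ β₀ R t
  rw [lintegral_dataLaw Q hpm hp θ₀ β₀ (measurable_gammaPosterior_apply Pγ hS)]
  have hinner : ∀ (z : Fin n → Fin d → ℝ) (x : Fin n → Bool), ∑ y : Fin n → Bool,
        ENNReal.ofReal (∏ i, bern (Real.sigmoid (val (x i) * θ₀ + z i ⬝ᵥ β₀)) (y i))
          * gammaPosterior Pγ (y, x, z)
            {γ | ((y, x, z), γ) ∈ largePropEffect p θ₀ β₀ R t} ≤ δ := fun z x => by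
    -- The responses `true` are a dummy value: the posterior of `γ` does not read them, so all
    -- choices agree by `rfl`.
    set ν := gammaPosterior Pγ ((fun _ => true), x, z) with hν
    have hνy : ∀ y : Fin n → Bool, gammaPosterior Pγ (y, x, z) = ν := fun y => rfl
    have : IsProbabilityMeasure ν := isProbabilityMeasure_gammaPosterior _ _
    have hSy : ∀ y : Fin n → Bool, MeasurableSet
        {γ | (((y, x, z) : Obs n d), γ) ∈ largePropEffect p θ₀ β₀ R t} :=
      fun y => measurable_prodMk_left hS
    simp only [hνy, ← lintegral_indicator_one (hSy _)]
    have hmul : ∀ (r : ℝ≥0∞) (y : Fin n → Bool), r * ∫⁻ γ,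
        {γ | (((y, x, z) : Obs n d), γ) ∈ largePropEffect p θ₀ β₀ R t}.indicator 1 γ ∂ν
        = ∫⁻ γ, r * {γ | (((y, x, z) : Obs n d), γ) ∈
            largePropEffect p θ₀ β₀ R t}.indicator 1 γ ∂ν := fun r y =>
      (lintegral_const_mul _ (measurable_one.indicator (hSy y))).symm
    simp only [hmul]
    rw [← lintegral_finsetSum _ fun y _ => (measurable_one.indicator (hSy y)).const_mul _]
    refine (lintegral_mono fun γ => ?_).trans
      (le_of_eq (by rw [lintegral_const, measure_univ, mul_one]) : ∫⁻ _, δ ∂ν ≤ δ)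
    -- This condition does not involve `y`. If it holds, `R` bounds each summand; if it fails, `γ`
    -- is never counted.
    by_cases hγ : ∀ i, |logitErr p z γ i| ≤ R
    · have h := hoeffding_sum_pi (α := Bool) hn hR
        (w := fun i b => bern (Real.sigmoid (val (x i) * θ₀ + z i ⬝ᵥ β₀)) b)
        (g := fun i b => projSlope p θ₀ β₀ z i * logitErr p z γ i * resid θ₀ β₀ z i (b, x i))
        (fun i b => (bern_sigmoid_pos _ _).le) (fun i => sum_bern _)
        (fun i b => by
          rw [mul_assoc, mul_comm (logitErr p z γ i)]
          exact abs_mul_le_of_abs_le_one (abs_projSlope_le_one θ₀ β₀ z i)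
            (abs_mul_le_of_abs_le_one (abs_resid_le_one θ₀ β₀ z i _) (hγ i)))
        (fun i => by
          have := sum_bern_mul_resid θ₀ β₀ z i (x i)
          simp only [mul_left_comm _ (projSlope p θ₀ β₀ z i * logitErr p z γ i),
            ← Finset.mul_sum, this, mul_zero]) ht
        (fun y => t ≤ |∑ i, projSlope p θ₀ β₀ z i * logitErr p z γ i
          * resid θ₀ β₀ z i (y i, x i)|) fun y hy => hy
      refine le_trans (le_of_eq ?_) (ENNReal.ofReal_le_ofReal h)
      rw [ENNReal.ofReal_sum_of_nonneg fun f _ => mul_nonneg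
        (Finset.prod_nonneg fun i _ => (bern_sigmoid_pos _ _).le) (by split_ifs <;> simp)]
      refine Finset.sum_congr rfl fun y _ => ?_
      rw [ENNReal.ofReal_mul (Finset.prod_nonneg fun i _ => (bern_sigmoid_pos _ _).le)]
      congr 1
      simp only [Set.indicator_apply, Set.mem_ofPred_eq, Pi.one_apply, largePropEffect]
      split_ifs with h1 h2 h2
      · simp
      · exact absurd h1.2 h2
      · exact absurd ⟨hγ, h2⟩ h1
      · simp
    · refine le_trans (le_of_eq ?_) zero_le
      refine Finset.sum_eq_zero fun y _ => ?_
      rw [Set.indicator_of_notMem (fun h => hγ h.1), mul_zero]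
  calc ∫⁻ z, ∑ x : Fin n → Bool,
      ENNReal.ofReal (∏ i, bern (p i (z i)) (x i)) * ∑ y : Fin n → Bool,
        ENNReal.ofReal (∏ i, bern (Real.sigmoid (val (x i) * θ₀ + z i ⬝ᵥ β₀)) (y i))
          * gammaPosterior Pγ (y, x, z)
            {γ | ((y, x, z), γ) ∈ largePropEffect p θ₀ β₀ R t} ∂Q
      ≤ ∫⁻ _, δ ∂Q := lintegral_mono fun z => by
        calc _ ≤ ∑ x : Fin n → Bool, ENNReal.ofReal (∏ i, bern (p i (z i)) (x i)) * δ :=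
              Finset.sum_le_sum fun x _ => by gcongr; exact hinner z x
          _ = δ := by
              rw [← Finset.sum_mul, ← ENNReal.ofReal_sum_of_nonneg fun f _ =>
                Finset.prod_nonneg fun i _ => bern_nonneg (hp _ _).1.le (hp _ _).2.le _,
                sum_prod_pi fun i b => bern (p i (z i)) b]
              simp only [sum_bern, Finset.prod_const_one, ENNReal.ofReal_one, one_mul]
    _ = δ := by rw [lintegral_const, measure_univ, mul_one]

end DataLaw

/-! ### The marginal posterior probability -/

section Marginal

variable {π : ℝ → ℝ} (hm : Measurable π) (h0 : ∀ t, 0 ≤ π t)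
  (h1 : ∫⁻ t, ENNReal.ofReal (π t) = 1) {n d : ℕ} (D : Obs n d)

include hm h0 h1 in
lemma integrable_density_mul_exp_logLik (h φ : Fin n → ℝ) :
    Integrable fun t => π t * Real.exp (logLik D h φ t) := by
  have hl : Measurable fun t => logLik D h φ t := (differentiable_logLik D h φ).continuous.measurable
  refine (integrable_density hm h0 h1).mono' (by fun_prop) (Eventually.of_forall fun t => ?_)
  rw [Real.norm_of_nonneg (mul_nonneg (h0 _) (Real.exp_pos _).le)]
  exact mul_le_of_le_one_right (h0 t) (Real.exp_le_one_iff.2 (logLik_nonpos D h φ t))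

include hm h0 h1 in
lemma integral_density_mul_exp_logLik_pos (h φ : Fin n → ℝ) :
    0 < ∫ t, π t * Real.exp (logLik D h φ t) := by
  have hnn : 0 ≤ fun t => π t * Real.exp (logLik D h φ t) :=
    fun t => mul_nonneg (h0 _) (Real.exp_pos _).le
  refine lt_of_le_of_ne (integral_nonneg hnn) fun hz => ?_
  rw [eq_comm, integral_eq_zero_iff_of_nonneg hnn (integrable_density_mul_exp_logLik hm h0 h1 D h φ)]
    at hz
  have : π =ᵐ[volume] 0 := hz.mono fun t ht => by
    simpa [(Real.exp_pos _).ne'] using ht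
  have h2 := integral_density hm h0 h1
  rw [integral_congr_ae this] at h2
  simp at h2

include hm h0 h1 in
lemma setLIntegral_thetaCondDensity (h φ : Fin n → ℝ) (A : Set ℝ) :
    ∫⁻ θ in A, thetaCondDensity π D h φ θ = ENNReal.ofReal
      ((∫ t in A, π t * Real.exp (logLik D h φ t)) / ∫ t, π t * Real.exp (logLik D h φ t)) := by
  have hi := integrable_density_mul_exp_logLik hm h0 h1 D h φ
  have hnn : ∀ t, 0 ≤ π t * Real.exp (logLik D h φ t) :=
    fun t => mul_nonneg (h0 _) (Real.exp_pos _).le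
  have hl : Measurable fun t => logLik D h φ t := (differentiable_logLik D h φ).continuous.measurable
  rw [ENNReal.ofReal_div_of_pos (integral_density_mul_exp_logLik_pos hm h0 h1 D h φ),
    ofReal_integral_eq_lintegral_ofReal hi (Eventually.of_forall hnn),
    ofReal_integral_eq_lintegral_ofReal hi.integrableOn (Eventually.of_forall hnn)]
  simp only [thetaCondDensity, div_eq_mul_inv]
  rw [lintegral_mul_const _ (by fun_prop)]

include hm in
lemma measurable_thetaCondDensity {Ω : Type*} [MeasurableSpace Ω] {h φ : Ω → Fin n → ℝ}
    {θ : Ω → ℝ} (hh : Measurable h) (hφ : Measurable φ) (hθ : Measurable θ) :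
    Measurable fun ω => thetaCondDensity π D (h ω) (φ ω) (θ ω) := by
  have h1 : Measurable fun ω => logLik D (h ω) (φ ω) (θ ω) := Measurable.logLik D hh hφ hθ
  have h2 : Measurable fun v : Ω × ℝ =>
      ENNReal.ofReal (π v.2 * Real.exp (logLik D (h v.1) (φ v.1) v.2)) := by
    have : Measurable fun v : Ω × ℝ => logLik D (h v.1) (φ v.1) v.2 :=
      Measurable.logLik D (by fun_prop) (by fun_prop) (by fun_prop)
    fun_prop
  have h3 := h2.lintegral_prod_right' (ν := volume)
  simp only [thetaCondDensity]
  exact (by fun_prop : Measurable fun ω =>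
    ENNReal.ofReal (π (θ ω) * Real.exp (logLik D (h ω) (φ ω) (θ ω)))).div h3

include hm h1 in
lemma setLIntegral_thetaDensity (Pβ Pγ : Measure (Fin d → ℝ)) [IsProbabilityMeasure Pβ]
    [IsProbabilityMeasure Pγ] (A : Set ℝ) :
    ∫⁻ θ in A, thetaDensity π Pβ Pγ D θ = ∫⁻ γ, ∫⁻ w, (∫⁻ θ in A,
      thetaCondDensity π D (sampleH w.1 w.2 γ D.2.2)
        (phi w.1 w.2 D.2.2 (sampleH w.1 w.2 γ D.2.2)) θ)
        ∂(thetaBetaPosterior π Pβ D) ∂(gammaPosterior Pγ D) := by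
  have := isProbabilityMeasure_thetaBetaPosterior h1 Pβ D
  have := isProbabilityMeasure_gammaPosterior Pγ D
  have hmeas : Measurable fun v : (ℝ × (Fin d → ℝ)) × (ℝ × (Fin d → ℝ)) =>
      thetaCondDensity π D (sampleH v.2.1 v.2.2 v.1.2 D.2.2)
        (phi v.2.1 v.2.2 D.2.2 (sampleH v.2.1 v.2.2 v.1.2 D.2.2)) v.1.1 :=
    measurable_thetaCondDensity hm D (by fun_prop) (by fun_prop) (by fun_prop)
  have hmeas2 := hmeas.lintegral_prod_right' (ν := thetaBetaPosterior π Pβ D)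
  simp only [thetaDensity]
  rw [lintegral_lintegral_swap hmeas2.aemeasurable]
  refine lintegral_congr fun γ => ?_
  exact lintegral_lintegral_swap (hmeas.comp (by fun_prop :
    Measurable fun v : ℝ × (ℝ × (Fin d → ℝ)) => ((v.1, γ), v.2))).aemeasurable

/-- On the exceptional sets the error is at most one, since both `J` and `G` lie in `[0, 1]`.
Neither measurability of `A`, `B` nor of `J` is required: the sets are replaced by measurable hulls.
-/
lemma lintegral_lintegral_close {α β : Type*} [MeasurableSpace α] [MeasurableSpace β]
    (μ : Measure α) (ν : Measure β) [IsProbabilityMeasure μ] [IsProbabilityMeasure ν]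
    {J : α → β → ℝ} (hJ0 : ∀ a b, 0 ≤ J a b) (hJ1 : ∀ a b, J a b ≤ 1) {G ε : ℝ} (hG0 : 0 ≤ G)
    (hG1 : G ≤ 1) (hε : 0 ≤ ε) {A : Set α} {B : Set β}
    (hclose : ∀ a ∉ A, ∀ b ∉ B, |J a b - G| ≤ ε) :
    |(∫⁻ a, ∫⁻ b, ENNReal.ofReal (J a b) ∂ν ∂μ).toReal - G| ≤ ε + μ.real A + ν.real B := by
  set A' := toMeasurable μ A
  set B' := toMeasurable ν B
  have hA' : MeasurableSet A' := measurableSet_toMeasurable _ _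
  have hB' : MeasurableSet B' := measurableSet_toMeasurable _ _
  set I := ∫⁻ a, ∫⁻ b, ENNReal.ofReal (J a b) ∂ν ∂μ
  have hI1 : I ≤ 1 := by
    calc I ≤ ∫⁻ _, ∫⁻ _, 1 ∂ν ∂μ := lintegral_mono fun a => lintegral_mono fun b => by
          simpa using hJ1 a b
      _ = 1 := by simp
  have key : ∀ c : ℝ≥0∞, ∫⁻ a, ∫⁻ b, (c + A'.indicator 1 a + B'.indicator 1 b) ∂ν ∂μ
      = c + μ A + ν B := fun c => by
    have : ∀ a, ∫⁻ b, (c + A'.indicator 1 a + B'.indicator 1 b) ∂ν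
        = c + A'.indicator 1 a + ν B := fun a => by
      rw [lintegral_add_left measurable_const, lintegral_const, measure_univ, mul_one,
        lintegral_indicator_one hB', measure_toMeasurable]
    simp only [this]
    rw [lintegral_add_right _ measurable_const,
      lintegral_add_left measurable_const, lintegral_const, lintegral_const, measure_univ, mul_one,
      mul_one, lintegral_indicator_one hA', measure_toMeasurable]
  have hbad : ∀ a b, (a ∈ A' ∨ b ∈ B') →
      (1 : ℝ≥0∞) ≤ A'.indicator 1 a + B'.indicator 1 b := fun a b h => by
    rcases h with h | h
    · rw [Set.indicator_of_mem h]; exact le_self_add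
    · rw [Set.indicator_of_mem h]; exact le_add_self
  have hgood : ∀ a b, ¬ (a ∈ A' ∨ b ∈ B') → |J a b - G| ≤ ε := fun a b h => by
    push Not at h
    exact hclose a (fun ha => h.1 (subset_toMeasurable _ _ ha)) b
      fun hb => h.2 (subset_toMeasurable _ _ hb)
  have up : I ≤ ENNReal.ofReal (G + ε) + μ A + ν B := by
    rw [← key]
    refine lintegral_mono fun a => lintegral_mono fun b => ?_
    by_cases h : a ∈ A' ∨ b ∈ B'
    · refine (ENNReal.ofReal_le_one.2 (hJ1 a b)).trans ((hbad a b h).trans ?_)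
      rw [add_assoc]; exact le_add_self
    · refine (ENNReal.ofReal_le_ofReal ?_).trans (le_self_add.trans le_self_add)
      linarith [(abs_le.1 (hgood a b h)).2]
  -- The error is added to `I` rather than subtracted from `G`: additivity of the lower integral
  -- then needs measurability of the error term only.
  have lo : ENNReal.ofReal G ≤ I + (ENNReal.ofReal ε + μ A + ν B) := by
    rw [← key]
    have hmA : Measurable fun v : α × β => (A'.indicator 1 v.1 : ℝ≥0∞) :=
      (measurable_one.indicator hA').comp measurable_fst
    have hmB' : Measurable fun v : α × β => (B'.indicator 1 v.2 : ℝ≥0∞) :=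
      (measurable_one.indicator hB').comp measurable_snd
    have hmB : Measurable fun v : α × β =>
        (ENNReal.ofReal ε + A'.indicator 1 v.1 + B'.indicator 1 v.2 : ℝ≥0∞) := by fun_prop
    have hmB2 := hmB.lintegral_prod_right' (ν := ν)
    have e : I + ∫⁻ a, ∫⁻ b, (ENNReal.ofReal ε + A'.indicator 1 a + B'.indicator 1 b) ∂ν ∂μ
        = ∫⁻ a, ∫⁻ b, (ENNReal.ofReal (J a b) +
          (ENNReal.ofReal ε + A'.indicator 1 a + B'.indicator 1 b)) ∂ν ∂μ := by
      rw [← lintegral_add_right _ hmB2]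
      refine lintegral_congr fun a => ?_
      exact (lintegral_add_right _ (show Measurable fun b =>
        (ENNReal.ofReal ε + A'.indicator 1 a + B'.indicator 1 b : ℝ≥0∞) from
          hmB.comp measurable_prodMk_left)).symm
    rw [e]
    calc ENNReal.ofReal G = ∫⁻ _, ∫⁻ _, ENNReal.ofReal G ∂ν ∂μ := by simp
      _ ≤ _ := lintegral_mono fun a => lintegral_mono fun b => ?_
    by_cases h : a ∈ A' ∨ b ∈ B'
    · refine (ENNReal.ofReal_le_one.2 hG1).trans ((hbad a b h).trans ?_)
      rw [add_assoc (ENNReal.ofReal ε), ← add_assoc]; exact le_add_self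
    · rw [add_assoc (ENNReal.ofReal ε), ← add_assoc]
      refine le_trans ?_ le_self_add
      rw [← ENNReal.ofReal_add (hJ0 a b) hε]
      refine ENNReal.ofReal_le_ofReal ?_
      linarith [(abs_le.1 (hgood a b h)).1]
  have hIt : I ≠ ∞ := ne_top_of_le_ne_top ENNReal.one_ne_top hI1
  have hAt := measure_ne_top μ A
  have hBt := measure_ne_top ν B
  have up' := ENNReal.toReal_mono (by finiteness) up
  have lo' := ENNReal.toReal_mono (by finiteness) lo
  rw [ENNReal.toReal_add (by finiteness) hBt, ENNReal.toReal_add (by finiteness) hAt,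
    ENNReal.toReal_ofReal (by linarith)] at up'
  rw [ENNReal.toReal_add hIt (by finiteness), ENNReal.toReal_add (by finiteness) hBt,
    ENNReal.toReal_add (by finiteness) hAt, ENNReal.toReal_ofReal hε,
    ENNReal.toReal_ofReal hG0] at lo'
  rw [abs_le]
  simp only [Measure.real]
  constructor <;> linarith

include hm h0 h1 in
lemma abs_thetaPosteriorProb_sub_le (Pβ Pγ : Measure (Fin d → ℝ)) [IsProbabilityMeasure Pβ]
    [IsProbabilityMeasure Pγ] (A : Set ℝ) {G ε : ℝ} (hG0 : 0 ≤ G) (hG1 : G ≤ 1) (hε : 0 ≤ ε)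
    {W : Set (ℝ × (Fin d → ℝ))} {Γ : Set (Fin d → ℝ)}
    (hclose : ∀ γ ∉ Γ, ∀ w ∉ W,
      |(∫ t in A, π t * Real.exp (logLik D (sampleH w.1 w.2 γ D.2.2)
          (phi w.1 w.2 D.2.2 (sampleH w.1 w.2 γ D.2.2)) t)) /
        (∫ t, π t * Real.exp (logLik D (sampleH w.1 w.2 γ D.2.2)
          (phi w.1 w.2 D.2.2 (sampleH w.1 w.2 γ D.2.2)) t)) - G| ≤ ε) :
    |thetaPosteriorProb π Pβ Pγ D A - G| ≤ ε + (gammaPosterior Pγ D).real Γ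
      + (thetaBetaPosterior π Pβ D).real W := by
  have := isProbabilityMeasure_thetaBetaPosterior h1 Pβ D
  have := isProbabilityMeasure_gammaPosterior Pγ D
  rw [thetaPosteriorProb, setLIntegral_thetaDensity hm h1]
  simp only [setLIntegral_thetaCondDensity hm h0 h1]
  have hnn : ∀ (h φ : Fin n → ℝ) t, 0 ≤ π t * Real.exp (logLik D h φ t) :=
    fun h φ t => mul_nonneg (h0 _) (Real.exp_pos _).le
  refine lintegral_lintegral_close _ _ (fun γ w => ?_) (fun γ w => ?_) hG0 hG1 hε hclose
  · exact div_nonneg (integral_nonneg (hnn _ _)) (integral_nonneg (hnn _ _))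
  · exact div_le_one_of_le₀ (setIntegral_le_integral
      (integrable_density_mul_exp_logLik hm h0 h1 D _ _) (Eventually.of_forall (hnn _ _)))
      (integral_nonneg (hnn _ _))

end Marginal

/-! ### Closeness of the perturbed score and information on well-behaved data -/

lemma gaussProb_mem_Icc {a b : ℝ} (hab : a < b) : gaussProb a b ∈ Set.Icc (0 : ℝ) 1 := by
  have hgi : ∫ u : ℝ, Real.exp (-(1 / 2) * u ^ 2) = Real.sqrt (2 * Real.pi) := by
    rw [integral_gaussian]; congr 1; ring
  have hsq : 0 < Real.sqrt (2 * Real.pi) := Real.sqrt_pos.2 (by positivity)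
  rw [gaussProb, intervalIntegral.integral_of_le hab.le]
  refine ⟨mul_nonneg (by positivity) (integral_nonneg fun u => (Real.exp_pos _).le), ?_⟩
  rw [one_div, inv_mul_le_iff₀ hsq, mul_one, ← hgi]
  exact setIntegral_le_integral (integrable_exp_neg_mul_sq (by norm_num))
    (Eventually.of_forall fun u => (Real.exp_pos _).le)

section FixedSampleSize

variable {n d : ℕ} {p : Fin n → (Fin d → ℝ) → ℝ} (hp : ∀ i z, p i z ∈ Set.Ioo (0 : ℝ) 1)
  (θ₀ : ℝ) (β₀ : Fin d → ℝ)

include hp in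
-- A deterministic statement, once the coefficient sums are bounded by `V`. The tolerance `τ √n` is
-- shared equally between the propensity effect and the sum of the `ℓ¹` pairing and the quadratic
-- remainder.
lemma score_obsInfo_close {D : Obs n d} {C V R₁ R₂ ρ τ : ℝ} (hC : 0 ≤ C)
    (hz : ∀ i j, |D.2.2 i j| ≤ C)
    (hVθ : |∑ i, thetaEffect p θ₀ β₀ D.2.2 i (D.1 i, D.2.1 i)| ≤ V)
    (hVj : ∀ j, |∑ i, D.2.2 i j * predEffect p θ₀ β₀ D.2.2 i (D.1 i, D.2.1 i)| ≤ V)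
    {w : ℝ × (Fin d → ℝ)} {γ : Fin d → ℝ} (hw : l1Dist w (θ₀, β₀) ≤ R₁)
    (hγ : ∀ i, |logitErr p D.2.2 γ i| ≤ R₂)
    (hT : |∑ i, projSlope p θ₀ β₀ D.2.2 i * logitErr p D.2.2 γ i
        * resid θ₀ β₀ D.2.2 i (D.1 i, D.2.1 i)| ≤ τ / 2 * Real.sqrt n)
    (hρ₁ : (1 + C) * R₁ ≤ ρ) (hρ₂ : R₂ ≤ ρ)
    (hnum : R₁ * V + n * (102 * ρ ^ 2) ≤ τ / 2 * Real.sqrt n) (hnum' : 18 * ρ ≤ τ) :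
    |score D (sampleH w.1 w.2 γ D.2.2) (phi w.1 w.2 D.2.2 (sampleH w.1 w.2 γ D.2.2)) θ₀
      - score D (oracleH p θ₀ β₀ D.2.2) (phi θ₀ β₀ D.2.2 (oracleH p θ₀ β₀ D.2.2)) θ₀|
        ≤ τ * Real.sqrt n ∧
    |obsInfo D (sampleH w.1 w.2 γ D.2.2) (phi w.1 w.2 D.2.2 (sampleH w.1 w.2 γ D.2.2)) θ₀
      - obsInfo D (oracleH p θ₀ β₀ D.2.2) (phi θ₀ β₀ D.2.2 (oracleH p θ₀ β₀ D.2.2)) θ₀|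
        ≤ τ * n := by
  have hl : |w.1 - θ₀| + ∑ j, |w.2 j - β₀ j| ≤ R₁ := hw
  have hs0 : 0 ≤ ∑ j, |w.2 j - β₀ j| := Finset.sum_nonneg fun _ _ => abs_nonneg _
  have hR₁ : 0 ≤ R₁ := (add_nonneg (abs_nonneg _) hs0).trans hl
  have hCR : 0 ≤ C * R₁ := mul_nonneg hC hR₁
  have hV : 0 ≤ V := (abs_nonneg _).trans hVθ
  have hΔ : |w.1 - θ₀| ≤ ρ := by linarith
  have hζ : ∀ i, |D.2.2 i ⬝ᵥ (w.2 - β₀)| ≤ ρ := fun i => by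
    calc |D.2.2 i ⬝ᵥ (w.2 - β₀)| ≤ ∑ j, |D.2.2 i j * (w.2 - β₀) j| :=
          Finset.abs_sum_le_sum_abs _ _
      _ ≤ ∑ j, C * |w.2 j - β₀ j| := Finset.sum_le_sum fun j _ => by
          rw [abs_mul]
          exact mul_le_mul_of_nonneg_right (hz i j) (abs_nonneg _)
      _ = C * ∑ j, |w.2 j - β₀ j| := by rw [Finset.mul_sum]
      _ ≤ C * R₁ := mul_le_mul_of_nonneg_left (by linarith [abs_nonneg (w.1 - θ₀)]) hC
      _ ≤ ρ := by linarith
  have hu : ∀ i, |logitErr p D.2.2 γ i| ≤ ρ := fun i => (hγ i).trans hρ₂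
  refine ⟨(abs_score_sampleH_sub_le hp θ₀ β₀ D hΔ hζ hu).trans ?_,
    (abs_obsInfo_sampleH_sub_le hp θ₀ β₀ D hΔ hζ hu).trans ?_⟩
  · have h1 : |w.1 - θ₀| * |∑ i, thetaEffect p θ₀ β₀ D.2.2 i (D.1 i, D.2.1 i)|
        + ∑ j, |w.2 j - β₀ j| * |∑ i, D.2.2 i j * predEffect p θ₀ β₀ D.2.2 i (D.1 i, D.2.1 i)|
        ≤ R₁ * V := by
      calc _ ≤ |w.1 - θ₀| * V + ∑ j, |w.2 j - β₀ j| * V := by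
            refine add_le_add (mul_le_mul_of_nonneg_left hVθ (abs_nonneg _))
              (Finset.sum_le_sum fun j _ => mul_le_mul_of_nonneg_left (hVj j) (abs_nonneg _))
        _ = (|w.1 - θ₀| + ∑ j, |w.2 j - β₀ j|) * V := by rw [← Finset.sum_mul]; ring
        _ ≤ R₁ * V := mul_le_mul_of_nonneg_right hl hV
    linarith
  · rw [mul_comm]; exact mul_le_mul_of_nonneg_right hnum' (Nat.cast_nonneg n)

/-! ### Probabilities of the exceptional events -/

variable (Q : Measure (Fin n → Fin d → ℝ)) [IsProbabilityMeasure Q]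
  (hpm : ∀ i, Measurable (p i))

include hpm hp in
lemma dataLaw_score_large (hn : 0 < n) {K : ℝ} (hK : 0 ≤ K) :
    dataLaw Q p θ₀ β₀ {D | K * Real.sqrt n ≤
      |score D (oracleH p θ₀ β₀ D.2.2) (phi θ₀ β₀ D.2.2 (oracleH p θ₀ β₀ D.2.2)) θ₀|}
      ≤ ENNReal.ofReal (2 * Real.exp (-(K ^ 2 / 2))) := by
  have hn' : (0 : ℝ) < n := by exact_mod_cast hn
  simp only [score_oracle_eq]
  have h := dataLaw_hoeffding Q hpm hp θ₀ β₀ hn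
    (g := fun z i a => (val a.2 - oracleH p θ₀ β₀ z i) * resid θ₀ β₀ z i a)
    (fun i a => by
      have := measurable_oracleH hpm θ₀ β₀ i
      fun_prop) one_pos (t := K * Real.sqrt n) (by positivity)
    (Eventually.of_forall fun z i a => abs_mul_le_of_abs_le_one
      (abs_val_sub_oracleH_le_one hp θ₀ β₀ z i _) (abs_resid_le_one θ₀ β₀ z i a))
    (fun z i => sum_obsWt_mul_mul_resid θ₀ β₀ z i fun b => val b - oracleH p θ₀ β₀ z i)
  have e : (K * Real.sqrt n) ^ 2 / (2 * (n * 1 ^ 2)) = K ^ 2 / 2 := by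
    rw [mul_pow, Real.sq_sqrt hn'.le]; field_simp
  rwa [e] at h

include hpm hp in
lemma dataLaw_info_fluctuation (hn : 0 < n) {k : ℝ} (hk : 0 ≤ k) :
    dataLaw Q p θ₀ β₀ {D | k * n ≤
      |∑ i, (infoTerm p θ₀ β₀ D.2.2 i (D.2.1 i) - condInfo p θ₀ β₀ D.2.2 i)|}
      ≤ ENNReal.ofReal (2 * Real.exp (-(k ^ 2 / 2 * n))) := by
  have hn' : (0 : ℝ) < n := by exact_mod_cast hn
  have h := dataLaw_hoeffding Q hpm hp θ₀ β₀ hn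
    (g := fun z i a => infoTerm p θ₀ β₀ z i a.2 - condInfo p θ₀ β₀ z i)
    (fun i a => (measurable_infoTerm hpm θ₀ β₀ i a.2).sub (measurable_condInfo hpm θ₀ β₀ i))
    one_pos (t := k * n) (by positivity)
    (Eventually.of_forall fun z i a => abs_infoTerm_sub_condInfo_le hp θ₀ β₀ z i a.2)
    (fun z i => sum_obsWt_mul_infoTerm_sub θ₀ β₀ z i)
  have e : (k * n) ^ 2 / (2 * (n * 1 ^ 2)) = k ^ 2 / 2 * n := by field_simp
  rwa [e] at h

/-- With `l = log (d ∨ n)` the tail becomes a multiple of `(d ∨ n)⁻²`, which survives a union over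
`d + 1` coordinates. -/
lemma exp_neg_hoeffding_rate {c l : ℝ} (hn : 0 < n) (hc : 0 < c) (hl : 0 ≤ l) :
    (2 * c * Real.sqrt (n * l)) ^ 2 / (2 * (n * c ^ 2)) = 2 * l := by
  have hn' : (0 : ℝ) < n := by exact_mod_cast hn
  rw [mul_pow, Real.sq_sqrt (by positivity)]; field_simp

include hpm hp in
lemma dataLaw_thetaEffect_large (hn : 0 < n) {c l : ℝ} (hc : 3 ≤ c) (hl : 0 ≤ l) :
    dataLaw Q p θ₀ β₀ {D | 2 * c * Real.sqrt (n * l) ≤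
      |∑ i, thetaEffect p θ₀ β₀ D.2.2 i (D.1 i, D.2.1 i)|}
      ≤ ENNReal.ofReal (2 * Real.exp (-(2 * l))) := by
  have h := dataLaw_hoeffding Q hpm hp θ₀ β₀ hn
    (g := fun z i a => thetaEffect p θ₀ β₀ z i a) (measurable_thetaEffect hpm θ₀ β₀)
    (show 0 < c by linarith) (t := 2 * c * Real.sqrt (n * l)) (by positivity)
    (Eventually.of_forall fun z i a => (abs_thetaEffect_le hp θ₀ β₀ z i a).trans hc)
    (fun z i => sum_obsWt_mul_thetaEffect hp θ₀ β₀ z i)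
  rwa [exp_neg_hoeffding_rate hn (by linarith) hl] at h

include hpm hp in
lemma dataLaw_predEffect_large (hn : 0 < n) {C c l : ℝ} (hz : ∀ᵐ z ∂Q, ∀ i j, |z i j| ≤ C)
    (hc0 : 0 < c) (hc : C * 3 ≤ c) (hl : 0 ≤ l) (j : Fin d) :
    dataLaw Q p θ₀ β₀ {D | 2 * c * Real.sqrt (n * l) ≤
      |∑ i, D.2.2 i j * predEffect p θ₀ β₀ D.2.2 i (D.1 i, D.2.1 i)|}
      ≤ ENNReal.ofReal (2 * Real.exp (-(2 * l))) := by
  have h := dataLaw_hoeffding Q hpm hp θ₀ β₀ hn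
    (g := fun z i a => z i j * predEffect p θ₀ β₀ z i a)
    (fun i a => by
      have := measurable_predEffect hpm θ₀ β₀ i a
      fun_prop) hc0 (t := 2 * c * Real.sqrt (n * l)) (by positivity)
    (hz.mono fun z hz i a => by
      rw [abs_mul]
      exact (mul_le_mul (hz i j) (abs_predEffect_le hp θ₀ β₀ z i a) (abs_nonneg _)
        ((abs_nonneg _).trans (hz i j))).trans hc)
    (fun z i => sum_obsWt_mul_predEffect hp θ₀ β₀ z i (z i j))
  rwa [exp_neg_hoeffding_rate hn hc0 hl] at h

include hpm hp in
lemma dataLaw_largePropEffect (hn : 0 < n) (Pγ : Measure (Fin d → ℝ)) [IsProbabilityMeasure Pγ]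
    {R t ε : ℝ} (hR : 0 < R) (ht : 0 ≤ t) (hε : 0 < ε) :
    dataLaw Q p θ₀ β₀ {D | ENNReal.ofReal ε ≤
      gammaPosterior Pγ D {γ | (D, γ) ∈ largePropEffect p θ₀ β₀ R t}}
      ≤ ENNReal.ofReal (2 * Real.exp (-(t ^ 2 / (2 * (n * R ^ 2)))) / ε) := by
  have hS := measurableSet_largePropEffect hpm θ₀ β₀ R t
  refine (meas_ge_le_lintegral_div (measurable_gammaPosterior_apply Pγ hS).aemeasurable
    (by simpa using hε) ENNReal.ofReal_ne_top).trans ?_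
  rw [ENNReal.ofReal_div_of_pos hε]
  gcongr
  exact lintegral_gammaPosterior_largePropEffect_le Q hpm hp θ₀ β₀ hn Pγ hR ht

lemma log_odds_sigmoid_div_eq (z : Fin n → Fin d → ℝ) (γ : Fin d → ℝ) (i : Fin n)
    (hpi : p i (z i) ∈ Set.Ioo (0 : ℝ) 1) :
    Real.log (odds (Real.sigmoid (z i ⬝ᵥ γ)) / odds (p i (z i))) = logitErr p z γ i := by
  rw [Real.log_div (odds_pos (sigmoid_mem_Ioo _)).ne' (odds_pos hpi).ne', log_odds_sigmoid]
  rfl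

include hpm hp in
-- The content is measurability of the event, without which a lower bound on its outer measure says
-- nothing about its complement.
lemma dataLaw_gammaPosterior_compl (Pγ : Measure (Fin d → ℝ)) [IsProbabilityMeasure Pγ]
    {R B q : ℝ} (h : 1 - q ≤ (dataLaw Q p θ₀ β₀).real
      {D | (gammaPosterior Pγ D).real {γ | ∃ i, R ≤
        |Real.log (odds (Real.sigmoid (D.2.2 i ⬝ᵥ γ)) / odds (p i (D.2.2 i)))|} ≤ B}) :
    (dataLaw Q p θ₀ β₀).real {D | ¬ (gammaPosterior Pγ D).real {γ | ∃ i, R ≤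
        |Real.log (odds (Real.sigmoid (D.2.2 i ⬝ᵥ γ)) / odds (p i (D.2.2 i)))|} ≤ B} ≤ q := by
  have := isProbabilityMeasure_dataLaw Q hpm hp θ₀ β₀
  have hS : MeasurableSet {v : Obs n d × (Fin d → ℝ) | ∃ i, R ≤
      |Real.log (odds (Real.sigmoid (v.1.2.2 i ⬝ᵥ v.2)) / odds (p i (v.1.2.2 i)))|} := by
    have e : {v : Obs n d × (Fin d → ℝ) | ∃ i, R ≤
        |Real.log (odds (Real.sigmoid (v.1.2.2 i ⬝ᵥ v.2)) / odds (p i (v.1.2.2 i)))|}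
        = ⋃ i, {v | R ≤
        |Real.log (odds (Real.sigmoid (v.1.2.2 i ⬝ᵥ v.2)) / odds (p i (v.1.2.2 i)))|} := by
      ext; simp
    rw [e]
    have := measurable_odds
    refine MeasurableSet.iUnion fun i => measurableSet_le measurable_const ?_
    have := hpm i
    fun_prop
  have hE : MeasurableSet {D : Obs n d | (gammaPosterior Pγ D).real {γ | ∃ i, R ≤
      |Real.log (odds (Real.sigmoid (D.2.2 i ⬝ᵥ γ)) / odds (p i (D.2.2 i)))|} ≤ B} :=
    measurableSet_le (measurable_gammaPosterior_apply Pγ hS).ennreal_toReal measurable_const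
  have hc := probReal_compl_eq_one_sub (μ := dataLaw Q p θ₀ β₀) hE
  calc _ = _ := hc
    _ ≤ q := by linarith

include hpm hp in
lemma dataLaw_thetaBetaPosterior_compl {π : ℝ → ℝ} (h1 : ∫⁻ t, ENNReal.ofReal (π t) = 1)
    (Pβ : Measure (Fin d → ℝ)) [IsProbabilityMeasure Pβ] {R R' B q : ℝ}
    (h : 1 - q ≤ (dataLaw Q p θ₀ β₀).real
      {D | (thetaBetaPosterior π Pβ D).real
        {w | R ≤ l1Dist w (θ₀, β₀) ∨ R' ≤ l2Dist w (θ₀, β₀)} ≤ B}) :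
    (dataLaw Q p θ₀ β₀).real {D | ¬ (thetaBetaPosterior π Pβ D).real
        {w | R ≤ l1Dist w (θ₀, β₀) ∨ R' ≤ l2Dist w (θ₀, β₀)} ≤ B} ≤ q := by
  have := isProbabilityMeasure_dataLaw Q hpm hp θ₀ β₀
  have hS : MeasurableSet {w : ℝ × (Fin d → ℝ) |
      R ≤ l1Dist w (θ₀, β₀) ∨ R' ≤ l2Dist w (θ₀, β₀)} := by
    have hA : MeasurableSet {w : ℝ × (Fin d → ℝ) | R ≤ l1Dist w (θ₀, β₀)} := by
      simp only [l1Dist]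
      exact measurableSet_le measurable_const (by fun_prop)
    have hB : MeasurableSet {w : ℝ × (Fin d → ℝ) | R' ≤ l2Dist w (θ₀, β₀)} := by
      simp only [l2Dist]
      exact measurableSet_le measurable_const (by fun_prop)
    exact hA.union hB
  have hE : MeasurableSet {D : Obs n d | (thetaBetaPosterior π Pβ D).real
        {w | R ≤ l1Dist w (θ₀, β₀) ∨ R' ≤ l2Dist w (θ₀, β₀)} ≤ B} :=
    measurableSet_le (measurable_thetaBetaPosterior_apply h1 Pβ hS).ennreal_toReal
      measurable_const
  have hc := probReal_compl_eq_one_sub (μ := dataLaw Q p θ₀ β₀) hE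
  calc _ = _ := hc
    _ ≤ q := by linarith

lemma l1Dist_nonneg (u v : ℝ × (Fin d → ℝ)) : 0 ≤ l1Dist u v :=
  add_nonneg (abs_nonneg _) (Finset.sum_nonneg fun _ _ => abs_nonneg _)

omit [IsProbabilityMeasure Q] in
/-- Contraction of the nuisance posterior at a rate proportional to the sparsity is impossible when
the sparsity is zero. -/
lemma numNonzero_pos_of_contraction {π : ℝ → ℝ} (h1 : ∫⁻ t, ENNReal.ofReal (π t) = 1)
    (Pβ : Measure (Fin d → ℝ)) [IsProbabilityMeasure Pβ] {M r B q : ℝ} {R' : ℝ}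
    (hB : B < 1) (hq : q < 1)
    (h : 1 - q ≤ (dataLaw Q p θ₀ β₀).real
      {D | (thetaBetaPosterior π Pβ D).real
        {w | M * numNonzero β₀ * r ≤ l1Dist w (θ₀, β₀) ∨ R' ≤ l2Dist w (θ₀, β₀)} ≤ B}) :
    1 ≤ numNonzero β₀ := by
  by_contra hs
  have hs0 : numNonzero β₀ = 0 := by omega
  have hE : {D : Obs n d | (thetaBetaPosterior π Pβ D).real
        {w | M * numNonzero β₀ * r ≤ l1Dist w (θ₀, β₀) ∨ R' ≤ l2Dist w (θ₀, β₀)} ≤ B} = ∅ := by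
    refine Set.eq_empty_iff_forall_notMem.2 fun D hD => ?_
    have := isProbabilityMeasure_thetaBetaPosterior h1 Pβ D
    -- With zero sparsity the `ℓ¹` threshold is zero, so every draw counts as far and has total
    -- posterior mass one.
    have hU : {w : ℝ × (Fin d → ℝ) | M * numNonzero β₀ * r ≤ l1Dist w (θ₀, β₀) ∨
        R' ≤ l2Dist w (θ₀, β₀)} = Set.univ :=
      Set.eq_univ_of_forall fun w => Or.inl (by simpa [hs0] using l1Dist_nonneg w _)
    rw [Set.mem_ofPred_eq, hU, probReal_univ] at hD
    linarith
  rw [hE, measureReal_empty] at h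
  linarith

end FixedSampleSize

/-! ### The exceptional data sets -/

section ExceptionalSet

variable {n d : ℕ} {p : Fin n → (Fin d → ℝ) → ℝ} (hp : ∀ i z, p i z ∈ Set.Ioo (0 : ℝ) 1)
  (θ₀ : ℝ) (β₀ : Fin d → ℝ) (Q : Measure (Fin n → Fin d → ℝ)) [IsProbabilityMeasure Q]
  (hpm : ∀ i, Measurable (p i))

omit [IsProbabilityMeasure Q] in
include hpm hp in
lemma dataLaw_unbounded_design {C : ℝ} (hz : ∀ᵐ z ∂Q, ∀ i j, |z i j| ≤ C) :
    (dataLaw Q p θ₀ β₀).real {D | ¬ ∀ i j, |D.2.2 i j| ≤ C} = 0 := by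
  have hG : MeasurableSet {z : Fin n → Fin d → ℝ | ¬ ∀ i j, |z i j| ≤ C} := by
    have e : {z : Fin n → Fin d → ℝ | ¬ ∀ i j, |z i j| ≤ C}
        = (⋂ i, ⋂ j, {z | |z i j| ≤ C})ᶜ := by ext; simp
    rw [e]
    refine (MeasurableSet.iInter fun i => MeasurableSet.iInter fun j =>
      measurableSet_le ?_ measurable_const).compl
    fun_prop
  have h := dataLaw_design Q hpm hp θ₀ β₀ hG
  have h2 : Q {z : Fin n → Fin d → ℝ | ¬ ∀ i j, |z i j| ≤ C} = 0 := hz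
  rw [h2] at h
  rw [Measure.real, show {D : Obs n d | ¬ ∀ i j, |D.2.2 i j| ≤ C} =
    {D | D.2.2 ∈ {z : Fin n → Fin d → ℝ | ¬ ∀ i j, |z i j| ≤ C}} from rfl, h, ENNReal.toReal_zero]

include hpm hp in
lemma dataLaw_small_info (κ : ℝ) :
    (dataLaw Q p θ₀ β₀).real {D | ¬ κ ≤ (∑ i, condInfo p θ₀ β₀ D.2.2 i) / n}
      = 1 - Q.real {z | κ ≤ (∑ i, condInfo p θ₀ β₀ z i) / n} := by
  have hG : MeasurableSet {z : Fin n → Fin d → ℝ | κ ≤ (∑ i, condInfo p θ₀ β₀ z i) / n} := by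
    refine measurableSet_le measurable_const ?_
    have := measurable_condInfo hpm θ₀ β₀
    fun_prop
  have h := dataLaw_design Q hpm hp θ₀ β₀ hG.compl
  rw [← probReal_compl_eq_one_sub hG, Measure.real, Measure.real, ← h]
  rfl

include hpm hp in
-- Outside the exceptional events the conclusion holds deterministically, so the probability of
-- failure is at most the sum of theirs.
lemma dataLaw_posterior_far_le {π : ℝ → ℝ} (hm : Measurable π) (h0 : ∀ t, 0 ≤ π t)
    (h1 : ∫⁻ t, ENNReal.ofReal (π t) = 1) (Pβ Pγ : Measure (Fin d → ℝ)) [IsProbabilityMeasure Pβ]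
    [IsProbabilityMeasure Pγ] {a b ε K κ τ C c l R₁ R₂ R' ρ B₁ B₂ q₁ q₂ : ℝ} (hab : a < b)
    (hn : 0 < n) (hε : 0 < ε) (hK : 0 ≤ K) (hκ : 0 < κ) (hτ : 0 < τ) (hC : 0 ≤ C)
    (hc3 : 3 ≤ c) (hcC : C * 3 ≤ c) (hl : 0 ≤ l) (hR₂ : 0 < R₂)
    (hz : ∀ᵐ z ∂Q, ∀ i j, |z i j| ≤ C)
    (hratio : ∀ (D : Obs n d) (h₀ φ₀ : Fin n → ℝ),
      (∀ i, |val (D.2.1 i) - h₀ i| ≤ 1) → |score D h₀ φ₀ θ₀| ≤ K * Real.sqrt n →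
      κ / 2 * n ≤ obsInfo D h₀ φ₀ θ₀ → ∀ m : ℝ,
      ((∃ t, IsMaxOn (logLik D h₀ φ₀) Set.univ t) → IsMaxOn (logLik D h₀ φ₀) Set.univ m) →
      ∀ σ, σ = (Real.sqrt (-iteratedDeriv 2 (logLik D h₀ φ₀) m))⁻¹ →
      ∀ h φ : Fin n → ℝ, (∀ i, |val (D.2.1 i) - h i| ≤ 1) →
      |score D h φ θ₀ - score D h₀ φ₀ θ₀| ≤ τ * Real.sqrt n →
      |obsInfo D h φ θ₀ - obsInfo D h₀ φ₀ θ₀| ≤ τ * n →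
      |(∫ t in Set.Ioo (m + a * σ) (m + b * σ), π t * Real.exp (logLik D h φ t)) /
        (∫ t, π t * Real.exp (logLik D h φ t)) - gaussProb a b| ≤ ε / 4)
    (hβ : 1 - q₁ ≤ (dataLaw Q p θ₀ β₀).real
      {D | (thetaBetaPosterior π Pβ D).real
        {w | R₁ ≤ l1Dist w (θ₀, β₀) ∨ R' ≤ l2Dist w (θ₀, β₀)} ≤ B₁})
    (hγ : 1 - q₂ ≤ (dataLaw Q p θ₀ β₀).real
      {D | (gammaPosterior Pγ D).real {γ | ∃ i, R₂ ≤
        |Real.log (odds (Real.sigmoid (D.2.2 i ⬝ᵥ γ)) / odds (p i (D.2.2 i)))|} ≤ B₂})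
    (hB₁ : B₁ ≤ ε / 8) (hB₂ : B₂ ≤ ε / 8) (hρ₁ : (1 + C) * R₁ ≤ ρ) (hρ₂ : R₂ ≤ ρ)
    (hnum : R₁ * (2 * c * Real.sqrt (n * l)) + n * (102 * ρ ^ 2) ≤ τ / 2 * Real.sqrt n)
    (hnum' : 18 * ρ ≤ τ) (θhat : Obs n d → ℝ)
    (hθhat : ∀ D, (∃ t, IsMaxOn (oracleLogLik p θ₀ β₀ D) Set.univ t) →
      IsMaxOn (oracleLogLik p θ₀ β₀ D) Set.univ (θhat D)) :
    (dataLaw Q p θ₀ β₀).real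
      {D | ε ≤ |thetaPosteriorProb π Pβ Pγ D
          (Set.Ioo (θhat D + a * oracleSigma p θ₀ β₀ D (θhat D))
            (θhat D + b * oracleSigma p θ₀ β₀ D (θhat D))) - gaussProb a b|}
      ≤ (1 - Q.real {z | κ ≤ (∑ i, condInfo p θ₀ β₀ z i) / n})
        + 2 * Real.exp (-(K ^ 2 / 2)) + 2 * Real.exp (-((κ / 2) ^ 2 / 2 * n))
        + (d + 1) * (2 * Real.exp (-(2 * l))) + q₁ + q₂
        + 2 * Real.exp (-((τ / 2 * Real.sqrt n) ^ 2 / (2 * (n * R₂ ^ 2)))) / (ε / 8) := by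
  have hprob := isProbabilityMeasure_dataLaw Q hpm hp θ₀ β₀
  have hn' : (0 : ℝ) < n := by exact_mod_cast hn
  have hc0 : 0 < c := by linarith
  set μ := dataLaw Q p θ₀ β₀ with hμ
  set V := 2 * c * Real.sqrt (n * l) with hV
  set T := τ / 2 * Real.sqrt n with hT
  have toR : ∀ {S : Set (Obs n d)} {x : ℝ}, 0 ≤ x → μ S ≤ ENNReal.ofReal x → μ.real S ≤ x :=
    fun hx h => ENNReal.toReal_le_of_le_ofReal hx h
  set E0 : Set (Obs n d) := {D | ¬ ∀ i j, |D.2.2 i j| ≤ C} with hE0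
  set E1 : Set (Obs n d) := {D | ¬ κ ≤ (∑ i, condInfo p θ₀ β₀ D.2.2 i) / n} with hE1
  set E2 : Set (Obs n d) := {D | K * Real.sqrt n ≤
      |score D (oracleH p θ₀ β₀ D.2.2) (phi θ₀ β₀ D.2.2 (oracleH p θ₀ β₀ D.2.2)) θ₀|} with hE2
  set E3 : Set (Obs n d) := {D | κ / 2 * n ≤
      |∑ i, (infoTerm p θ₀ β₀ D.2.2 i (D.2.1 i) - condInfo p θ₀ β₀ D.2.2 i)|} with hE3
  set Eθ : Set (Obs n d) := {D | V ≤
      |∑ i, thetaEffect p θ₀ β₀ D.2.2 i (D.1 i, D.2.1 i)|} with hEθ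
  set Ej : Fin d → Set (Obs n d) := fun j => {D | V ≤
      |∑ i, D.2.2 i j * predEffect p θ₀ β₀ D.2.2 i (D.1 i, D.2.1 i)|} with hEj
  set E4 : Set (Obs n d) := {D | ¬ (thetaBetaPosterior π Pβ D).real
      {w | R₁ ≤ l1Dist w (θ₀, β₀) ∨ R' ≤ l2Dist w (θ₀, β₀)} ≤ B₁} with hE4
  set E5 : Set (Obs n d) := {D | ¬ (gammaPosterior Pγ D).real {γ | ∃ i, R₂ ≤
      |Real.log (odds (Real.sigmoid (D.2.2 i ⬝ᵥ γ)) / odds (p i (D.2.2 i)))|} ≤ B₂} with hE5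
  set E6 : Set (Obs n d) := {D | ENNReal.ofReal (ε / 8) ≤
      gammaPosterior Pγ D {γ | (D, γ) ∈ largePropEffect p θ₀ β₀ R₂ T}} with hE6
  have b0 : μ.real E0 = 0 := dataLaw_unbounded_design hp θ₀ β₀ Q hpm hz
  have b1 : μ.real E1 = _ := dataLaw_small_info hp θ₀ β₀ Q hpm κ
  have b2 : μ.real E2 ≤ _ := toR (by positivity) (dataLaw_score_large hp θ₀ β₀ Q hpm hn hK)
  have b3 : μ.real E3 ≤ _ := toR (by positivity)
    (dataLaw_info_fluctuation hp θ₀ β₀ Q hpm hn (k := κ / 2) (by positivity))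
  have bθ : μ.real Eθ ≤ _ := toR (by positivity)
    (dataLaw_thetaEffect_large hp θ₀ β₀ Q hpm hn hc3 hl)
  have bj : μ.real (⋃ j, Ej j) ≤ d * (2 * Real.exp (-(2 * l))) := by
    refine (measureReal_iUnion_fintype_le _).trans ?_
    calc ∑ j, μ.real (Ej j) ≤ ∑ _j : Fin d, 2 * Real.exp (-(2 * l)) :=
          Finset.sum_le_sum fun j _ => toR (by positivity)
            (dataLaw_predEffect_large hp θ₀ β₀ Q hpm hn hz hc0 hcC hl j)
      _ = _ := by simp
  have b4 : μ.real E4 ≤ q₁ := dataLaw_thetaBetaPosterior_compl hp θ₀ β₀ Q hpm h1 Pβ hβ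
  have b5 : μ.real E5 ≤ q₂ := dataLaw_gammaPosterior_compl hp θ₀ β₀ Q hpm Pγ hγ
  have b6 : μ.real E6 ≤ _ := toR (by positivity)
    (dataLaw_largePropEffect hp θ₀ β₀ Q hpm hn Pγ hR₂ (t := T) (by positivity)
      (show 0 < ε / 8 by positivity))
  have hsub : {D | ε ≤ |thetaPosteriorProb π Pβ Pγ D
          (Set.Ioo (θhat D + a * oracleSigma p θ₀ β₀ D (θhat D))
            (θhat D + b * oracleSigma p θ₀ β₀ D (θhat D))) - gaussProb a b|}
      ⊆ E0 ∪ (E1 ∪ (E2 ∪ (E3 ∪ (Eθ ∪ ((⋃ j, Ej j) ∪ (E4 ∪ (E5 ∪ E6))))))) := by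
    intro D hD
    by_contra hcon
    simp only [Set.mem_union, Set.mem_iUnion, not_or, not_exists] at hcon
    obtain ⟨n0, n1, n2, n3, nθ, nj, n4, n5, n6⟩ := hcon
    simp only [hE0, hE1, hE2, hE3, hEθ, hEj, hE4, hE5, hE6, Set.mem_ofPred_eq, not_not, not_le]
      at n0 n1 n2 n3 nθ nj n4 n5 n6
    have := isProbabilityMeasure_gammaPosterior Pγ D
    have hI : κ / 2 * n ≤ obsInfo D (oracleH p θ₀ β₀ D.2.2)
        (phi θ₀ β₀ D.2.2 (oracleH p θ₀ β₀ D.2.2)) θ₀ := by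
      rw [obsInfo_oracle_eq]
      rw [not_lt, le_div_iff₀ hn'] at n1
      rw [Finset.sum_sub_distrib] at n3
      linarith [(abs_lt.1 n3).1]
    have hG := gaussProb_mem_Icc hab
    -- The error budget is `ε / 4` for the Laplace approximation and `ε / 8` for each of the three
    -- kinds of bad draws, which stays below `ε`.
    have hfin := abs_thetaPosteriorProb_sub_le hm h0 h1 D Pβ Pγ
      (Set.Ioo (θhat D + a * oracleSigma p θ₀ β₀ D (θhat D))
            (θhat D + b * oracleSigma p θ₀ β₀ D (θhat D))) hG.1 hG.2
      (show 0 ≤ ε / 4 by positivity)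
      (W := {w | R₁ ≤ l1Dist w (θ₀, β₀) ∨ R' ≤ l2Dist w (θ₀, β₀)})
      (Γ := {γ | ∃ i, R₂ ≤
        |Real.log (odds (Real.sigmoid (D.2.2 i ⬝ᵥ γ)) / odds (p i (D.2.2 i)))|}
        ∪ {γ | (D, γ) ∈ largePropEffect p θ₀ β₀ R₂ T}) fun γ hγ w hw => by
        rw [Set.mem_union, not_or] at hγ
        simp only [Set.mem_ofPred_eq, not_or, not_le] at hw
        have hγ1 : ∀ i, |logitErr p D.2.2 γ i| ≤ R₂ := fun i => by
          have := hγ.1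
          simp only [Set.mem_ofPred_eq, not_exists, not_le] at this
          have := this i
          rw [log_odds_sigmoid_div_eq D.2.2 γ i (hp _ _)] at this
          exact this.le
        have hγ2 : |∑ i, projSlope p θ₀ β₀ D.2.2 i * logitErr p D.2.2 γ i
            * resid θ₀ β₀ D.2.2 i (D.1 i, D.2.1 i)| ≤ T := by
          by_contra! hlt
          exact hγ.2 ⟨hγ1, hlt.le⟩
        obtain ⟨hs, hi⟩ := score_obsInfo_close hp θ₀ β₀ hC n0 nθ.le (fun j => (nj j).le)
          hw.1.le hγ1 hγ2 hρ₁ hρ₂ hnum hnum'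
        exact hratio D _ _ (abs_val_sub_oracleH_le hp θ₀ β₀ D) n2.le hI (θhat D) (hθhat D) _ rfl
          _ _ (abs_val_sub_sampleH_le D w.1 w.2 γ) hs hi
    have hΓ := (measureReal_union_le (μ := gammaPosterior Pγ D) {γ | ∃ i, R₂ ≤
        |Real.log (odds (Real.sigmoid (D.2.2 i ⬝ᵥ γ)) / odds (p i (D.2.2 i)))|}
        {γ | (D, γ) ∈ largePropEffect p θ₀ β₀ R₂ T})
    have hΓ2 : (gammaPosterior Pγ D).real {γ | (D, γ) ∈ largePropEffect p θ₀ β₀ R₂ T} ≤ ε / 8 :=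
      ENNReal.toReal_le_of_le_ofReal (by positivity) n6.le
    rw [Set.mem_ofPred_eq] at hD
    rw [not_lt] at n4 n5
    linarith
  -- Since `θhat` is arbitrary, the event of failure need not be measurable; monotonicity of the
  -- outer measure suffices.
  refine (measureReal_mono hsub).trans ?_
  have u0 := measureReal_union_le (μ := μ) E0
    (E1 ∪ (E2 ∪ (E3 ∪ (Eθ ∪ ((⋃ j, Ej j) ∪ (E4 ∪ (E5 ∪ E6)))))))
  have u1 := measureReal_union_le (μ := μ) E1
    (E2 ∪ (E3 ∪ (Eθ ∪ ((⋃ j, Ej j) ∪ (E4 ∪ (E5 ∪ E6))))))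
  have u2 := measureReal_union_le (μ := μ) E2 (E3 ∪ (Eθ ∪ ((⋃ j, Ej j) ∪ (E4 ∪ (E5 ∪ E6)))))
  have u3 := measureReal_union_le (μ := μ) E3 (Eθ ∪ ((⋃ j, Ej j) ∪ (E4 ∪ (E5 ∪ E6))))
  have u4 := measureReal_union_le (μ := μ) Eθ ((⋃ j, Ej j) ∪ (E4 ∪ (E5 ∪ E6)))
  have u5 := measureReal_union_le (μ := μ) (⋃ j, Ej j) (E4 ∪ (E5 ∪ E6))
  have u6 := measureReal_union_le (μ := μ) E4 (E5 ∪ E6)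
  have u7 := measureReal_union_le (μ := μ) E5 E6
  linarith

end ExceptionalSet

/-! ### Rates -/

/-- Since `r √(n l) = l`, the pairing term is of order `s l` and the remainder of order `s² l`. The
assumption `s ≥ 1` merges them and absorbs the propensity rate, which carries no factor `s`. -/
lemma rate_conditions {M M' C c τ : ℝ} (hM : 0 < M) (hM' : 0 < M') (hC : 0 < C) (hc : 0 < c)
    (hτ : 0 < τ) : ∃ η > 0, ∀ (n : ℕ) (s l : ℝ), 0 < n → 1 ≤ s → 0 ≤ l →
      s ^ 2 * l ≤ η * Real.sqrt n → ∀ r, r = Real.sqrt (l / n) →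
      M' * r ≤ ((1 + C) * M + M') * (s * r) ∧
      M * s * r * (2 * c * Real.sqrt (n * l))
        + n * (102 * (((1 + C) * M + M') * (s * r)) ^ 2) ≤ τ / 2 * Real.sqrt n ∧
      18 * (((1 + C) * M + M') * (s * r)) ≤ τ := by
  set A := (1 + C) * M + M' with hA
  have hA0 : 0 < A := by positivity
  set B := 2 * c * M + 102 * A ^ 2 with hB
  have hB0 : 0 < B := by positivity
  -- The first entry serves the score; the second, with `324 = 18²`, serves the information
  -- condition after squaring.
  refine ⟨min (τ / 2 / B) (τ ^ 2 / (324 * A ^ 2)), by positivity, ?_⟩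
  intro n s l hn hs hl hq r hr
  have hn' : (0 : ℝ) < n := by exact_mod_cast hn
  have hr0 : 0 ≤ r := hr ▸ Real.sqrt_nonneg _
  have hr2 : r ^ 2 = l / n := by rw [hr, Real.sq_sqrt (by positivity)]
  have hsn : 1 ≤ Real.sqrt n := Real.one_le_sqrt.2 (by exact_mod_cast hn)
  have hsn2 : Real.sqrt n ^ 2 = n := Real.sq_sqrt hn'.le
  have hq1 : s ^ 2 * l ≤ τ / 2 / B * Real.sqrt n :=
    hq.trans (mul_le_mul_of_nonneg_right (min_le_left _ _) (by positivity))
  have hq2 : s ^ 2 * l ≤ τ ^ 2 / (324 * A ^ 2) * Real.sqrt n :=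
    hq.trans (mul_le_mul_of_nonneg_right (min_le_right _ _) (by positivity))
  have hrl : r * Real.sqrt (n * l) = l := by
    rw [hr, ← Real.sqrt_mul (by positivity), show l / n * (n * l) = l ^ 2 by field_simp,
      Real.sqrt_sq hl]
  refine ⟨?_, ?_, ?_⟩
  · calc M' * r ≤ A * (1 * r) := by
          rw [one_mul]; gcongr; rw [hA]; nlinarith
      _ ≤ A * (s * r) := by gcongr
  · have e1 : M * s * r * (2 * c * Real.sqrt (n * l)) = 2 * c * M * (s * l) := by
      rw [show M * s * r * (2 * c * Real.sqrt (n * l))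
        = 2 * c * M * s * (r * Real.sqrt (n * l)) by ring, hrl]; ring
    have e2 : n * (102 * (A * (s * r)) ^ 2) = 102 * A ^ 2 * (s ^ 2 * l) := by
      rw [mul_pow, mul_pow, hr2]; field_simp
    have e3 : s * l ≤ s ^ 2 * l := by
      gcongr; nlinarith
    rw [e1, e2]
    calc 2 * c * M * (s * l) + 102 * A ^ 2 * (s ^ 2 * l)
        ≤ 2 * c * M * (s ^ 2 * l) + 102 * A ^ 2 * (s ^ 2 * l) := by gcongr
      _ = B * (s ^ 2 * l) := by rw [hB]; ring
      _ ≤ B * (τ / 2 / B * Real.sqrt n) := by gcongr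
      _ = _ := by field_simp
  · refine le_of_sq_le_sq ?_ hτ.le
    have e : (18 * (A * (s * r))) ^ 2 = 324 * A ^ 2 * (s ^ 2 * l) / n := by
      rw [mul_pow, mul_pow, mul_pow, hr2]; field_simp; ring
    rw [e, div_le_iff₀ hn']
    calc 324 * A ^ 2 * (s ^ 2 * l) ≤ 324 * A ^ 2 * (τ ^ 2 / (324 * A ^ 2) * Real.sqrt n) := by
          gcongr
      _ = τ ^ 2 * Real.sqrt n := by field_simp
      _ ≤ τ ^ 2 * n := by gcongr; nlinarith

/-- The Hoeffding exponent is proportional to `n / l`, hence at least a multiple of `√n`. -/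
lemma prop_tail_le {n : ℕ} {M ε l τ : ℝ} (hn : 0 < n) (hM : 0 < M) (hε : 0 < ε) (hl : 0 < l)
    (hln : l ≤ Real.sqrt n) :
    2 * Real.exp (-((τ / 2 * Real.sqrt n) ^ 2 / (2 * (n * (M * Real.sqrt (l / n)) ^ 2))))
        / (ε / 8)
      ≤ 2 * Real.exp (-(τ ^ 2 / (8 * M ^ 2) * Real.sqrt n)) / (ε / 8) := by
  have hn0 : (0 : ℝ) < n := by exact_mod_cast hn
  have e : (τ / 2 * Real.sqrt n) ^ 2 / (2 * (n * (M * Real.sqrt (l / n)) ^ 2))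
      = τ ^ 2 / (8 * M ^ 2) * (n / l) := by
    rw [mul_pow, mul_pow, Real.sq_sqrt hn0.le, Real.sq_sqrt (by positivity)]
    field_simp; norm_num
  rw [e]
  have h : Real.sqrt n ≤ n / l := by
    rw [le_div_iff₀ hl]
    calc Real.sqrt n * l ≤ Real.sqrt n * Real.sqrt n := by gcongr
      _ = n := Real.mul_self_sqrt hn0.le
  gcongr

lemma natCast_le_dvn (d n : ℕ) : (n : ℝ) ≤ dvn d n := by
  unfold dvn; exact_mod_cast le_max_right d n

lemma tendsto_dvn (d : ℕ → ℕ) : Tendsto (fun n => dvn (d n) n) atTop atTop :=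
  tendsto_atTop_mono (fun n => natCast_le_dvn (d n) n) tendsto_natCast_atTop_atTop

lemma tendsto_dvn_rpow_neg (d : ℕ → ℕ) {c : ℝ} (hc : 0 < c) :
    Tendsto (fun n => dvn (d n) n ^ (-c)) atTop (𝓝 0) :=
  (tendsto_rpow_neg_atTop hc).comp (tendsto_dvn d)

/-- The sum is at most `4 / (d ∨ n)`, which vanishes whatever the growth of `d`. -/
lemma tendsto_union_bound (d : ℕ → ℕ) :
    Tendsto (fun n => ((d n : ℝ) + 1) * (2 * Real.exp (-(2 * Real.log (dvn (d n) n)))))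
      atTop (𝓝 0) := by
  have h4 : Tendsto (fun n => 4 * (dvn (d n) n)⁻¹) atTop (𝓝 0) := by
    simpa using (tendsto_inv_atTop_zero.comp (tendsto_dvn d)).const_mul 4
  refine squeeze_zero' (Eventually.of_forall fun n => by positivity) ?_ h4
  filter_upwards [eventually_ge_atTop 1] with n hn
  have h1 : (1 : ℝ) ≤ dvn (d n) n := le_trans (by exact_mod_cast hn) (natCast_le_dvn (d n) n)
  have hd : (d n : ℝ) ≤ dvn (d n) n := by unfold dvn; exact_mod_cast le_max_left _ _
  have h0 : 0 < dvn (d n) n := by linarith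
  rw [show -(2 * Real.log (dvn (d n) n)) = -Real.log (dvn (d n) n) + -Real.log (dvn (d n) n) by
    ring, Real.exp_add, Real.exp_neg, Real.exp_log h0]
  calc ((d n : ℝ) + 1) * (2 * ((dvn (d n) n)⁻¹ * (dvn (d n) n)⁻¹))
      ≤ (2 * dvn (d n) n) * (2 * ((dvn (d n) n)⁻¹ * (dvn (d n) n)⁻¹)) := by
        gcongr; linarith
    _ = _ := by field_simp; norm_num

end LogisticCP

open LogisticCP

theorem theorem1
    -- dimensions, true parameters, design laws and propensity scores
    (d : ℕ → ℕ) (θ₀ : ℝ) (β₀ : ∀ n, Fin (d n) → ℝ)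
    (Q : ∀ n, Measure (Fin n → Fin (d n) → ℝ)) (hQ : ∀ n, IsProbabilityMeasure (Q n))
    (p : ∀ n, Fin n → (Fin (d n) → ℝ) → ℝ) (hp_meas : ∀ n i, Measurable (p n i))
    (hp : ∀ n i z, p n i z ∈ Set.Ioo (0 : ℝ) 1)
    -- priors on `θ` (a density), on `β` and on `γ`
    (π : ℝ → ℝ) (hπ_meas : Measurable π) (hπ_nonneg : ∀ t, 0 ≤ π t)
    (hπ_one : ∫⁻ t, ENNReal.ofReal (π t) = 1)
    (Pβ Pγ : ∀ n, Measure (Fin (d n) → ℝ))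
    (hPβ : ∀ n, IsProbabilityMeasure (Pβ n)) (hPγ : ∀ n, IsProbabilityMeasure (Pγ n))
    -- growth of the dimension
    (A1 : (fun n => Real.log (d n)) =o[atTop] fun n : ℕ => (n : ℝ))
    -- bounded nuisance covariates
    (A2 : ∃ C > 0, ∀ n, ∀ᵐ z ∂(Q n), ∀ i j, |z i j| ≤ C)
    -- sparsity
    (A3 : (fun n => (numNonzero (β₀ n) : ℝ) ^ 2 * Real.log (dvn (d n) n))
      =o[atTop] fun n : ℕ => Real.sqrt n)
    -- concentration of the conditional posterior of the nuisance parameters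
    (A4 : ∃ M C c : ℝ, 0 < M ∧ 0 < C ∧ 0 < c ∧ ∀ᶠ n in atTop,
      1 - dvn (d n) n ^ (-c) ≤ (dataLaw (Q n) (p n) θ₀ (β₀ n)).real
        {D | (thetaBetaPosterior π (Pβ n) D).real
            {w | M * numNonzero (β₀ n) * rate (d n) n ≤ l1Dist w (θ₀, β₀ n) ∨
              M * Real.sqrt (numNonzero (β₀ n)) * rate (d n) n ≤ l2Dist w (θ₀, β₀ n)}
          ≤ C * dvn (d n) n ^ (-c)})
    -- concentration of the estimated propensity scores
    (A5 : ∃ M C c : ℝ, 0 < M ∧ 0 < C ∧ 0 < c ∧ ∀ᶠ n in atTop,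
      1 - dvn (d n) n ^ (-c) ≤ (dataLaw (Q n) (p n) θ₀ (β₀ n)).real
        {D | (gammaPosterior (Pγ n) D).real
            {γ | ∃ i, M * rate (d n) n ≤
              |Real.log (odds (Real.sigmoid (D.2.2 i ⬝ᵥ γ)) / odds (p n i (D.2.2 i)))|}
          ≤ C * dvn (d n) n ^ (-c)})
    -- prior of the parameter of interest
    (A6 : ContinuousAt π θ₀ ∧ 0 < π θ₀)
    -- the average Fisher information in the oracle likelihood does not degenerate
    (hInfo : ∃ κ > 0, Tendsto (fun n : ℕ => (Q n).real
      {z | κ ≤ (∑ i, condInfo (p n) θ₀ (β₀ n) z i) / n}) atTop (𝓝 1))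
    -- the oracle maximum likelihood estimator: a maximizer whenever there is one
    (θhat : ∀ n, Obs n (d n) → ℝ)
    (hθhat : ∀ n D, (∃ t, IsMaxOn (oracleLogLik (p n) θ₀ (β₀ n) D) Set.univ t) →
      IsMaxOn (oracleLogLik (p n) θ₀ (β₀ n) D) Set.univ (θhat n D))
    (a b : ℝ) (hab : a < b) :
    ∀ ε > 0, Tendsto (fun n : ℕ => (dataLaw (Q n) (p n) θ₀ (β₀ n)).real
      {D | ε ≤ |thetaPosteriorProb π (Pβ n) (Pγ n) D
          (Set.Ioo (θhat n D + a * oracleSigma (p n) θ₀ (β₀ n) D (θhat n D))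
            (θhat n D + b * oracleSigma (p n) θ₀ (β₀ n) D (θhat n D)))
          - 1 / Real.sqrt (2 * Real.pi) * ∫ u in a..b, Real.exp (-(1 / 2) * u ^ 2)|})
      atTop (𝓝 0) := by
  intro ε hε
  obtain ⟨C, hC, hz⟩ := A2
  obtain ⟨M₁, C₁, c₁, hM₁, hC₁, hc₁, hA4⟩ := A4
  obtain ⟨M₂, C₂, c₂, hM₂, hC₂, hc₂, hA5⟩ := A5
  obtain ⟨κ, hκ, hI⟩ := hInfo
  have hexpK : Tendsto (fun K : ℝ => 2 * Real.exp (-(K ^ 2 / 2))) atTop (𝓝 0) := by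
    have h : Tendsto (fun K : ℝ => K ^ 2 / 2) atTop atTop :=
      (tendsto_pow_atTop two_ne_zero).atTop_div_const (by norm_num)
    simpa using (Real.tendsto_exp_neg_atTop_nhds_zero.comp h).const_mul 2
  refine tendsto_order.2 ⟨fun x hx => Eventually.of_forall fun n =>
    hx.trans_le measureReal_nonneg, fun δ hδ => ?_⟩
  -- The tail of the oracle score does not vanish with `n`, so `K` is fixed first to make it less
  -- than `δ / 2`. Then `τ` depends on `K`, and the rate constant `η` on `τ`.
  obtain ⟨K, hK, hKδ⟩ := ((eventually_gt_atTop (0 : ℝ)).and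
    (hexpK.eventually_lt_const (show 0 < δ / 2 by positivity))).exists
  obtain ⟨τ, hτ, hratio⟩ := posterior_ratio_close hπ_meas hπ_nonneg hπ_one A6.1 A6.2 hab
    (show 0 < ε / 4 by positivity) hK (show 0 < κ / 2 by positivity)
  -- One constant dominates both `3`, the bound on `thetaEffect`, and `3 * C`, the bound on `Z i j *
  -- predEffect`.
  set c := 3 * (C + 1) with hc
  obtain ⟨η, hη, hrate⟩ := rate_conditions hM₁ hM₂ hC (show 0 < c by positivity) hτ
  have hq₁ := tendsto_dvn_rpow_neg d hc₁
  have hq₂ := tendsto_dvn_rpow_neg d hc₂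
  have hB₁ : Tendsto (fun n => C₁ * dvn (d n) n ^ (-c₁)) atTop (𝓝 0) := by
    simpa using hq₁.const_mul C₁
  have hB₂ : Tendsto (fun n => C₂ * dvn (d n) n ^ (-c₂)) atTop (𝓝 0) := by
    simpa using hq₂.const_mul C₂
  have hinfo : Tendsto (fun n : ℕ => 1 - (Q n).real
      {z | κ ≤ (∑ i, condInfo (p n) θ₀ (β₀ n) z i) / n}) atTop (𝓝 0) := by
    simpa using hI.const_sub 1
  have hfluct : Tendsto (fun n : ℕ => 2 * Real.exp (-((κ / 2) ^ 2 / 2 * n))) atTop (𝓝 0) := by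
    have h : Tendsto (fun n : ℕ => (κ / 2) ^ 2 / 2 * (n : ℝ)) atTop atTop :=
      tendsto_natCast_atTop_atTop.const_mul_atTop (by positivity)
    simpa using (Real.tendsto_exp_neg_atTop_nhds_zero.comp h).const_mul 2
  have hprop : Tendsto (fun n : ℕ => 2 * Real.exp (-(τ ^ 2 / (8 * M₂ ^ 2) * Real.sqrt n)) / (ε / 8))
      atTop (𝓝 0) := by
    have h : Tendsto (fun n : ℕ => τ ^ 2 / (8 * M₂ ^ 2) * Real.sqrt n) atTop atTop :=
      (Real.tendsto_sqrt_atTop.comp tendsto_natCast_atTop_atTop).const_mul_atTop (by positivity)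
    simpa using ((Real.tendsto_exp_neg_atTop_nhds_zero.comp h).const_mul 2).div_const (ε / 8)
  have hsum := ((((hinfo.add hfluct).add (tendsto_union_bound d)).add hq₁).add hq₂).add hprop
  simp only [add_zero] at hsum
  -- A3 enters twice: with constant `η` for the rate conditions, and with constant one to obtain
  -- `log (d ∨ n) ≤ √n`. Taking `n ≥ 2` makes the logarithm positive.
  filter_upwards [hA4, hA5, hratio, hB₁.eventually_lt_const (show 0 < ε / 8 by positivity),
    hB₂.eventually_lt_const (show 0 < ε / 8 by positivity),
    hB₁.eventually_lt_const one_pos, hq₁.eventually_lt_const one_pos,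
    A3.def hη, A3.def one_pos, eventually_ge_atTop 2,
    hsum.eventually_lt_const (show 0 < δ / 2 by positivity)]
    with n h4 h5 hrat hb1 hb2 hb1' hq1' ha3 ha3' hn2 hlt
  have := hQ n
  have := hPβ n
  have := hPγ n
  have hn : 0 < n := by omega
  have hn' : (2 : ℝ) ≤ n := by exact_mod_cast hn2
  have hs : (1 : ℝ) ≤ numNonzero (β₀ n) := by
    exact_mod_cast numNonzero_pos_of_contraction θ₀ (β₀ n) (Q n) hπ_one (Pβ n) hb1' hq1' h4
  set l := Real.log (dvn (d n) n) with hl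
  have hl0 : 0 < l := Real.log_pos (by linarith [natCast_le_dvn (d n) n])
  have hsl : 0 ≤ (numNonzero (β₀ n) : ℝ) ^ 2 * l := by positivity
  rw [Real.norm_of_nonneg hsl, Real.norm_of_nonneg (Real.sqrt_nonneg _)] at ha3 ha3'
  set r := rate (d n) n with hr
  have hr0 : 0 < r := Real.sqrt_pos.2 (by positivity)
  obtain ⟨hr1, hr2, hr3⟩ := hrate n (numNonzero (β₀ n)) l hn hs hl0.le ha3 r rfl
  have hbound := dataLaw_posterior_far_le (hp n) θ₀ (β₀ n) (Q n) (hp_meas n) hπ_meas hπ_nonneg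
    hπ_one (Pβ n) (Pγ n) hab hn hε hK.le hκ hτ hC.le (c := c) (by rw [hc]; linarith)
    (by rw [hc]; linarith) hl0.le (mul_pos hM₂ hr0) (hz n) (hrat (d n)) h4 h5 hb1.le hb2.le
    (by
      have : 0 ≤ M₂ * (numNonzero (β₀ n) * r) := by positivity
      linarith) hr1 hr2 hr3 (θhat n) (hθhat n)
  refine hbound.trans_lt ?_
  have hls : l ≤ Real.sqrt n := by
    calc l = 1 * l := (one_mul l).symm
      _ ≤ (numNonzero (β₀ n) : ℝ) ^ 2 * l := by gcongr; exact one_le_pow₀ hs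
      _ ≤ Real.sqrt n := by rwa [one_mul] at ha3'
  have hexp := prop_tail_le (ε := ε) (τ := τ) hn hM₂ hε hl0 hls
  rw [show Real.sqrt (l / n) = r from rfl] at hexp
  linarith only [hexp, hlt, hKδ]
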